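/- Let $V=[n]$, and call $F:2^V\to\mathbb R$ submodular if $F(A\cup\{i\})-F(A)\ge F(B\cup\{i\})-F(B)$ for all $A\subseteq B\subseteq V$ and $i\in V\setminus B$. An evaluation oracle for $F$ is given a linked list storing a permutation $P=(P_1,\dots,P_n)$ of $V$ and an integer $0\le i\le n$, and returns $F(P[i])$, where $P[i]=\{P_1,\dots,P_i\}$ and $P[0]=\varnothing$. The model of computation is a randomized random access machine with exact real arithmetic: a program is a finite text; memory consists of registers and arrays of natural numbers (with addition, truncated subtraction, halving and comparison) and of real numbers (with $+,-,\times,/$ and comparison, and no rounding), initially zero except for the input; it can toss coins with any computed bias $p\in[0,1]$ and query the oracle on a linked list held in memory. An elementary operation takes time $1$ and a query takes time $\mathrm{EO}\ge 1$ (in addition to the elementary operations that prepare it). **Theorem.** There are one program and constants $C>0$ and $k\in\mathbb N$ such that the following holds for every $n\ge 0$, every submodular $F:2^V\to[-1,1]$ on $V=[n]$, every evaluation oracle for $F$, every real $\epsilon>0$ and every $\mathrm{EO}\ge1$. On input $n$ and $\epsilon$, and with access to the oracle, the program halts on all outcomes of its coins of positive probability, it outputs a random set $\bar S\subseteq V$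 with $$\mathbb E[F(\bar S)]\le \min_{S\subseteq V}F(S)+\epsilon ,$$ and its running time is, on all outcomes of positive probability, at most $$C\,\bigl(\log(n+2)\bigr)^{k}\cdot\max\Bigl\{1,\frac{n^{3/2}}{\epsilon^{2}}\Bigr\}\cdot \mathrm{EO},$$ that is, $\widetilde O\bigl(n^{3/2}/\epsilon^2\cdot \mathrm{EO}\bigr)$, where $\widetilde O$ hides factors polylogarithmic in $n$. -/

import Mathlib

/-! ### Submodular functions, permutations and evaluation oracles -/

/-- Diminishing returns: for `A ⊆ B` and `i ∉ B`,
`F (A ∪ {i}) - F A ≥ F (B ∪ {i}) - F B`. The ground set is `V = Fin n`. -/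
def IsSubmodular {n : ℕ} (F : Finset (Fin n) → ℝ) : Prop :=
  ∀ A B : Finset (Fin n), A ⊆ B → ∀ i : Fin n, i ∉ B →
    F (insert i B) - F B ≤ F (insert i A) - F A

/-- `P[i]`: the set of the first `i` elements of the ordering `P 0, P 1, …, P (n - 1)`. -/
def prefixSet {n : ℕ} (P : Equiv.Perm (Fin n)) (i : ℕ) : Finset (Fin n) :=
  Finset.univ.filter fun v => ((P.symm v : Fin n) : ℕ) < i

/-- The linked list with first cell `head` and successor table `next` runs through the
elements `P 0, P 1, …, P (n - 1)` in this order. -/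
def StoresPerm {n : ℕ} (next : ℕ → ℕ) (head : ℕ) (P : Equiv.Perm (Fin n)) : Prop :=
  (∀ j : Fin n, (j : ℕ) = 0 → head = (P j : ℕ)) ∧
  (∀ j k : Fin n, (k : ℕ) = (j : ℕ) + 1 → next (P j : ℕ) = (P k : ℕ))

/-- An oracle receives a linked list (a successor table and a first cell) and an index, and
answers with a real number. -/
abbrev Oracle : Type := (ℕ → ℕ) → ℕ → ℕ → ℝ

/-- `O` is an evaluation oracle for `F`: on a linked list storing a permutation `P` and an
index `i ≤ n` it returns `F (P[i])`. Nothing is known about its answers to other queries. -/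
def IsEvalOracle {n : ℕ} (F : Finset (Fin n) → ℝ) (O : Oracle) : Prop :=
  ∀ (next : ℕ → ℕ) (head : ℕ) (P : Equiv.Perm (Fin n)), StoresPerm next head P →
    ∀ i : ℕ, i ≤ n → O next head i = F (prefixSet P i)

/-! ### A randomized random access machine with real arithmetic and an oracle

The memory consists of registers and unbounded arrays holding natural numbers, and of
registers and unbounded arrays holding real numbers. Programs are finite texts. -/

/-- Expressions for natural numbers: numerals, registers, array cells, addition, truncated
subtraction and halving (rounded down). -/
inductive NExp : Type
  | const (k : ℕ) : NExp
  | var (x : ℕ) : NExp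
  | get (a : ℕ) (i : NExp) : NExp
  | add (e₁ e₂ : NExp) : NExp
  | sub (e₁ e₂ : NExp) : NExp
  | half (e : NExp) : NExp

/-- Expressions for real numbers: natural numbers, registers, array cells and the four
arithmetic operations (division by zero gives zero). There is no rounding of reals. -/
inductive RExp : Type
  | ofNat (e : NExp) : RExp
  | var (x : ℕ) : RExp
  | get (a : ℕ) (i : NExp) : RExp
  | add (e₁ e₂ : RExp) : RExp
  | sub (e₁ e₂ : RExp) : RExp
  | mul (e₁ e₂ : RExp) : RExp
  | div (e₁ e₂ : RExp) : RExp

/-- Tests: comparisons of natural numbers and of real numbers, and Boolean combinations. -/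
inductive BExp : Type
  | nlt (e₁ e₂ : NExp) : BExp
  | rlt (e₁ e₂ : RExp) : BExp
  | not (b : BExp) : BExp
  | and (b₁ b₂ : BExp) : BExp

/-- Programs. `query x a h i` stores in the real register `x` the oracle's answer for the
linked list with successor table the natural number array `a` and first cell `h`, and the
index `i`. `flip x p` stores in the natural number register `x` the result (`1` or `0`) of a
fresh coin that shows `1` with probability `p`. -/
inductive Cmd : Type
  | skip : Cmd
  | nset (x : ℕ) (e : NExp) : Cmd
  | nput (a : ℕ) (i e : NExp) : Cmd
  | rset (x : ℕ) (e : RExp) : Cmd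
  | rput (a : ℕ) (i : NExp) (e : RExp) : Cmd
  | query (x a : ℕ) (h i : NExp) : Cmd
  | flip (x : ℕ) (p : RExp) : Cmd
  | seq (c d : Cmd) : Cmd
  | ite (b : BExp) (c d : Cmd) : Cmd
  | loop (b : BExp) (c : Cmd) : Cmd

/-- A state of the machine: its memory, the number of elementary steps executed so far, and
the number of oracle queries made so far. -/
@[ext]
structure State : Type where
  nreg : ℕ → ℕ
  narr : ℕ → ℕ → ℕ
  rreg : ℕ → ℝ
  rarr : ℕ → ℕ → ℝ
  steps : ℕ
  queries : ℕ

namespace NExp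

def eval (s : State) : NExp → ℕ
  | const k => k
  | var x => s.nreg x
  | get a i => s.narr a (eval s i)
  | add e₁ e₂ => eval s e₁ + eval s e₂
  | sub e₁ e₂ => eval s e₁ - eval s e₂
  | half e => eval s e / 2

/-- Number of elementary steps for an evaluation: one for each node. -/
def cost : NExp → ℕ
  | const _ => 1
  | var _ => 1
  | get _ i => cost i + 1
  | add e₁ e₂ => cost e₁ + cost e₂ + 1
  | sub e₁ e₂ => cost e₁ + cost e₂ + 1
  | half e => cost e + 1

end NExp

namespace RExp

noncomputable def eval (s : State) : RExp → ℝ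
  | ofNat e => (e.eval s : ℝ)
  | var x => s.rreg x
  | get a i => s.rarr a (i.eval s)
  | add e₁ e₂ => eval s e₁ + eval s e₂
  | sub e₁ e₂ => eval s e₁ - eval s e₂
  | mul e₁ e₂ => eval s e₁ * eval s e₂
  | div e₁ e₂ => eval s e₁ / eval s e₂

/-- Number of elementary steps for an evaluation: one for each node. -/
def cost : RExp → ℕ
  | ofNat e => e.cost + 1
  | var _ => 1
  | get _ i => i.cost + 1
  | add e₁ e₂ => cost e₁ + cost e₂ + 1
  | sub e₁ e₂ => cost e₁ + cost e₂ + 1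
  | mul e₁ e₂ => cost e₁ + cost e₂ + 1
  | div e₁ e₂ => cost e₁ + cost e₂ + 1

end RExp

namespace BExp

def holds (s : State) : BExp → Prop
  | nlt e₁ e₂ => e₁.eval s < e₂.eval s
  | rlt e₁ e₂ => e₁.eval s < e₂.eval s
  | not b => ¬ holds s b
  | and b₁ b₂ => holds s b₁ ∧ holds s b₂

/-- Number of elementary steps for an evaluation: one for each node. -/
def cost : BExp → ℕ
  | nlt e₁ e₂ => e₁.cost + e₂.cost + 1
  | rlt e₁ e₂ => e₁.cost + e₂.cost + 1
  | not b => cost b + 1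
  | and b₁ b₂ => cost b₁ + cost b₂ + 1

end BExp

namespace State

/-- Let `k` elementary steps pass. -/
def tick (s : State) (k : ℕ) : State := { s with steps := s.steps + k }

def setN (s : State) (x v : ℕ) : State :=
  { s with nreg := Function.update s.nreg x v }

def putN (s : State) (a i v : ℕ) : State :=
  { s with narr := Function.update s.narr a (Function.update (s.narr a) i v) }

def setR (s : State) (x : ℕ) (v : ℝ) : State :=
  { s with rreg := Function.update s.rreg x v }

def putR (s : State) (a i : ℕ) (v : ℝ) : State :=
  { s with rarr := Function.update s.rarr a (Function.update (s.rarr a) i v) }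

/-- Count one oracle query. -/
def countQuery (s : State) : State := { s with queries := s.queries + 1 }

/-- The initial state: `n` in natural number register `0`, `ε` in real register `0`, and zero
everywhere else. -/
def init (n : ℕ) (ε : ℝ) : State where
  nreg := Function.update (fun _ => 0) 0 n
  narr := fun _ _ => 0
  rreg := Function.update (fun _ => 0) 0 ε
  rarr := fun _ _ => 0
  steps := 0
  queries := 0

/-- The elapsed time when an elementary step costs `1` and an oracle query costs `EO`. -/
def time (s : State) (EO : ℝ) : ℝ := (s.steps : ℝ) + (s.queries : ℝ) * EO

/-- The output set: `v` belongs to it if cell `v` of natural number array `0` is nonzero. -/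
def output (n : ℕ) (s : State) : Finset (Fin n) :=
  Finset.univ.filter fun v => s.narr 0 (v : ℕ) ≠ 0

end State

/-- A coin showing `true` with probability `p`, where `p` is first clamped to `[0, 1]`. -/
noncomputable def coin (p : ℝ) : PMF Bool :=
  PMF.ofFintype
    (fun b => if b then ENNReal.ofReal (max 0 (min 1 p))
      else ENNReal.ofReal (1 - max 0 (min 1 p)))
    (by
      have h0 : (0 : ℝ) ≤ max 0 (min 1 p) := le_max_left _ _
      have h1 : max 0 (min 1 p) ≤ (1 : ℝ) := max_le zero_le_one (min_le_left _ _)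
      simp only [Fintype.univ_bool, Finset.mem_singleton, Bool.true_eq_false, not_false_eq_true,
        Finset.sum_insert, Finset.sum_singleton, if_true, Bool.false_eq_true, if_false]
      rw [← ENNReal.ofReal_add h0 (sub_nonneg.mpr h1)]
      simp)

/-- `Exec O c s μ`: with oracle `O`, the program `c` started in the state `s` halts on all
outcomes of its coins, and its final state has the distribution `μ`. -/
inductive Exec (O : Oracle) : Cmd → State → PMF State → Prop
  | skip (s : State) : Exec O Cmd.skip s (PMF.pure (s.tick 1))
  | nset (s : State) (x : ℕ) (e : NExp) :
      Exec O (Cmd.nset x e) s (PMF.pure ((s.setN x (e.eval s)).tick (e.cost + 1)))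
  | nput (s : State) (a : ℕ) (i e : NExp) :
      Exec O (Cmd.nput a i e) s
        (PMF.pure ((s.putN a (i.eval s) (e.eval s)).tick (i.cost + e.cost + 1)))
  | rset (s : State) (x : ℕ) (e : RExp) :
      Exec O (Cmd.rset x e) s (PMF.pure ((s.setR x (e.eval s)).tick (e.cost + 1)))
  | rput (s : State) (a : ℕ) (i : NExp) (e : RExp) :
      Exec O (Cmd.rput a i e) s
        (PMF.pure ((s.putR a (i.eval s) (e.eval s)).tick (i.cost + e.cost + 1)))
  | query (s : State) (x a : ℕ) (h i : NExp) :
      Exec O (Cmd.query x a h i) s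
        (PMF.pure (((s.setR x (O (s.narr a) (h.eval s) (i.eval s))).countQuery).tick
          (h.cost + i.cost + 1)))
  | flip (s : State) (x : ℕ) (p : RExp) :
      Exec O (Cmd.flip x p) s
        ((coin (p.eval s)).map fun b => (s.setN x (if b then 1 else 0)).tick (p.cost + 1))
  | seq (s : State) (c d : Cmd) (μ : PMF State) (ν : State → PMF State) :
      Exec O c s μ → (∀ t ∈ μ.support, Exec O d t (ν t)) →
      Exec O (Cmd.seq c d) s (μ.bind ν)
  | ite_true (s : State) (b : BExp) (c d : Cmd) (μ : PMF State) :
      b.holds s → Exec O c (s.tick (b.cost + 1)) μ → Exec O (Cmd.ite b c d) s μ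
  | ite_false (s : State) (b : BExp) (c d : Cmd) (μ : PMF State) :
      ¬ b.holds s → Exec O d (s.tick (b.cost + 1)) μ → Exec O (Cmd.ite b c d) s μ
  | loop_true (s : State) (b : BExp) (c : Cmd) (μ : PMF State) (ν : State → PMF State) :
      b.holds s → Exec O c (s.tick (b.cost + 1)) μ →
      (∀ t ∈ μ.support, Exec O (Cmd.loop b c) t (ν t)) →
      Exec O (Cmd.loop b c) s (μ.bind ν)
  | loop_false (s : State) (b : BExp) (c : Cmd) :
      ¬ b.holds s → Exec O (Cmd.loop b c) s (PMF.pure (s.tick (b.cost + 1)))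

theorem PMF.bind_eq_of_support {α β : Type*} (μ : PMF α) (f g : α → PMF β)
    (h : ∀ a ∈ μ.support, f a = g a) : μ.bind f = μ.bind g := by
  ext b
  simp only [PMF.bind_apply]
  refine tsum_congr fun a => ?_
  by_cases ha : μ a = 0
  · simp [ha]
  · rw [h a ((PMF.mem_support_iff μ a).mpr ha)]

/-- The distribution of the final state is determined by the program and the initial state. -/
theorem Exec.unique {O : Oracle} {c : Cmd} {s : State} {μ : PMF State} (h : Exec O c s μ) :
    ∀ {μ' : PMF State}, Exec O c s μ' → μ = μ' := by
  induction h with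
  | seq s c d μ ν _ _ ih₁ ih₂ =>
    intro μ' h'
    cases h' with
    | seq _ _ _ μ₁ ν₁ h₁ h₂ =>
      obtain rfl := ih₁ h₁
      exact PMF.bind_eq_of_support _ _ _ fun a ha => ih₂ a ha (h₂ a ha)
  | ite_true s b c d μ hb _ ih =>
    intro μ' h'
    cases h' with
    | ite_true _ _ _ _ _ _ h₁ => exact ih h₁
    | ite_false _ _ _ _ _ hb' _ => exact absurd hb hb'
  | ite_false s b c d μ hb _ ih =>
    intro μ' h'
    cases h' with
    | ite_true _ _ _ _ _ hb' _ => exact absurd hb' hb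
    | ite_false _ _ _ _ _ _ h₁ => exact ih h₁
  | loop_true s b c μ ν hb _ _ ih₁ ih₂ =>
    intro μ' h'
    cases h' with
    | loop_true _ _ _ μ₁ ν₁ _ h₁ h₂ =>
      obtain rfl := ih₁ h₁
      exact PMF.bind_eq_of_support _ _ _ fun a ha => ih₂ a ha (h₂ a ha)
    | loop_false _ _ _ hb' => exact absurd hb hb'
  | loop_false s b c hb =>
    intro μ' h'
    cases h' with
    | loop_true _ _ _ _ _ hb' _ _ => exact absurd hb' hb
    | loop_false _ _ _ _ => rfl
  | skip s => intro μ' h'; cases h'; rfl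
  | nset s x e => intro μ' h'; cases h'; rfl
  | nput s a i e => intro μ' h'; cases h'; rfl
  | rset s x e => intro μ' h'; cases h'; rfl
  | rput s a i e => intro μ' h'; cases h'; rfl
  | query s x a h i => intro μ' h'; cases h'; rfl
  | flip s x p => intro μ' h'; cases h'; rfl

/-! The Lovász extension of `F` is minimised over a grid with `L` steps per coordinate by a
stochastic subgradient method that moves one coordinate by one grid step per round. The elements are
kept in order of decreasing level `z`, and the subgradient at position `p` is the marginal value `gr
p` along this order. Position `p` is chosen with probability `|gr p| / 16`, and its level moves by
one against the sign of `gr p`. Let `m` be the least value of a prefix. Since `∑ |gr p| ≤ 4` and the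
extension is convex, the squared distance of the levels to `L · 1_S` changes in expectation by at
most `(4 - 2 L (m - F S)) / 16` (`descent_le`). Starting from distance at most `n L²`, the average
of `m` over `K` rounds exceeds `F S` by at most `8 n L / K + 2 / L`. Hence it suffices to stop at a
uniformly random round and to output the best prefix, with `L ≈ 16 / ε` and `K ≈ 16 n L / ε`, that
is `K = O(n / ε²)` (`mainLoop_ens`).

A round must cost about `√n`, so the `n` marginal values cannot be recomputed in it. Rounds are
grouped into epochs. At the start of an epoch the partial sums of `|gr|` along the base order `f₀`
are stored. Let `J` be the set of positions touched since then. For an untouched position `i`, the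
current and the base marginal value lie in the same interval: by submodularity, between the gain of
`f₀ i` over the untouched prefix together with all touched elements and its gain over the untouched
prefix alone (`Agree.abs_gr_le`). So `|gr G f i|` is at most the stored value plus the length of
this interval, and these bounds telescope. Their partial sums, the potential `pot`, need only two
queries each, and the total weight is at most `16`. Touched positions get extra leaves with their
exact marginal values. A random bisection over the potential finds a leaf in logarithmically many
steps, and a rejection step corrects its probability to exactly `|gr p| / 16` (`sum_leafVal`).

Both queries read one cyclic list, untouched elements in base order followed by the touched ones,
from two starting points. A move by one level exchanges two positions, because the element first
goes to the border of its level block; so a round touches at most two positions. An epoch ends when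
`|J|² ≥ n`, and rebuilding costs `O(n)`, amortised over about `√n` rounds (`round_ens`).

The randomised part is verified with `Ens`, a calculus of supermartingale certificates: each outcome
carries a nonnegative label, the expected label is bounded, and the label of a state serves as the
budget of the remaining program. -/

/-! ### Total time, instructions -/

namespace State

/-- Elementary steps and queries, counted together. -/
def tau (s : State) : ℕ := s.steps + s.queries

/-- As `EO ≥ 1`, elementary steps may be charged like queries, so one counter controls the running
time. -/
theorem time_le_tau (s : State) {EO : ℝ} (h : 1 ≤ EO) : s.time EO ≤ (s.tau : ℝ) * EO := by
  unfold time tau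
  push_cast
  nlinarith [(Nat.cast_nonneg s.steps : (0 : ℝ) ≤ s.steps)]

@[simp] theorem tick_nreg (s : State) (k : ℕ) : (s.tick k).nreg = s.nreg := rfl
@[simp] theorem tick_narr (s : State) (k : ℕ) : (s.tick k).narr = s.narr := rfl
@[simp] theorem tick_rreg (s : State) (k : ℕ) : (s.tick k).rreg = s.rreg := rfl
@[simp] theorem tick_rarr (s : State) (k : ℕ) : (s.tick k).rarr = s.rarr := rfl
@[simp] theorem tick_tau (s : State) (k : ℕ) : (s.tick k).tau = s.tau + k := by
  simp only [tau, tick]; omega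

@[simp] theorem setN_nreg (s : State) (x v y : ℕ) :
    (s.setN x v).nreg y = if y = x then v else s.nreg y := by
  simp [setN, Function.update_apply]
@[simp] theorem setN_narr (s : State) (x v : ℕ) : (s.setN x v).narr = s.narr := rfl
@[simp] theorem setN_rreg (s : State) (x v : ℕ) : (s.setN x v).rreg = s.rreg := rfl
@[simp] theorem setN_rarr (s : State) (x v : ℕ) : (s.setN x v).rarr = s.rarr := rfl
@[simp] theorem setN_tau (s : State) (x v : ℕ) : (s.setN x v).tau = s.tau := rfl

@[simp] theorem putN_nreg (s : State) (a i v : ℕ) : (s.putN a i v).nreg = s.nreg := rfl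
@[simp] theorem putN_narr (s : State) (a i v b : ℕ) :
    (s.putN a i v).narr b = if b = a then Function.update (s.narr a) i v else s.narr b := by
  simp [putN, Function.update_apply]
@[simp] theorem putN_rreg (s : State) (a i v : ℕ) : (s.putN a i v).rreg = s.rreg := rfl
@[simp] theorem putN_rarr (s : State) (a i v : ℕ) : (s.putN a i v).rarr = s.rarr := rfl
@[simp] theorem putN_tau (s : State) (a i v : ℕ) : (s.putN a i v).tau = s.tau := rfl

@[simp] theorem setR_nreg (s : State) (x : ℕ) (v : ℝ) : (s.setR x v).nreg = s.nreg := rfl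
@[simp] theorem setR_narr (s : State) (x : ℕ) (v : ℝ) : (s.setR x v).narr = s.narr := rfl
@[simp] theorem setR_rreg (s : State) (x : ℕ) (v : ℝ) (y : ℕ) :
    (s.setR x v).rreg y = if y = x then v else s.rreg y := by
  simp [setR, Function.update_apply]
@[simp] theorem setR_rarr (s : State) (x : ℕ) (v : ℝ) : (s.setR x v).rarr = s.rarr := rfl
@[simp] theorem setR_tau (s : State) (x : ℕ) (v : ℝ) : (s.setR x v).tau = s.tau := rfl

@[simp] theorem putR_nreg (s : State) (a i : ℕ) (v : ℝ) : (s.putR a i v).nreg = s.nreg := rfl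
@[simp] theorem putR_narr (s : State) (a i : ℕ) (v : ℝ) : (s.putR a i v).narr = s.narr := rfl
@[simp] theorem putR_rreg (s : State) (a i : ℕ) (v : ℝ) : (s.putR a i v).rreg = s.rreg := rfl
@[simp] theorem putR_rarr (s : State) (a i : ℕ) (v : ℝ) (b : ℕ) :
    (s.putR a i v).rarr b = if b = a then Function.update (s.rarr a) i v else s.rarr b := by
  simp [putR, Function.update_apply]
@[simp] theorem putR_tau (s : State) (a i : ℕ) (v : ℝ) : (s.putR a i v).tau = s.tau := rfl

@[simp] theorem countQuery_nreg (s : State) : s.countQuery.nreg = s.nreg := rfl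
@[simp] theorem countQuery_narr (s : State) : s.countQuery.narr = s.narr := rfl
@[simp] theorem countQuery_rreg (s : State) : s.countQuery.rreg = s.rreg := rfl
@[simp] theorem countQuery_rarr (s : State) : s.countQuery.rarr = s.rarr := rfl
@[simp] theorem countQuery_tau (s : State) : s.countQuery.tau = s.tau + 1 := rfl

end State

attribute [simp] NExp.eval RExp.eval BExp.holds NExp.cost RExp.cost BExp.cost

namespace Cmd

/-- The effect of an instruction that is not a coin, a test or a loop. -/
noncomputable def run (O : Oracle) : Cmd → State → State
  | skip, s => s.tick 1
  | nset x e, s => (s.setN x (e.eval s)).tick (e.cost + 1)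
  | nput a i e, s => (s.putN a (i.eval s) (e.eval s)).tick (i.cost + e.cost + 1)
  | rset x e, s => (s.setR x (e.eval s)).tick (e.cost + 1)
  | rput a i e, s => (s.putR a (i.eval s) (e.eval s)).tick (i.cost + e.cost + 1)
  | query x a h i, s =>
    ((s.setR x (O (s.narr a) (h.eval s) (i.eval s))).countQuery).tick (h.cost + i.cost + 1)
  | _, s => s

/-- Not a coin, a composition, a test or a loop. -/
def Atom : Cmd → Prop
  | flip _ _ => False
  | loop _ _ => False
  | seq _ _ => False
  | ite _ _ _ => False
  | _ => True

/-- Sequential composition of a list of programs. -/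
def block : List Cmd → Cmd
  | [] => skip
  | c :: l => seq c (block l)

theorem exec_run (O : Oracle) (c : Cmd) (s : State) (hc : c.Atom) :
    Exec O c s (PMF.pure (c.run O s)) := by
  cases c with
  | skip => exact Exec.skip s
  | nset x e => exact Exec.nset s x e
  | nput a i e => exact Exec.nput s a i e
  | rset x e => exact Exec.rset s x e
  | rput a i e => exact Exec.rput s a i e
  | query x a h i => exact Exec.query s x a h i
  | flip x p => exact hc.elim
  | loop b c => exact hc.elim
  | seq c d => exact hc.elim
  | ite b c d => exact hc.elim

end Cmd

/-! ### Deterministic correctness -/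

/-- Started in `s`, the program `c` halts in one state, which satisfies `Q`. -/
def Det (O : Oracle) (c : Cmd) (s : State) (Q : State → Prop) : Prop :=
  ∃ t, Exec O c s (PMF.pure t) ∧ Q t

namespace Det

variable {O : Oracle} {c d : Cmd} {s : State} {Q : State → Prop}

theorem atom (h : Q (c.run O s)) (hc : c.Atom := by trivial) : Det O c s Q :=
  ⟨_, Cmd.exec_run O c s hc, h⟩

theorem seq (h : Det O c s fun t => Det O d t Q) : Det O (Cmd.seq c d) s Q := by
  obtain ⟨t, h₁, u, h₂, h₃⟩ := h
  refine ⟨u, ?_, h₃⟩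
  have := Exec.seq s c d (PMF.pure t) (fun _ => PMF.pure u) h₁
    (fun t' ht' => by
      rw [PMF.support_pure, Set.mem_singleton_iff] at ht'
      exact ht' ▸ h₂)
  rwa [PMF.pure_bind] at this

theorem nil (h : Q (s.tick 1)) : Det O (Cmd.block []) s Q := ⟨_, Exec.skip s, h⟩

theorem cons {l : List Cmd} (h : Det O c s fun t => Det O (Cmd.block l) t Q) :
    Det O (Cmd.block (c :: l)) s Q := seq h

theorem ite {b : BExp} (h₁ : b.holds s → Det O c (s.tick (b.cost + 1)) Q)
    (h₂ : ¬ b.holds s → Det O d (s.tick (b.cost + 1)) Q) : Det O (Cmd.ite b c d) s Q := by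
  by_cases hb : b.holds s
  · obtain ⟨t, h, ht⟩ := h₁ hb
    exact ⟨t, Exec.ite_true s b c d _ hb h, ht⟩
  · obtain ⟨t, h, ht⟩ := h₂ hb
    exact ⟨t, Exec.ite_false s b c d _ hb h, ht⟩

/-- A loop with a bound `m` on the number of remaining rounds. -/
theorem loop {b : BExp} (I : ℕ → State → Prop)
    (hstep : ∀ m s, I m s → b.holds s → 0 < m ∧
      Det O c (s.tick (b.cost + 1)) (I (m - 1)))
    (hend : ∀ m s, I m s → ¬ b.holds s → Q (s.tick (b.cost + 1))) :
    ∀ m s, I m s → Det O (Cmd.loop b c) s Q := by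
  intro m
  induction m with
  | zero =>
    intro s hI
    by_cases hb : b.holds s
    · exact absurd (hstep 0 s hI hb).1 (lt_irrefl 0)
    · exact ⟨_, Exec.loop_false s b c hb, hend 0 s hI hb⟩
  | succ m ih =>
    intro s hI
    by_cases hb : b.holds s
    · obtain ⟨-, t, h₁, h₂⟩ := hstep (m + 1) s hI hb
      obtain ⟨u, h₃, h₄⟩ := ih t h₂
      refine ⟨u, ?_, h₄⟩
      have := Exec.loop_true s b c (PMF.pure t) (fun _ => PMF.pure u) hb h₁
        (fun t' ht' => by
          rw [PMF.support_pure, Set.mem_singleton_iff] at ht'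
          exact ht' ▸ h₃)
      rwa [PMF.pure_bind] at this
    · exact ⟨_, Exec.loop_false s b c hb, hend _ s hI hb⟩

end Det

/-! ### Expectations -/

/-- Started in `s`, the program `c` halts on all outcomes of its coins, and every outcome can be
labelled with a nonnegative number `x` such that `Ψ t x` holds for the final state `t` and the
expectation of the label is at most `r`. -/
def Ens (O : Oracle) (c : Cmd) (s : State) (Ψ : State → ℝ → Prop) (r : ℝ) : Prop :=
  ∃ μ : PMF (State × ℝ), Exec O c s (μ.map Prod.fst) ∧
    (∀ y ∈ μ.support, 0 ≤ y.2 ∧ Ψ y.1 y.2) ∧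
    ∑' y, μ y * ENNReal.ofReal y.2 ≤ ENNReal.ofReal r

namespace Ens

variable {O : Oracle} {c d : Cmd} {s : State} {Ψ : State → ℝ → Prop} {r : ℝ}

theorem tsum_pure {α : Type*} (t : α) (f : α → ENNReal) :
    ∑' u, (PMF.pure t) u * f u = f t := by
  rw [tsum_eq_single t]
  · simp
  · intro u hu
    simp [PMF.pure_apply, hu]

theorem tsum_bind {α β : Type*} (μ : PMF α) (ν : α → PMF β) (f : β → ENNReal) :
    ∑' u, (μ.bind ν) u * f u = ∑' t, μ t * ∑' u, ν t u * f u := by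
  simp only [PMF.bind_apply, ← ENNReal.tsum_mul_right, ← ENNReal.tsum_mul_left]
  rw [ENNReal.tsum_comm]
  simp only [mul_assoc]

/-- The common core of composition and iteration. The difficulty is that one state may occur with
several labels, hence with several chosen continuations, whereas `Exec` wants a continuation
depending on the state only. -/
theorem bind_aux {μ : PMF (State × ℝ)}
    (hμ : ∀ y ∈ μ.support, 0 ≤ y.2 ∧ Ens O d y.1 Ψ y.2)
    (hb : ∑' y, μ y * ENNReal.ofReal y.2 ≤ ENNReal.ofReal r) :
    ∃ (κ : State → PMF State) (μ' : PMF (State × ℝ)),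
      (∀ t ∈ (μ.map Prod.fst).support, Exec O d t (κ t)) ∧
      μ'.map Prod.fst = (μ.map Prod.fst).bind κ ∧
      (∀ y ∈ μ'.support, 0 ≤ y.2 ∧ Ψ y.1 y.2) ∧
      ∑' y, μ' y * ENNReal.ofReal y.2 ≤ ENNReal.ofReal r := by
  classical
  have hex : ∀ y : State × ℝ, ∃ ν : PMF (State × ℝ), y ∈ μ.support →
      Exec O d y.1 (ν.map Prod.fst) ∧ (∀ z ∈ ν.support, 0 ≤ z.2 ∧ Ψ z.1 z.2) ∧
      ∑' z, ν z * ENNReal.ofReal z.2 ≤ ENNReal.ofReal y.2 := by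
    intro y
    by_cases hy : y ∈ μ.support
    · obtain ⟨ν, h⟩ := (hμ y hy).2
      exact ⟨ν, fun _ => h⟩
    · exact ⟨PMF.pure y, fun h => absurd h hy⟩
  choose ν hν using hex
  have hκ : ∀ t : State, ∃ κ : PMF State, t ∈ (μ.map Prod.fst).support → Exec O d t κ := by
    intro t
    by_cases ht : t ∈ (μ.map Prod.fst).support
    · obtain ⟨y, hy, rfl⟩ := (PMF.mem_support_map_iff _ _ _).mp ht
      exact ⟨_, fun _ => (hν y hy).1⟩
    · exact ⟨PMF.pure t, fun h => absurd h ht⟩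
  choose κ hκ using hκ
  refine ⟨κ, μ.bind ν, hκ, ?_, ?_, ?_⟩
  · rw [PMF.map_bind, PMF.bind_map]
    refine PMF.bind_eq_of_support _ _ _ fun y hy => ?_
    -- Continuations chosen for different labels of the same state agree after forgetting labels,
    -- because executions are unique.
    exact (hν y hy).1.unique (hκ y.1 ((PMF.mem_support_map_iff _ _ _).mpr ⟨y, hy, rfl⟩))
  · intro z hz
    obtain ⟨y, hy, hz⟩ := (PMF.mem_support_bind_iff _ _ _).mp hz
    exact (hν y hy).2.1 z hz
  · rw [tsum_bind]
    refine le_trans (ENNReal.tsum_le_tsum fun y => ?_) hb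
    by_cases hy : μ y = 0
    · simp [hy]
    · gcongr
      exact (hν y ((PMF.mem_support_iff μ y).mpr hy)).2.2

theorem of_pure {t : State} (h : Exec O c s (PMF.pure t)) (hr : 0 ≤ r) (hΨ : Ψ t r) :
    Ens O c s Ψ r := by
  refine ⟨PMF.pure (t, r), ?_, ?_, ?_⟩
  · rwa [PMF.pure_map]
  · intro y hy
    rw [PMF.support_pure, Set.mem_singleton_iff] at hy
    subst hy
    exact ⟨hr, hΨ⟩
  · rw [tsum_pure]

theorem det (h : Det O c s fun t => Ψ t r) (hr : 0 ≤ r) : Ens O c s Ψ r := by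
  obtain ⟨t, h₁, h₂⟩ := h
  exact of_pure h₁ hr h₂

theorem mono_bound {r' : ℝ} (h : Ens O c s Ψ r) (hr : r ≤ r') : Ens O c s Ψ r' := by
  obtain ⟨μ, h₁, h₂, h₃⟩ := h
  exact ⟨μ, h₁, h₂, h₃.trans (ENNReal.ofReal_le_ofReal hr)⟩

/-- This rule is why `Ψ` relates a state to a label instead of fixing a function of the state: the
label reached after `c` is the budget granted to `d`. -/
theorem seq (h : Ens O c s (fun t x => Ens O d t Ψ x) r) : Ens O (Cmd.seq c d) s Ψ r := by
  obtain ⟨μ, h₁, h₂, h₃⟩ := h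
  obtain ⟨κ, μ', h₄, h₅, h₆, h₇⟩ := bind_aux h₂ h₃
  exact ⟨μ', h₅ ▸ Exec.seq s c d _ κ h₁ h₄, h₆, h₇⟩

theorem cons_det {l : List Cmd} (hr : 0 ≤ r) (h : Det O c s fun t => Ens O (Cmd.block l) t Ψ r) :
    Ens O (Cmd.block (c :: l)) s Ψ r := seq (det h hr)

theorem nil (hr : 0 ≤ r) (h : Ψ (s.tick 1) r) : Ens O (Cmd.block []) s Ψ r :=
  of_pure (Exec.skip s) hr h

theorem cons {l : List Cmd} (h : Ens O c s (fun t x => Ens O (Cmd.block l) t Ψ x) r) :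
    Ens O (Cmd.block (c :: l)) s Ψ r := seq h

theorem ite {b : BExp} (h₁ : b.holds s → Ens O c (s.tick (b.cost + 1)) Ψ r)
    (h₂ : ¬ b.holds s → Ens O d (s.tick (b.cost + 1)) Ψ r) : Ens O (Cmd.ite b c d) s Ψ r := by
  by_cases hb : b.holds s
  · obtain ⟨μ, h, h'⟩ := h₁ hb
    exact ⟨μ, Exec.ite_true s b c d _ hb h, h'⟩
  · obtain ⟨μ, h, h'⟩ := h₂ hb
    exact ⟨μ, Exec.ite_false s b c d _ hb h, h'⟩

theorem loop_true {b : BExp} (hb : b.holds s)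
    (h : Ens O c (s.tick (b.cost + 1)) (fun t x => Ens O (Cmd.loop b c) t Ψ x) r) :
    Ens O (Cmd.loop b c) s Ψ r := by
  obtain ⟨μ, h₁, h₂, h₃⟩ := h
  obtain ⟨κ, μ', h₄, h₅, h₆, h₇⟩ := bind_aux h₂ h₃
  exact ⟨μ', h₅ ▸ Exec.loop_true s b c _ κ hb h₁ h₄, h₆, h₇⟩

theorem loop_false {b : BExp} (hb : ¬ b.holds s) (hr : 0 ≤ r) (h : Ψ (s.tick (b.cost + 1)) r) :
    Ens O (Cmd.loop b c) s Ψ r :=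
  of_pure (Exec.loop_false s b c hb) hr h

/-- A coin with probability `p` of showing `1`. -/
theorem flip {x : ℕ} {e : RExp} {p r₀ r₁ : ℝ} (hp : e.eval s = p) (h0 : 0 ≤ p) (h1 : p ≤ 1)
    (hr₀ : 0 ≤ r₀) (hr₁ : 0 ≤ r₁)
    (h₁ : 0 < p → Ψ ((s.setN x 1).tick (e.cost + 1)) r₁)
    (h₀ : p < 1 → Ψ ((s.setN x 0).tick (e.cost + 1)) r₀)
    (hr : p * r₁ + (1 - p) * r₀ ≤ r) :
    Ens O (Cmd.flip x e) s Ψ r := by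
  have hc : max 0 (min 1 p) = p := by rw [min_eq_right h1, max_eq_right h0]
  have hct : coin p true = ENNReal.ofReal p := by
    show (if true = true then ENNReal.ofReal (max 0 (min 1 p)) else
      ENNReal.ofReal (1 - max 0 (min 1 p))) = _
    rw [if_pos rfl, hc]
  have hcf : coin p false = ENNReal.ofReal (1 - p) := by
    show (if false = true then ENNReal.ofReal (max 0 (min 1 p)) else
      ENNReal.ofReal (1 - max 0 (min 1 p))) = _
    rw [if_neg Bool.false_ne_true, hc]
  let f : Bool → State × ℝ := fun b =>
    ((s.setN x (if b then 1 else 0)).tick (e.cost + 1), if b then r₁ else r₀)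
  refine ⟨(coin p).map f, ?_, ?_, ?_⟩
  · rw [PMF.map_comp]
    have := Exec.flip (O := O) s x e
    rwa [hp] at this
  · intro y hy
    obtain ⟨b, hb, rfl⟩ := (PMF.mem_support_map_iff _ _ _).mp hy
    rw [PMF.mem_support_iff] at hb
    cases b
    · rw [hcf] at hb
      have : p < 1 := by
        by_contra hlt
        exact hb (ENNReal.ofReal_eq_zero.mpr (by linarith))
      exact ⟨hr₀, h₀ this⟩
    · rw [hct] at hb
      have : 0 < p := by
        by_contra hlt
        exact hb (ENNReal.ofReal_eq_zero.mpr (by linarith))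
      exact ⟨hr₁, h₁ this⟩
  · have hr₀' : 0 ≤ (f false).2 := by simpa [f] using hr₀
    have hr₁' : 0 ≤ (f true).2 := by simpa [f] using hr₁
    rw [← PMF.bind_pure_comp, tsum_bind]
    simp only [Function.comp, tsum_pure]
    rw [tsum_bool, hct, hcf, ← ENNReal.ofReal_mul h0, ← ENNReal.ofReal_mul (by linarith),
      ← ENNReal.ofReal_add (mul_nonneg (by linarith) hr₀') (mul_nonneg h0 hr₁')]
    refine ENNReal.ofReal_le_ofReal ?_
    simp only [f]
    simpa [add_comm] using hr

end Ens


/-! ### Submodular functions on finite sets of natural numbers -/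

open Finset in
/-- A function on subsets of `Fin n` as a function on finite sets of natural numbers. -/
def liftNat {n : ℕ} (F : Finset (Fin n) → ℝ) (A : Finset ℕ) : ℝ :=
  F (univ.filter fun v : Fin n => (v : ℕ) ∈ A)

/-- Submodularity on finite sets of natural numbers. -/
def SubNat (G : Finset ℕ → ℝ) : Prop :=
  ∀ A B : Finset ℕ, A ⊆ B → ∀ x, x ∉ B → G (insert x B) - G B ≤ G (insert x A) - G A

theorem IsSubmodular.liftNat {n : ℕ} {F : Finset (Fin n) → ℝ} (h : IsSubmodular F) :
    SubNat (liftNat F) := by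
  intro A B hAB x hx
  by_cases hxn : x < n
  · have key : ∀ C : Finset ℕ, (Finset.univ.filter fun v : Fin n => (v : ℕ) ∈ insert x C) =
        insert ⟨x, hxn⟩ (Finset.univ.filter fun v : Fin n => (v : ℕ) ∈ C) := by
      intro C
      ext v
      simp [Fin.ext_iff]
    simp only [_root_.liftNat, key]
    apply h
    · intro v hv
      simp only [Finset.mem_filter, Finset.mem_univ, true_and] at hv ⊢
      exact hAB hv
    · simpa using hx
  · have key : ∀ C : Finset ℕ, (Finset.univ.filter fun v : Fin n => (v : ℕ) ∈ insert x C) =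
        (Finset.univ.filter fun v : Fin n => (v : ℕ) ∈ C) := by
      intro C
      ext v
      have : (v : ℕ) ≠ x := by have := v.2; omega
      simp [this]
    simp only [_root_.liftNat, key, sub_self, le_refl]

/-- The value of `G` on the set of the first `k` entries of `f`. -/
def pv (G : Finset ℕ → ℝ) (f : ℕ → ℕ) (k : ℕ) : ℝ := G ((Finset.range k).image f)

/-- The marginal value of the entry `k` of `f`. -/
def gr (G : Finset ℕ → ℝ) (f : ℕ → ℕ) (k : ℕ) : ℝ := pv G f (k + 1) - pv G f k

/-- The first `n` entries of `f` are a permutation of `0, …, n - 1`. -/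
structure IsList (n : ℕ) (f : ℕ → ℕ) : Prop where
  lt : ∀ i, i < n → f i < n
  inj : ∀ i, i < n → ∀ j, j < n → f i = f j → i = j

namespace IsList

variable {n : ℕ} {f : ℕ → ℕ}

theorem injOn (h : IsList n f) : Set.InjOn f (Finset.range n : Finset ℕ) := by
  intro i hi j hj hij
  simp only [Finset.coe_range, Set.mem_Iio] at hi hj
  exact h.inj i hi j hj hij

theorem image_range (h : IsList n f) : (Finset.range n).image f = Finset.range n := by
  apply Finset.eq_of_subset_of_card_le
  · intro x hx
    obtain ⟨i, hi, rfl⟩ := Finset.mem_image.mp hx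
    exact Finset.mem_range.mpr (h.lt i (Finset.mem_range.mp hi))
  · rw [Finset.card_image_of_injOn h.injOn]

theorem surj (h : IsList n f) {x : ℕ} (hx : x < n) : ∃ i < n, f i = x := by
  have := Finset.mem_range.mpr hx
  rw [← h.image_range] at this
  obtain ⟨i, hi, rfl⟩ := Finset.mem_image.mp this
  exact ⟨i, Finset.mem_range.mp hi, rfl⟩

/-- The permutation of `Fin n` given by the list. -/
theorem exists_perm (h : IsList n f) : ∃ P : Equiv.Perm (Fin n), ∀ i, (P i : ℕ) = f i := by
  let g : Fin n → Fin n := fun i => ⟨f i, h.lt i i.2⟩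
  have hg : Function.Injective g := by
    intro i j hij
    have : f i = f j := congrArg Fin.val hij
    exact Fin.ext (h.inj i i.2 j j.2 this)
  exact ⟨Equiv.ofBijective g (Finite.injective_iff_bijective.mp hg), fun i => rfl⟩

theorem comp {g : ℕ → ℕ} (h : IsList n f) (hg : IsList n g) : IsList n fun i => f (g i) :=
  ⟨fun i hi => h.lt _ (hg.lt i hi),
    fun i hi j hj hij => hg.inj i hi j hj (h.inj _ (hg.lt i hi) _ (hg.lt j hj) hij)⟩

end IsList

/-- The successor of the last entry is unconstrained. A cyclic list is therefore a legal query from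
any of its cells. -/
theorem IsEvalOracle.eq_pv {n : ℕ} {F : Finset (Fin n) → ℝ} {O : Oracle} (hO : IsEvalOracle F O)
    {f next : ℕ → ℕ} {head : ℕ} (hf : IsList n f) (hh : 0 < n → head = f 0)
    (hn : ∀ i, i + 1 < n → next (f i) = f (i + 1)) {k : ℕ} (hk : k ≤ n) :
    O next head k = pv (liftNat F) f k := by
  obtain ⟨P, hP⟩ := hf.exists_perm
  rw [hO next head P ⟨?_, ?_⟩ k hk]
  · unfold pv liftNat prefixSet
    congr 1
    ext v
    simp only [Finset.mem_filter, Finset.mem_univ, true_and, Finset.mem_image, Finset.mem_range]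
    constructor
    · intro h
      exact ⟨_, h, by rw [← hP]; simp⟩
    · rintro ⟨i, hi, hiv⟩
      have : P ⟨i, by omega⟩ = v := Fin.ext (by rw [hP]; exact hiv)
      rw [← this]
      simpa using hi
  · intro j hj
    rw [hP, hj]
    exact hh (by have := j.2; omega)
  · intro j k hjk
    rw [hP, hP, hjk]
    exact hn _ (by have := k.2; omega)

section Math

open Finset

variable {n : ℕ} {G : Finset ℕ → ℝ} {f : ℕ → ℕ}

theorem image_range_succ' (f : ℕ → ℕ) (k : ℕ) :
    (range (k + 1)).image f = insert (f k) ((range k).image f) := by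
  rw [range_add_one, image_insert]

theorem IsList.notMem_prefix (hf : IsList n f) {k : ℕ} (hk : k < n) : f k ∉ (range k).image f := by
  intro h
  obtain ⟨i, hi, hik⟩ := mem_image.mp h
  have hi := mem_range.mp hi
  have := hf.inj i (by omega) k hk hik
  omega

theorem sum_gr (k : ℕ) : ∑ i ∈ range k, gr G f i = pv G f k - pv G f 0 :=
  sum_range_sub _ _

/-- The greedy vector lies in the base polytope: the marginal value of an element over a full prefix
is at most its marginal value over the part of the prefix in `A`. -/
theorem greedy_le (hG : SubNat G) (hf : IsList n f) (A : Finset ℕ) (k : ℕ) (hk : k ≤ n) :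
    ∑ i ∈ range k, (if f i ∈ A then gr G f i else 0) ≤ G (A ∩ (range k).image f) - G ∅ := by
  induction k with
  | zero => simp
  | succ k ih =>
    rw [sum_range_succ]
    have ih := ih (by omega)
    have hnot := hf.notMem_prefix (show k < n by omega)
    split_ifs with hA
    · have : A ∩ (range (k + 1)).image f = insert (f k) (A ∩ (range k).image f) := by
        rw [image_range_succ', inter_insert_of_mem hA]
      rw [this]
      have := hG (A ∩ (range k).image f) ((range k).image f) inter_subset_right (f k) hnot
      have e : gr G f k = G (insert (f k) ((range k).image f)) - G ((range k).image f) := by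
        unfold gr pv
        rw [image_range_succ']
      linarith
    · have : A ∩ (range (k + 1)).image f = A ∩ (range k).image f := by
        rw [image_range_succ', inter_insert_of_notMem hA]
      rw [this]
      linarith

/-- With `A` the elements of positive marginal value, the sum is twice the sum over `A` minus the
total, hence at most `2 G(A) - G(∅) - G(V)`. -/
theorem sum_abs_gr_le (hG : SubNat G) (hb : ∀ A, |G A| ≤ 1) (hf : IsList n f) :
    ∑ i ∈ range n, |gr G f i| ≤ 4 := by
  set A := ((range n).filter fun i => 0 < gr G f i).image f with hA
  have h1 := greedy_le hG hf A n le_rfl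
  have h2 : ∑ i ∈ range n, |gr G f i| =
      2 * ∑ i ∈ range n, (if f i ∈ A then gr G f i else 0) - ∑ i ∈ range n, gr G f i := by
    rw [mul_sum, ← sum_sub_distrib]
    refine sum_congr rfl fun i hi => ?_
    have : f i ∈ A ↔ 0 < gr G f i := by
      constructor
      · intro h
        obtain ⟨j, hj, hji⟩ := mem_image.mp h
        rw [mem_filter, mem_range] at hj
        rw [hf.inj j hj.1 i (mem_range.mp hi) hji] at hj
        exact hj.2
      · intro h
        exact mem_image_of_mem f (mem_filter.mpr ⟨hi, h⟩)
    by_cases hpos : 0 < gr G f i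
    · rw [if_pos (this.mpr hpos), abs_of_pos hpos]; ring
    · rw [if_neg (fun h => hpos (this.mp h)), abs_of_nonpos (not_lt.mp hpos)]; ring
  rw [h2, sum_gr]
  have b1 := abs_le.mp (hb (A ∩ (range n).image f))
  have b2 := abs_le.mp (hb ∅)
  have b3 := abs_le.mp (hb ((range n).image f))
  have e0 : pv G f 0 = G ∅ := by simp [pv]
  have en : pv G f n = G ((range n).image f) := rfl
  rw [e0, en]
  linarith

/-- By Abel summation, for decreasing `z` the right side at `k = d` is a combination of the `p i`
with nonnegative weights of total `L`, so it is at least `L m`. The induction keeps the weight `z'`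
still resting on the last value `p k`; the conclusion is used with `z' = 0`. -/
theorem abel_le {d : ℕ} {p z : ℕ → ℝ} {m L : ℝ} (hm : ∀ i ≤ d, m ≤ p i)
    (hz : ∀ i j, i ≤ j → j < d → z j ≤ z i) (hL : ∀ i < d, 0 ≤ z i ∧ z i ≤ L) :
    ∀ k ≤ d, ∀ z', 0 ≤ z' → z' ≤ L → (∀ i < k, z' ≤ z i) →
      z' * p k + (L - z') * m ≤ ∑ i ∈ range k, (p (i + 1) - p i) * z i + L * p 0 := by
  intro k
  induction k with
  | zero =>
    intro _ z' h0 h1 _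
    have := hm 0 (by omega)
    simp only [range_zero, sum_empty]
    nlinarith
  | succ k ih =>
    intro hk z' h0 h1 h2
    have := ih (by omega) (z k) (hL k (by omega)).1 (hL k (by omega)).2
      (fun i hi => hz i k hi.le (by omega))
    rw [sum_range_succ]
    have h3 := h2 k (by omega)
    have h4 := hm (k + 1) hk
    nlinarith

/-- One step of the method moves entry `i` against the sign of its marginal value. -/
theorem descent_le (hG : SubNat G) (hb : ∀ A, |G A| ≤ 1) (hf : IsList n f) {z : ℕ → ℝ}
    {m L : ℝ} (h0 : 0 ≤ L) (hm : ∀ i ≤ n, m ≤ pv G f i)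
    (hz : ∀ i j, i ≤ j → j < n → z j ≤ z i) (hL : ∀ i < n, 0 ≤ z i ∧ z i ≤ L)
    {S : Finset ℕ} (hS : S ⊆ range n) {σ : ℕ → ℝ} (hσ : ∀ i, |gr G f i| * σ i = gr G f i) :
    ∑ i ∈ range n, |gr G f i| * (1 - 2 * σ i * (z i - if f i ∈ S then L else 0)) ≤
      4 - 2 * L * (m - G S) := by
  have e : ∑ i ∈ range n, |gr G f i| * (1 - 2 * σ i * (z i - if f i ∈ S then L else 0)) =
      ∑ i ∈ range n, |gr G f i| - 2 * ∑ i ∈ range n, gr G f i * z i +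
        2 * L * ∑ i ∈ range n, (if f i ∈ S then gr G f i else 0) := by
    rw [mul_sum, mul_sum, ← sum_sub_distrib, ← sum_add_distrib]
    refine sum_congr rfl fun i _ => ?_
    have := hσ i
    split_ifs
    · linear_combination (-2 * (z i - L)) * this
    · linear_combination (-2 * z i) * this
  rw [e]
  -- The convexity argument: `∑ gr · z` is bounded below by `abel_le`, the linear functional at the
  -- target `S` is bounded above by `greedy_le`, and the values `G ∅` cancel.
  have h1 := sum_abs_gr_le hG hb hf
  have h2 := greedy_le hG hf S n le_rfl
  rw [hf.image_range, inter_eq_left.mpr hS] at h2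
  have h3 := abel_le hm hz hL n le_rfl 0 le_rfl h0 (fun i hi => (hL i hi).1)
  have e0 : pv G f 0 = G ∅ := by simp [pv]
  rw [e0] at h3
  change _ ≤ ∑ i ∈ range n, gr G f i * z i + _ at h3
  nlinarith

/-! ### The sampling weights -/

/-- The entries of the base list `f₀` at the positions below `i` outside of `J`. -/
def untouched (f₀ : ℕ → ℕ) (J : Finset ℕ) (i : ℕ) : Finset ℕ :=
  ((range i).filter fun p => p ∉ J).image f₀

/-- The potential whose increments are the sampling weights. -/
noncomputable def pot (G : Finset ℕ → ℝ) (n : ℕ) (f₀ f : ℕ → ℕ) (J : Finset ℕ) (tp : ℕ → ℕ)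
    (i : ℕ) : ℝ :=
  ∑ p ∈ range (min i n), |gr G f₀ p| + G (untouched f₀ J (min i n))
    - G (untouched f₀ J (min i n) ∪ J.image f₀) + ∑ k ∈ range (i - n), |gr G f (tp k)|
    + (i : ℝ) / n

variable {f₀ : ℕ → ℕ} {J : Finset ℕ} {tp : ℕ → ℕ} {s : ℕ}

theorem untouched_succ_of_mem {i : ℕ} (h : i ∈ J) :
    untouched f₀ J (i + 1) = untouched f₀ J i := by
  unfold untouched
  rw [range_add_one, filter_insert, if_neg (not_not.mpr h)]

theorem untouched_succ_of_notMem {i : ℕ} (h : i ∉ J) :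
    untouched f₀ J (i + 1) = insert (f₀ i) (untouched f₀ J i) := by
  unfold untouched
  rw [range_add_one, filter_insert, if_pos h, image_insert]

/-- Two lists and a set of positions outside of which they agree. -/
structure Agree (n : ℕ) (f₀ f : ℕ → ℕ) (J : Finset ℕ) : Prop where
  base : IsList n f₀
  cur : IsList n f
  sub : J ⊆ range n
  eq : ∀ i < n, i ∉ J → f i = f₀ i

/-- Two permutations that agree outside `J` carry the same elements on `J`. -/
theorem Agree.mem_image (h : Agree n f₀ f J) {p : ℕ} (hp : p ∈ J) : f p ∈ J.image f₀ := by
  have hpn := mem_range.mp (h.sub hp)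
  obtain ⟨q, hq, hqp⟩ := h.base.surj (h.cur.lt p hpn)
  by_cases hqJ : q ∈ J
  · exact Finset.mem_image.mpr ⟨q, hqJ, hqp⟩
  · rw [← h.eq q hq hqJ] at hqp
    rw [h.cur.inj q hq p hpn hqp] at hqJ
    exact absurd hp hqJ

/-- The prefixes of `f` and of `f₀` before `i` both lie between the untouched prefix and its union
with all touched elements. Diminishing returns puts both marginal values into one interval, so they
differ by at most its length. -/
theorem Agree.abs_gr_le (h : Agree n f₀ f J) (hG : SubNat G) {i : ℕ} (hi : i < n) (hJ : i ∉ J) :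
    |gr G f i| ≤ |gr G f₀ i| +
      (G (untouched f₀ J (i + 1)) - G (untouched f₀ J i)) -
      (G (untouched f₀ J (i + 1) ∪ J.image f₀) - G (untouched f₀ J i ∪ J.image f₀)) := by
  have sand : ∀ g : ℕ → ℕ, IsList n g → (∀ i < n, i ∉ J → g i = f₀ i) →
      (∀ p ∈ J, g p ∈ J.image f₀) →
      G (untouched f₀ J (i + 1) ∪ J.image f₀) - G (untouched f₀ J i ∪ J.image f₀) ≤ gr G g i ∧
      gr G g i ≤ G (untouched f₀ J (i + 1)) - G (untouched f₀ J i) := by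
    intro g hg hge hgJ
    have hnot : f₀ i ∉ untouched f₀ J i ∪ J.image f₀ := by
      intro hm
      obtain ⟨p, hp, hpi⟩ : ∃ p, (p < i ∨ p ∈ J) ∧ f₀ p = f₀ i := by
        rcases Finset.mem_union.mp hm with hm | hm
        · obtain ⟨p, hp, hpi⟩ := Finset.mem_image.mp hm
          exact ⟨p, Or.inl (mem_range.mp (mem_filter.mp hp).1), hpi⟩
        · obtain ⟨p, hp, hpi⟩ := Finset.mem_image.mp hm
          exact ⟨p, Or.inr hp, hpi⟩
      rcases hp with hp | hp
      · have := h.base.inj p (by omega) i hi hpi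
        omega
      · have := h.base.inj p (mem_range.mp (h.sub hp)) i hi hpi
        exact hJ (this ▸ hp)
    have hsub : untouched f₀ J i ⊆ (range i).image g := by
      intro x hx
      obtain ⟨p, hp, rfl⟩ := Finset.mem_image.mp hx
      rw [mem_filter, mem_range] at hp
      rw [← hge p (by omega) hp.2]
      exact mem_image_of_mem g (mem_range.mpr hp.1)
    have hsub' : (range i).image g ⊆ untouched f₀ J i ∪ J.image f₀ := by
      intro x hx
      obtain ⟨p, hp, rfl⟩ := Finset.mem_image.mp hx
      rw [mem_range] at hp
      by_cases hpJ : p ∈ J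
      · exact Finset.mem_union_right _ (hgJ p hpJ)
      · rw [hge p (by omega) hpJ]
        exact Finset.mem_union_left _
          (mem_image_of_mem _ (mem_filter.mpr ⟨mem_range.mpr hp, hpJ⟩))
    have e : gr G g i = G (insert (f₀ i) ((range i).image g)) - G ((range i).image g) := by
      unfold gr pv
      rw [image_range_succ', hge i hi hJ]
    rw [e, untouched_succ_of_notMem hJ, insert_union]
    exact ⟨hG _ _ hsub' _ hnot, hG _ _ hsub _ (fun hm => hnot (hsub' hm))⟩
  have h1 := sand f h.cur h.eq fun p hp => h.mem_image hp
  have h2 := sand f₀ h.base (fun _ _ _ => rfl) fun p hp => mem_image_of_mem f₀ hp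
  rw [abs_le]
  have h3 := abs_le.mp (le_refl |gr G f₀ i|)
  have h4 := abs_nonneg (gr G f₀ i)
  constructor <;> linarith

theorem pot_succ_of_lt {i : ℕ} (hi : i < n) :
    pot G n f₀ f J tp (i + 1) - pot G n f₀ f J tp i = |gr G f₀ i| +
      (G (untouched f₀ J (i + 1)) - G (untouched f₀ J i)) -
      (G (untouched f₀ J (i + 1) ∪ J.image f₀) - G (untouched f₀ J i ∪ J.image f₀)) + 1 / n := by
  unfold pot
  rw [min_eq_left (show i + 1 ≤ n by omega), min_eq_left hi.le, sum_range_succ,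
    Nat.sub_eq_zero_of_le (show i + 1 ≤ n by omega), Nat.sub_eq_zero_of_le hi.le]
  push_cast
  ring

theorem pot_succ_of_le {k : ℕ} :
    pot G n f₀ f J tp (n + k + 1) - pot G n f₀ f J tp (n + k) = |gr G f (tp k)| + 1 / n := by
  unfold pot
  rw [min_eq_right (show n ≤ n + k + 1 by omega), min_eq_right (show n ≤ n + k by omega),
    show n + k + 1 - n = k + 1 by omega, show n + k - n = k by omega, sum_range_succ]
  push_cast
  ring

/-- The summand `i / n` of `pot` makes every leaf weight positive, which excludes division by zero
in the bisection and in the rejection step. -/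
theorem Agree.pot_lt (h : Agree n f₀ f J) (hG : SubNat G) (hn : 0 < n) (i : ℕ) :
    pot G n f₀ f J tp i < pot G n f₀ f J tp (i + 1) := by
  have hn' : (0 : ℝ) < 1 / n := by positivity
  rcases lt_or_ge i n with hi | hi
  · have := pot_succ_of_lt (G := G) (f₀ := f₀) (f := f) (J := J) (tp := tp) hi
    have h4 := abs_nonneg (gr G f₀ i)
    by_cases hJ : i ∈ J
    · rw [untouched_succ_of_mem hJ] at this
      linarith
    · have h5 := h.abs_gr_le hG hi hJ
      have h6 := abs_nonneg (gr G f i)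
      linarith
  · obtain ⟨k, rfl⟩ := Nat.exists_eq_add_of_le hi
    have := pot_succ_of_le (n := n) (G := G) (f₀ := f₀) (f := f) (J := J) (tp := tp) (k := k)
    have h4 := abs_nonneg (gr G f (tp k))
    linarith

theorem sum_tp (hJ : J = (range s).image tp) (hinj : Set.InjOn tp (range s)) (hsub : J ⊆ range n)
    (φ : ℕ → ℝ) :
    ∑ p ∈ (range n).filter (fun p => p ∉ J), φ p + ∑ k ∈ range s, φ (tp k) =
      ∑ p ∈ range n, φ p := by
  rw [← sum_image (f := φ) hinj, ← hJ, ← sum_filter_add_sum_filter_not (range n) (fun p => p ∉ J)]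
  congr 1
  refine sum_congr ?_ fun _ _ => rfl
  ext p
  simp only [mem_filter, not_not]
  exact ⟨fun hp => ⟨hsub hp, hp⟩, fun hp => hp.2⟩

/-- The stored values contribute at most `4`, the four values of `G` at most `4`, the touched
positions at most `4` and the term `i / n` at most `2`; `16` is a convenient bound. -/
theorem Agree.pot_total_le (h : Agree n f₀ f J) (hG : SubNat G) (hb : ∀ A, |G A| ≤ 1)
    (hn : 0 < n) (hJ : J = (range s).image tp) (hinj : Set.InjOn tp (range s)) :
    pot G n f₀ f J tp (n + s) - pot G n f₀ f J tp 0 ≤ 16 := by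
  have hs : s ≤ n := by
    have := card_le_card h.sub
    rw [hJ, card_image_of_injOn hinj, card_range, card_range] at this
    exact this
  have h1 := sum_abs_gr_le hG hb h.base
  have h2 := sum_abs_gr_le hG hb h.cur
  have h3 := sum_tp hJ hinj h.sub fun p => |gr G f p|
  have h4 : 0 ≤ ∑ p ∈ (range n).filter (fun p => p ∉ J), |gr G f p| :=
    sum_nonneg fun _ _ => abs_nonneg _
  unfold pot
  rw [min_eq_right (show n ≤ n + s by omega), show n + s - n = s by omega,
    min_eq_left (Nat.zero_le n), Nat.zero_sub, Nat.cast_zero, zero_div]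
  simp only [range_zero, sum_empty]
  have h5 : ((n + s : ℕ) : ℝ) / n ≤ 2 := by
    rw [div_le_iff₀ (by positivity)]
    have : (s : ℝ) ≤ n := by exact_mod_cast hs
    push_cast
    linarith
  have b1 := abs_le.mp (hb (untouched f₀ J n))
  have b2 := abs_le.mp (hb (untouched f₀ J n ∪ J.image f₀))
  have b3 := abs_le.mp (hb (untouched f₀ J 0))
  have b4 := abs_le.mp (hb (untouched f₀ J 0 ∪ J.image f₀))
  linarith

/-- The position selected by the leaf `i` of the search. -/
def leafPos (n : ℕ) (tp : ℕ → ℕ) (i : ℕ) : ℕ := if i < n then i else tp (i - n)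

open Classical in
/-- The expected value at the leaf `i` of the search, if moving the entry `p` changes the value
`V` by `δ p`. -/
noncomputable def leafVal (G : Finset ℕ → ℝ) (n : ℕ) (f₀ f : ℕ → ℕ) (J : Finset ℕ) (tp : ℕ → ℕ)
    (tot V : ℝ) (δ : ℕ → ℝ) (i : ℕ) : ℝ :=
  if i < n ∧ i ∈ J then V
  else V + |gr G f (leafPos n tp i)| * tot /
    ((pot G n f₀ f J tp (i + 1) - pot G n f₀ f J tp i) * 16) * δ (leafPos n tp i)

/-- Rejection sampling: a leaf of weight `w` is found with probability `w / tot` and accepted with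
probability `|gr| tot / (16 w)`, so its position moves with probability `|gr| / 16`. A touched
position owns a leaf `n + k`; its leaf below `n` does nothing, which prevents double counting. -/
theorem Agree.sum_leafVal (h : Agree n f₀ f J) (hG : SubNat G) (hn : 0 < n)
    (hJ : J = (range s).image tp) (hinj : Set.InjOn tp (range s)) (tot V : ℝ)
    (htot : pot G n f₀ f J tp (n + s) - pot G n f₀ f J tp 0 = tot) (δ : ℕ → ℝ) :
    ∑ i ∈ range (n + s), (pot G n f₀ f J tp (i + 1) - pot G n f₀ f J tp i) *
        leafVal G n f₀ f J tp tot V δ i =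
      tot * (V + (∑ p ∈ range n, |gr G f p| * δ p) / 16) := by
  set w : ℕ → ℝ := fun i => pot G n f₀ f J tp (i + 1) - pot G n f₀ f J tp i with hw
  have hwpos : ∀ i, 0 < w i := fun i => sub_pos.mpr (h.pot_lt hG hn i)
  have hterm : ∀ i, w i * leafVal G n f₀ f J tp tot V δ i = w i * V +
      if i < n ∧ i ∈ J then 0 else
        tot / 16 * (|gr G f (leafPos n tp i)| * δ (leafPos n tp i)) := by
    intro i
    have := (hwpos i).ne'
    unfold leafVal
    change w i * (if i < n ∧ i ∈ J then V else V + |gr G f (leafPos n tp i)| * tot /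
      (w i * 16) * δ (leafPos n tp i)) = _
    split_ifs
    · ring
    · field_simp
  change ∑ i ∈ range (n + s), w i * leafVal G n f₀ f J tp tot V δ i = _
  rw [sum_congr rfl fun i _ => hterm i, sum_add_distrib, ← sum_mul,
    sum_range_sub (pot G n f₀ f J tp) (n + s), htot, sum_range_add,
    ← sum_tp hJ hinj h.sub fun p => |gr G f p| * δ p]
  have e1 : ∑ i ∈ range n, (if i < n ∧ i ∈ J then 0 else
      tot / 16 * (|gr G f (leafPos n tp i)| * δ (leafPos n tp i))) =
      tot / 16 * ∑ p ∈ (range n).filter (fun p => p ∉ J), |gr G f p| * δ p := by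
    rw [mul_sum, sum_filter]
    refine sum_congr rfl fun i hi => ?_
    have hi := mem_range.mp hi
    by_cases hiJ : i ∈ J <;> simp [hi, hiJ, leafPos]
  have e2 : ∑ k ∈ range s, (if n + k < n ∧ n + k ∈ J then 0 else
      tot / 16 * (|gr G f (leafPos n tp (n + k))| * δ (leafPos n tp (n + k)))) =
      tot / 16 * ∑ k ∈ range s, |gr G f (tp k)| * δ (tp k) := by
    rw [mul_sum]
    refine sum_congr rfl fun k _ => ?_
    simp [leafPos]
  rw [e1, e2]
  ring

end Math


/-! ### The program

Natural number registers: `0` the size `n`, `1` the number of levels, `2` the number of remaining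
rounds, `3` the number of touched positions, `4` and `5` the heads of the two readings of the
cyclic list; all others are temporary. Natural number arrays: `0` the output, `1` the elements
ordered by decreasing level, `2` the linked list of array `1`, `3` and `4` the successors and
predecessors in a cyclic list of the untouched and then the touched elements, `5` the touched
positions, `6` the marks of the touched positions, `7` the level at each position, `8` the number
of elements of at least a given level. Real arrays: `0` and `1` partial sums of absolute marginal
values. -/

/-- Query the marginal value at the position `e` of the current order. -/
def gradAt (e : NExp) : Cmd :=
  .block [.query 5 2 (.get 1 (.const 0)) e, .query 6 2 (.get 1 (.const 0)) (.add e (.const 1)),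
    .ite (.rlt (.var 5) (.var 6)) (.rset 7 (.sub (.var 6) (.var 5)))
      (.rset 7 (.sub (.var 5) (.var 6)))]

/-- Start an epoch: no position is touched, the current order is the base order. -/
def rebuild : Cmd :=
  .block [.rput 0 (.const 0) (.ofNat (.const 0)), .nset 3 (.const 0),
    .nset 4 (.get 1 (.const 0)), .nset 5 (.get 1 (.const 0)), .nset 10 (.const 0),
    .loop (.nlt (.var 10) (.var 0)) (.block [gradAt (.var 10),
      .rput 0 (.add (.var 10) (.const 1)) (.add (.get 0 (.var 10)) (.var 7)),
      .nput 6 (.var 10) (.const 0),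
      -- At index `0` truncated subtraction makes the first element its own neighbour; this is
      -- overwritten when the cycle is closed after the loop.
      .nput 3 (.get 1 (.sub (.var 10) (.const 1))) (.get 1 (.var 10)),
      .nput 4 (.get 1 (.var 10)) (.get 1 (.sub (.var 10) (.const 1))),
      .nset 10 (.add (.var 10) (.const 1))]),
    .nput 3 (.get 1 (.sub (.var 0) (.const 1))) (.get 1 (.const 0)),
    .nput 4 (.get 1 (.const 0)) (.get 1 (.sub (.var 0) (.const 1)))]

/-- Partial sums of the absolute marginal values at the touched positions. -/
def sumTouched : Cmd :=
  .block [.rput 1 (.const 0) (.ofNat (.const 0)), .nset 10 (.const 0),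
    .loop (.nlt (.var 10) (.var 3)) (.block [gradAt (.get 5 (.var 10)),
      .rput 1 (.add (.var 10) (.const 1)) (.add (.get 1 (.var 10)) (.var 7)),
      .nset 10 (.add (.var 10) (.const 1))])]

/-- The potential at the index in register `8`. -/
def evalPot : Cmd :=
  .block [.nset 9 (.const 0), .nset 10 (.const 0),
    -- The minimum of the index and `n`, by truncated subtraction.
    .nset 12 (.sub (.var 8) (.sub (.var 8) (.var 0))),
    .loop (.nlt (.var 10) (.var 3)) (.block [
      .ite (.nlt (.get 5 (.var 10)) (.var 12)) (.nset 9 (.add (.var 9) (.const 1))) .skip,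
      .nset 10 (.add (.var 10) (.const 1))]),
    .query 5 3 (.var 4) (.sub (.var 12) (.var 9)),
    .query 6 3 (.var 5) (.add (.var 3) (.sub (.var 12) (.var 9))),
    .rset 3 (.add (.add (.sub (.add (.get 0 (.var 12)) (.var 5)) (.var 6))
      (.get 1 (.sub (.var 8) (.var 0)))) (.div (.ofNat (.var 8)) (.ofNat (.var 0))))]

/-- Random bisection: finds a leaf with probability proportional to its weight. -/
def bisect : Cmd :=
  .loop (.nlt (.add (.var 6) (.const 1)) (.var 7)) (.block [
    .nset 8 (.half (.add (.var 6) (.var 7))), evalPot,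
    .flip 11 (.div (.sub (.var 2) (.var 3)) (.sub (.var 2) (.var 1))),
    .ite (.nlt (.const 0) (.var 11)) (.block [.nset 6 (.var 8), .rset 1 (.var 3)])
      (.block [.nset 7 (.var 8), .rset 2 (.var 3)])])

/-- Mark the position in register `17` as touched and move its element to the end of the cyclic
list. -/
def touch : Cmd :=
  .ite (.nlt (.const 0) (.get 6 (.var 17))) .skip (.block [
    .nput 6 (.var 17) (.const 1), .nput 5 (.var 3) (.var 17),
    .nset 18 (.get 1 (.var 17)), .nset 19 (.get 3 (.var 18)),
    .ite (.and (.not (.nlt (.var 18) (.var 4))) (.not (.nlt (.var 4) (.var 18))))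
      (.nset 4 (.var 19))
      (.block [.nset 20 (.get 4 (.var 18)), .nput 3 (.var 20) (.var 19),
        .nput 4 (.var 19) (.var 20), .nset 20 (.get 4 (.var 4)), .nput 3 (.var 20) (.var 18),
        .nput 4 (.var 18) (.var 20), .nput 3 (.var 18) (.var 4), .nput 4 (.var 4) (.var 18)]),
    .ite (.nlt (.const 0) (.var 3)) .skip (.nset 5 (.var 18)),
    .nset 3 (.add (.var 3) (.const 1))])

/-- Repair the linked list of the current order behind the position `e`. -/
def relink (e : NExp) : Cmd := .nput 2 (.get 1 e) (.get 1 (.add e (.const 1)))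

/-- Exchange the entries at the positions in registers `12` and `13`, give level `16` to the
latter, and set the boundary with index `14` to `15`. -/
def moveTo : Cmd :=
  .block [.nset 17 (.var 12), touch, .nset 17 (.var 13), touch,
    .nset 18 (.get 1 (.var 12)), .nput 1 (.var 12) (.get 1 (.var 13)),
    .nput 1 (.var 13) (.var 18),
    -- At position `0` the predecessor is again position `0`, which is harmless. Behind the last
    -- position a meaningless successor is stored, which no query depends on.
    relink (.sub (.var 12) (.const 1)), relink (.var 12),
    relink (.sub (.var 13) (.const 1)), relink (.var 13),
    .nput 7 (.var 13) (.var 16), .nput 8 (.var 14) (.var 15)]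

/-- Move the element at the position in register `12` by one level against the sign of its
marginal value. -/
def moveStep : Cmd :=
  .ite (.rlt (.var 6) (.var 5))
    (.ite (.nlt (.get 7 (.var 12)) (.var 1))
      (.block [.nset 14 (.add (.get 7 (.var 12)) (.const 1)), .nset 13 (.get 8 (.var 14)),
        .nset 15 (.add (.var 13) (.const 1)), .nset 16 (.var 14), moveTo]) .skip)
    (.ite (.nlt (.const 0) (.get 7 (.var 12)))
      (.block [.nset 14 (.get 7 (.var 12)), .nset 13 (.sub (.get 8 (.var 14)) (.const 1)),
        .nset 15 (.var 13), .nset 16 (.sub (.var 14) (.const 1)), moveTo]) .skip)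

/-- Act at the leaf found by the bisection. -/
def act : Cmd :=
  .block [.ite (.nlt (.var 6) (.var 0)) (.nset 12 (.var 6))
      (.nset 12 (.get 5 (.sub (.var 6) (.var 0)))),
    .ite (.and (.nlt (.var 6) (.var 0)) (.nlt (.const 0) (.get 6 (.var 6)))) .skip
      (.block [gradAt (.var 12),
        .flip 11 (.div (.mul (.var 7) (.var 4))
          (.mul (.sub (.var 2) (.var 1)) (.ofNat (.const 16)))),
        .ite (.nlt (.const 0) (.var 11)) moveStep .skip])]

/-- One step of the stochastic method. -/
def stochStep : Cmd :=
  .block [sumTouched, .nset 8 (.const 0), evalPot, .rset 1 (.var 3),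
    .nset 8 (.add (.var 0) (.var 3)), evalPot, .rset 2 (.var 3),
    .rset 4 (.sub (.var 2) (.var 1)), .nset 6 (.const 0), .nset 7 (.add (.var 0) (.var 3)),
    bisect, act]

/-- The main loop, with a uniformly random stopping time. -/
def mainLoop : Cmd :=
  .loop (.nlt (.const 0) (.var 2)) (.block [
    -- Stopping with probability one over the number of remaining rounds makes the stopping round
    -- uniform; in the last round the coin always stops.
    .flip 11 (.div (.ofNat (.const 1)) (.ofNat (.var 2))),
    .ite (.nlt (.const 0) (.var 11)) (.nset 2 (.const 0))
      (.block [.nset 2 (.sub (.var 2) (.const 1)),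
        .ite (.rlt (.mul (.ofNat (.var 3)) (.ofNat (.var 3))) (.ofNat (.var 0))) .skip rebuild,
        stochStep])])

/-- Set up the number of levels, the number of rounds and the identity order. -/
def setup : Cmd :=
  -- The roundings up of `16 / ε` and `16 n L / ε` are found by counting, which costs no more than a
  -- constant per round of the main loop.
  .block [.loop (.rlt (.mul (.ofNat (.var 1)) (.var 0)) (.ofNat (.const 16)))
      (.nset 1 (.add (.var 1) (.const 1))),
    .loop (.rlt (.mul (.ofNat (.var 2)) (.var 0))
        (.mul (.ofNat (.const 16)) (.mul (.ofNat (.var 0)) (.ofNat (.var 1)))))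
      (.nset 2 (.add (.var 2) (.const 1))),
    -- Since `n * n ≥ n`, the false count `n` of touched positions makes the first round start an
    -- epoch.
    .nset 3 (.var 0),
    .loop (.nlt (.var 10) (.var 0)) (.block [.nput 1 (.var 10) (.var 10),
      .nput 2 (.var 10) (.add (.var 10) (.const 1)), .nset 10 (.add (.var 10) (.const 1))])]

/-- Output the best prefix of the current order. -/
def finish : Cmd :=
  .block [.nset 6 (.const 0), .query 1 2 (.get 1 (.const 0)) (.const 0), .nset 10 (.const 0),
    .loop (.nlt (.var 10) (.var 0)) (.block [.nset 10 (.add (.var 10) (.const 1)),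
      .query 2 2 (.get 1 (.const 0)) (.var 10),
      .ite (.rlt (.var 2) (.var 1)) (.block [.rset 1 (.var 2), .nset 6 (.var 10)]) .skip]),
    .nset 10 (.const 0),
    .loop (.nlt (.var 10) (.var 6)) (.block [.nput 0 (.get 1 (.var 10)) (.const 1),
      .nset 10 (.add (.var 10) (.const 1))])]

/-- The program. -/
def sfm : Cmd :=
  -- For `n = 0` or `ε ≥ 2` any set is good enough, because the values lie in `[-1, 1]`.
  .ite (.and (.nlt (.const 0) (.var 0)) (.rlt (.var 0) (.ofNat (.const 2))))
    (.block [setup, mainLoop, finish]) .skip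

/-! ### Invariants -/

/-- The current order, its linked list and the level boundaries are consistent. -/
structure Core (n L : ℕ) (s : State) : Prop where
  size : s.nreg 0 = n
  levels : s.nreg 1 = L
  list : IsList n (s.narr 1)
  next : ∀ i, i + 1 < n → s.narr 2 (s.narr 1 i) = s.narr 1 (i + 1)
  le : ∀ i, i < n → s.narr 7 i ≤ L
  bdry : ∀ l, 1 ≤ l → ∀ i, i < n → (i < s.narr 8 l ↔ l ≤ s.narr 7 i)
  bdry_le : ∀ l, 1 ≤ l → s.narr 8 l ≤ n
  out : ∀ i, s.narr 0 i = 0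

theorem Core.congr {n L : ℕ} {s t : State} (h : Core n L s) (h0 : t.nreg 0 = s.nreg 0)
    (h1 : t.nreg 1 = s.nreg 1) (a0 : t.narr 0 = s.narr 0) (a1 : t.narr 1 = s.narr 1)
    (a2 : t.narr 2 = s.narr 2) (a7 : t.narr 7 = s.narr 7) (a8 : t.narr 8 = s.narr 8) :
    Core n L t := by
  constructor
  · rw [h0, h.size]
  · rw [h1, h.levels]
  · rw [a1]; exact h.list
  · rw [a1, a2]; exact h.next
  · rw [a7]; exact h.le
  · rw [a7, a8]; exact h.bdry
  · rw [a8]; exact h.bdry_le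
  · rw [a0]; exact h.out

/-- The touched positions. -/
def touchedSet (n : ℕ) (s : State) : Finset ℕ := (Finset.range n).filter fun p => s.narr 6 p ≠ 0

/-- The data of an epoch: base order `f₀`, positions in the order `a` of the cyclic list. -/
structure Epoch (G : Finset ℕ → ℝ) (n : ℕ) (f₀ a : ℕ → ℕ) (s : State) : Prop where
  base : IsList n f₀
  agree : ∀ i, i < n → s.narr 6 i = 0 → s.narr 1 i = f₀ i
  tp : touchedSet n s = (Finset.range (s.nreg 3)).image (s.narr 5)
  tp_inj : Set.InjOn (s.narr 5) (Finset.range (s.nreg 3))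
  weights : ∀ i, i ≤ n → s.rarr 0 i = ∑ p ∈ Finset.range i, |gr G f₀ p|
  cyc : IsList n a
  mono : ∀ i j, i < j → j < n - s.nreg 3 → a i < a j
  un : ∀ k, k < n - s.nreg 3 → s.narr 6 (a k) = 0
  tou : ∀ k, k < n → n - s.nreg 3 ≤ k → s.narr 6 (a k) ≠ 0
  succ : ∀ k, k < n → s.narr 3 (f₀ (a k)) = f₀ (a ((k + 1) % n))
  pred : ∀ k, k < n → s.narr 4 (f₀ (a ((k + 1) % n))) = f₀ (a k)
  head : s.nreg 4 = f₀ (a 0)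
  head' : s.nreg 5 = f₀ (a ((n - s.nreg 3) % n))

theorem touchedSet_congr {n : ℕ} {s t : State} (a6 : t.narr 6 = s.narr 6) :
    touchedSet n t = touchedSet n s := by
  unfold touchedSet
  rw [a6]

theorem Epoch.congr {G : Finset ℕ → ℝ} {n : ℕ} {f₀ a : ℕ → ℕ} {s t : State}
    (h : Epoch G n f₀ a s) (h3 : t.nreg 3 = s.nreg 3) (h4 : t.nreg 4 = s.nreg 4)
    (h5 : t.nreg 5 = s.nreg 5)
    (a1 : ∀ i, i < n → t.narr 6 i = 0 → t.narr 1 i = s.narr 1 i) (a3 : t.narr 3 = s.narr 3)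
    (a4 : t.narr 4 = s.narr 4) (a5 : t.narr 5 = s.narr 5) (a6 : t.narr 6 = s.narr 6)
    (r0 : t.rarr 0 = s.rarr 0) : Epoch G n f₀ a t := by
  constructor
  · exact h.base
  · intro i hi h6
    rw [a1 i hi h6]
    exact h.agree i hi (a6 ▸ h6)
  · rw [touchedSet_congr a6, h3, a5]; exact h.tp
  · rw [h3, a5]; exact h.tp_inj
  · rw [r0]; exact h.weights
  · exact h.cyc
  · rw [h3]; exact h.mono
  · rw [h3, a6]; exact h.un
  · rw [h3, a6]; exact h.tou
  · rw [a3]; exact h.succ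
  · rw [a4]; exact h.pred
  · rw [h4]; exact h.head
  · rw [h5, h3]; exact h.head'

theorem Epoch.toAgree {G : Finset ℕ → ℝ} {n L : ℕ} {f₀ a : ℕ → ℕ} {s : State}
    (h : Epoch G n f₀ a s) (hc : Core n L s) : Agree n f₀ (s.narr 1) (touchedSet n s) where
  base := h.base
  cur := hc.list
  sub := Finset.filter_subset _ _
  eq := by
    intro i hi hiJ
    refine h.agree i hi ?_
    by_contra h0
    exact hiJ (Finset.mem_filter.mpr ⟨Finset.mem_range.mpr hi, h0⟩)

theorem Epoch.card {G : Finset ℕ → ℝ} {n : ℕ} {f₀ a : ℕ → ℕ} {s : State}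
    (h : Epoch G n f₀ a s) : (touchedSet n s).card = s.nreg 3 := by
  rw [h.tp, Finset.card_image_of_injOn h.tp_inj, Finset.card_range]

theorem Epoch.count_le {G : Finset ℕ → ℝ} {n : ℕ} {f₀ a : ℕ → ℕ} {s : State}
    (h : Epoch G n f₀ a s) : s.nreg 3 ≤ n := by
  rw [← h.card]
  simpa [touchedSet] using Finset.card_le_card (Finset.filter_subset (fun p => s.narr 6 p ≠ 0) (Finset.range n))

/-! ### Deterministic parts -/

section Parts

variable {n L : ℕ} {F : Finset (Fin n) → ℝ} {O : Oracle} {s : State} {f₀ a : ℕ → ℕ}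

theorem Core.query (hc : Core n L s) (hO : IsEvalOracle F O) {k : ℕ} (hk : k ≤ n) :
    O (s.narr 2) (s.narr 1 0) k = pv (liftNat F) (s.narr 1) k :=
  hO.eq_pv hc.list (fun _ => rfl) hc.next hk

theorem gradAt_det (hc : Core n L s) (hO : IsEvalOracle F O) {e : NExp} {p : ℕ}
    (he : e.eval s = p) (hev : ∀ v, e.eval (((s.setR 5 v).countQuery).tick (2 + e.cost + 1)) = p)
    (hcost : e.cost ≤ 2) (hp : p < n)
    {Q : State → Prop}
    (hQ : ∀ t : State, t.narr = s.narr → t.rarr = s.rarr → t.nreg = s.nreg →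
      (∀ x, x < 5 → t.rreg x = s.rreg x) → t.rreg 5 = pv (liftNat F) (s.narr 1) p →
      t.rreg 6 = pv (liftNat F) (s.narr 1) (p + 1) → t.rreg 7 = |gr (liftNat F) (s.narr 1) p| →
      t.tau ≤ s.tau + 40 → Q t) :
    Det O (gradAt e) s Q := by
  have h1 := hc.query hO (show p ≤ n by omega)
  have h2 := hc.query hO (show p + 1 ≤ n by omega)
  have e1 : gr (liftNat F) (s.narr 1) p =
      pv (liftNat F) (s.narr 1) (p + 1) - pv (liftNat F) (s.narr 1) p := rfl
  unfold gradAt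
  repeat refine Det.cons (Det.atom ?_)
  refine Det.cons (Det.ite (fun hb => Det.atom (Det.nil ?_)) (fun hb => Det.atom (Det.nil ?_)))
  all_goals
    simp [Cmd.run, he, hev, h1, h2] at hb ⊢
    apply hQ
  any_goals simp
  any_goals first | omega | (intro x hx; split_ifs <;> first | rfl | omega)
  · rw [e1, abs_of_pos (by linarith)]
  · rw [e1, abs_of_nonpos (by linarith), neg_sub]

theorem sumTouched_det (hc : Core n L s) (hO : IsEvalOracle F O)
    (he : ∀ k, k < s.nreg 3 → s.narr 5 k < n) {Q : State → Prop}
    (hQ : ∀ t : State, t.narr = s.narr → t.rarr 0 = s.rarr 0 →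
      (∀ x, x ≠ 10 → t.nreg x = s.nreg x) → t.rreg 0 = s.rreg 0 →
      (∀ k, k ≤ s.nreg 3 → t.rarr 1 k =
        ∑ j ∈ Finset.range k, |gr (liftNat F) (s.narr 1) (s.narr 5 j)|) →
      t.tau ≤ s.tau + 100 * (s.nreg 3 + 1) → Q t) :
    Det O sumTouched s Q := by
  unfold sumTouched
  repeat refine Det.cons (Det.atom ?_)
  refine Det.cons (Det.loop (fun m t => t.nreg 10 + m = s.nreg 3 ∧ t.narr = s.narr ∧
      t.rarr 0 = s.rarr 0 ∧ (∀ x, x ≠ 10 → t.nreg x = s.nreg x) ∧ t.rreg 0 = s.rreg 0 ∧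
      (∀ k, k ≤ t.nreg 10 → t.rarr 1 k =
        ∑ j ∈ Finset.range k, |gr (liftNat F) (s.narr 1) (s.narr 5 j)|) ∧
      t.tau ≤ s.tau + 20 + 80 * t.nreg 10) ?_ ?_ (s.nreg 3) _ ?_)
  · rintro m t ⟨i1, i2, i3, i4, i5, i6, i7⟩ hb
    simp only [BExp.holds, NExp.eval] at hb
    rw [i4 3 (by omega)] at hb
    refine ⟨by omega, ?_⟩
    refine Det.cons (gradAt_det (p := s.narr 5 (t.nreg 10)) (L := L) ?_ hO ?_ ?_ ?_ (he _ hb) ?_)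
    · exact hc.congr (by simp [i4]) (by simp [i4]) (by simp [i2]) (by simp [i2]) (by simp [i2])
        (by simp [i2]) (by simp [i2])
    · simp [i2]
    · simp [i2]
    · simp [NExp.cost]
    intro u u1 u2 u3 u4 u5 u6 u7 u8
    simp at u1 u2 u3 u4 u7 u8
    repeat refine Det.cons (Det.atom ?_)
    apply Det.nil
    simp [Cmd.run, u1, u2, u3, i2, i3, u7, u4, i5]
    refine ⟨by omega, ?_, ?_, by omega⟩
    · intro x hx
      simp [hx, i4]
    · intro k hk
      rw [Function.update_apply]
      split_ifs with hk2
      · rw [hk2, Finset.sum_range_succ, i6 _ le_rfl]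
      · exact i6 k (by omega)
  · rintro m t ⟨i1, i2, i3, i4, i5, i6, i7⟩ hb
    simp only [BExp.holds, NExp.eval] at hb
    rw [i4 3 (by omega)] at hb
    apply Det.nil
    apply hQ
    · simp [i2]
    · simp [i3]
    · intro x hx; simp [i4 x hx]
    · simp [i5]
    · intro k hk
      simpa using i6 k (by omega)
    · have : t.nreg 10 = s.nreg 3 := by omega
      simp
      omega
  · simp [Cmd.run]
    intro x hx
    simp [hx]

end Parts


/-! ### Reading prefixes off the cyclic list of untouched and touched elements -/

section Cyclic

open Finset

variable {n L : ℕ} {G : Finset ℕ → ℝ} {s : State} {f₀ a : ℕ → ℕ}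

theorem eq_range_card_of_lower {A : Finset ℕ} (h : ∀ k ∈ A, ∀ j, j < k → j ∈ A) :
    A = range A.card := by
  refine eq_of_subset_of_card_le (fun k hk => ?_) (by rw [card_range])
  have : range (k + 1) ⊆ A := by
    intro j hj
    rcases (Nat.lt_succ_iff.mp (mem_range.mp hj)).lt_or_eq with h1 | rfl
    · exact h k hk j h1
    · exact hk
  have := card_le_card this
  rw [card_range] at this
  exact mem_range.mpr this

theorem isList_rotate (hn : 0 < n) (m : ℕ) : IsList n fun k => (k + m) % n := by
  refine ⟨fun _ _ => Nat.mod_lt _ hn, fun i hi j hj hij => ?_⟩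
  have h : i + m ≡ j + m [MOD n] := hij
  exact Nat.ModEq.eq_of_lt_of_lt (Nat.ModEq.add_right_cancel' m h) hi hj

theorem mem_touchedSet {p : ℕ} : p ∈ touchedSet n s ↔ p < n ∧ s.narr 6 p ≠ 0 := by
  rw [touchedSet, mem_filter, mem_range]

theorem Epoch.tp_lt (h : Epoch G n f₀ a s) {k : ℕ} (hk : k < s.nreg 3) : s.narr 5 k < n := by
  have : s.narr 5 k ∈ touchedSet n s := by
    rw [h.tp]
    exact mem_image_of_mem _ (mem_range.mpr hk)
  exact (mem_touchedSet.mp this).1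

theorem Epoch.mem_iff (h : Epoch G n f₀ a s) {k : ℕ} (hk : k < n) :
    a k ∈ touchedSet n s ↔ n - s.nreg 3 ≤ k := by
  rw [mem_touchedSet]
  constructor
  · intro h1
    by_contra h2
    exact h1.2 (h.un k (by omega))
  · intro h1
    exact ⟨h.cyc.lt k hk, h.tou k hk h1⟩

/-- Untouched positions are enumerated increasingly at the front of the cycle, so those below `i`
form an initial segment of it. Its length is `i` minus the number of touched positions below `i`,
the only quantity that the program has to count. -/
theorem Epoch.prefix_card (h : Epoch G n f₀ a s) {i : ℕ} (hi : i ≤ n) :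
    ∃ j, i - ((range (s.nreg 3)).filter fun k => s.narr 5 k < i).card = j ∧
      j ≤ n - s.nreg 3 ∧ (range j).image a = (range i).filter fun p => p ∉ touchedSet n s := by
  set A := (range (n - s.nreg 3)).filter fun k => a k < i with hA
  have hAl : A = range A.card := by
    apply eq_range_card_of_lower
    intro k hk j hj
    rw [hA, mem_filter, mem_range] at hk ⊢
    exact ⟨by omega, (h.mono j k hj hk.1).trans hk.2⟩
  have hAi : A.image a = (range i).filter fun p => p ∉ touchedSet n s := by
    ext p
    simp only [mem_image, mem_filter, mem_range, hA]
    constructor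
    · rintro ⟨k, ⟨hk, hki⟩, rfl⟩
      exact ⟨hki, fun hm => by have := (h.mem_iff (by omega)).mp hm; omega⟩
    · rintro ⟨hpi, hp⟩
      obtain ⟨k, hk, rfl⟩ := h.cyc.surj (show p < n by omega)
      refine ⟨k, ⟨?_, hpi⟩, rfl⟩
      by_contra h2
      exact hp ((h.mem_iff hk).mpr (by omega))
  have hAc : A.card = ((range i).filter fun p => p ∉ touchedSet n s).card := by
    rw [← hAi, card_image_of_injOn]
    intro x hx y hy hxy
    have hx := mem_range.mp (mem_filter.mp hx).1
    have hy := mem_range.mp (mem_filter.mp hy).1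
    exact h.cyc.inj x (by omega) y (by omega) hxy
  have hT : ((range i).filter fun p => p ∈ touchedSet n s) =
      ((range (s.nreg 3)).filter fun k => s.narr 5 k < i).image (s.narr 5) := by
    ext p
    simp only [h.tp, mem_image, mem_filter, mem_range]
    constructor
    · rintro ⟨hp, k, hk, rfl⟩
      exact ⟨k, ⟨hk, hp⟩, rfl⟩
    · rintro ⟨k, ⟨hk, hp⟩, rfl⟩
      exact ⟨hp, k, hk, rfl⟩
  have hTc : ((range i).filter fun p => p ∈ touchedSet n s).card =
      ((range (s.nreg 3)).filter fun k => s.narr 5 k < i).card := by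
    rw [hT, card_image_of_injOn]
    exact h.tp_inj.mono (by intro x hx; exact (mem_filter.mp hx).1)
  have hsum := card_filter_add_card_filter_not (s := range i) (fun p => p ∈ touchedSet n s)
  rw [card_range] at hsum
  refine ⟨A.card, by omega, ?_, ?_⟩
  · have := card_le_card (filter_subset (fun k => a k < i) (range (n - s.nreg 3)))
    rwa [card_range] at this
  · rw [← hAl, hAi]

theorem image_prefix {i j : ℕ}
    (hj : (range j).image a = (range i).filter fun p => p ∉ touchedSet n s) :
    (range j).image (fun k => f₀ (a k)) = untouched f₀ (touchedSet n s) i := by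
  unfold untouched
  rw [← hj, image_image]
  rfl

/-- Read from the first touched element, the cycle yields all touched elements and then wraps around
to the untouched ones. -/
theorem Epoch.image_prefix' (h : Epoch G n f₀ a s) {i j : ℕ} (hjn : j ≤ n - s.nreg 3)
    (hj : (range j).image a = (range i).filter fun p => p ∉ touchedSet n s) :
    (range (s.nreg 3 + j)).image (fun k => f₀ (a ((k + (n - s.nreg 3)) % n))) =
      untouched f₀ (touchedSet n s) i ∪ (touchedSet n s).image f₀ := by
  have hs := h.count_le
  rw [← image_prefix hj]
  ext x
  simp only [mem_union, mem_image, mem_range]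
  constructor
  · rintro ⟨k, hk, rfl⟩
    by_cases hks : k < s.nreg 3
    · right
      have hlt : k + (n - s.nreg 3) < n := by omega
      rw [Nat.mod_eq_of_lt hlt]
      exact ⟨_, (h.mem_iff hlt).mpr (by omega), rfl⟩
    · left
      refine ⟨k - s.nreg 3, by omega, ?_⟩
      have : k + (n - s.nreg 3) = (k - s.nreg 3) + n := by omega
      rw [this, Nat.add_mod_right, Nat.mod_eq_of_lt (by omega)]
  · rintro (⟨k, hk, rfl⟩ | ⟨p, hp, rfl⟩)
    · refine ⟨s.nreg 3 + k, by omega, ?_⟩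
      have : s.nreg 3 + k + (n - s.nreg 3) = k + n := by omega
      rw [this, Nat.add_mod_right, Nat.mod_eq_of_lt (by omega)]
    · obtain ⟨k, hk, rfl⟩ := h.cyc.surj (mem_touchedSet.mp hp).1
      have := (h.mem_iff hk).mp hp
      refine ⟨k - (n - s.nreg 3), by omega, ?_⟩
      rw [Nat.sub_add_cancel this, Nat.mod_eq_of_lt hk]

theorem Epoch.query_low {F : Finset (Fin n) → ℝ} {O : Oracle} (hO : IsEvalOracle F O)
    (h : Epoch (liftNat F) n f₀ a s) {i : ℕ} (hi : i ≤ n) :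
    O (s.narr 3) (s.nreg 4)
      (i - ((range (s.nreg 3)).filter fun k => s.narr 5 k < i).card) =
      liftNat F (untouched f₀ (touchedSet n s) i) := by
  obtain ⟨j, hj1, hj2, hj3⟩ := h.prefix_card hi
  rw [hj1, hO.eq_pv (f := fun k => f₀ (a k)) (h.base.comp h.cyc) (fun _ => h.head) ?_ (by omega),
    pv, image_prefix hj3]
  intro k hk
  rw [h.succ k (by omega), Nat.mod_eq_of_lt hk]

theorem Epoch.query_high {F : Finset (Fin n) → ℝ} {O : Oracle} (hO : IsEvalOracle F O)
    (h : Epoch (liftNat F) n f₀ a s) {i : ℕ} (hi : i ≤ n) (hn : 0 < n) :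
    O (s.narr 3) (s.nreg 5) (s.nreg 3 +
      (i - ((range (s.nreg 3)).filter fun k => s.narr 5 k < i).card)) =
      liftNat F (untouched f₀ (touchedSet n s) i ∪ (touchedSet n s).image f₀) := by
  obtain ⟨j, hj1, hj2, hj3⟩ := h.prefix_card hi
  have hs := h.count_le
  rw [hj1, hO.eq_pv (f := fun k => f₀ (a ((k + (n - s.nreg 3)) % n)))
    (h.base.comp (h.cyc.comp (isList_rotate hn _))) (fun _ => by simpa using h.head') ?_
    (by omega), pv, h.image_prefix' hj2 hj3]
  intro k hk
  rw [h.succ _ (Nat.mod_lt _ hn), Nat.mod_add_mod]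
  congr 3
  omega

end Cyclic

/-! ### Evaluating the potential and starting an epoch -/

section Parts

variable {n L : ℕ} {F : Finset (Fin n) → ℝ} {O : Oracle} {s : State} {f₀ a : ℕ → ℕ}

theorem evalPot_det (hc : Core n L s) (h : Epoch (liftNat F) n f₀ a s) (hO : IsEvalOracle F O)
    (hn : 0 < n) (hi : s.nreg 8 ≤ n + s.nreg 3)
    (hB : ∀ k, k ≤ s.nreg 3 → s.rarr 1 k =
        ∑ j ∈ Finset.range k, |gr (liftNat F) (s.narr 1) (s.narr 5 j)|) {Q : State → Prop}
    (hQ : ∀ t : State, t.narr = s.narr → t.rarr = s.rarr →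
      (∀ x, x < 9 ∨ x = 11 → t.nreg x = s.nreg x) → (∀ x, x < 3 ∨ x = 4 → t.rreg x = s.rreg x) →
      t.rreg 3 = pot (liftNat F) n f₀ (s.narr 1) (touchedSet n s) (s.narr 5) (s.nreg 8) →
      t.tau ≤ s.tau + 100 * (s.nreg 3 + 1) → Q t) :
    Det O evalPot s Q := by
  unfold evalPot
  obtain ⟨x₀, hx₀⟩ : ∃ x, min (s.nreg 8) n = x := ⟨_, rfl⟩
  have hmin : s.nreg 8 - (s.nreg 8 - n) = x₀ := by omega
  have hxn : x₀ ≤ n := by omega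
  repeat refine Det.cons (Det.atom ?_)
  refine Det.cons (Det.loop (fun m t => t.nreg 10 + m = s.nreg 3 ∧ t.narr = s.narr ∧
      t.rarr = s.rarr ∧ (∀ x, x < 9 ∨ x = 11 → t.nreg x = s.nreg x) ∧ t.rreg = s.rreg ∧
      t.nreg 12 = x₀ ∧
      t.nreg 9 = ((Finset.range (t.nreg 10)).filter fun k => s.narr 5 k < x₀).card ∧
      t.tau ≤ s.tau + 20 + 50 * t.nreg 10) ?_ ?_ (s.nreg 3) _ ?_)
  · rintro m t ⟨i1, i2, i3, i4, i5, i6, i7, i8⟩ hb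
    simp only [BExp.holds, NExp.eval] at hb
    rw [i4 3 (by omega)] at hb
    refine ⟨by omega, ?_⟩
    refine Det.cons (Det.ite (fun hb' => Det.atom ?_) (fun hb' => Det.atom ?_))
    all_goals
      repeat refine Det.cons (Det.atom ?_)
      apply Det.nil
      simp only [BExp.holds, NExp.eval, State.tick_narr, State.tick_nreg, i2, i6] at hb'
      simp [Cmd.run, i2, i3, i5, i6, i7, Finset.range_add_one, Finset.filter_insert, hb']
      refine ⟨by omega, ?_, by omega⟩
      intro x hx
      rw [if_neg (by omega)]
      try rw [if_neg (by omega)]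
      exact i4 x hx
  · rintro m t ⟨i1, i2, i3, i4, i5, i6, i7, i8⟩ hb
    simp only [BExp.holds, NExp.eval] at hb
    rw [i4 3 (by omega)] at hb
    have hm : t.nreg 10 = s.nreg 3 := by omega
    repeat refine Det.cons (Det.atom ?_)
    apply Det.nil
    have q1 := h.query_low hO hxn
    have q2 := h.query_high hO hxn hn
    rw [hm] at i7
    apply hQ
    · simp [Cmd.run, i2]
    · simp [Cmd.run, i3]
    · intro x hx
      simp [Cmd.run, i4 x hx]
    · intro x hx
      simp only [Cmd.run, State.tick_rreg, State.setR_rreg, State.countQuery_rreg]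
      rw [if_neg (by omega), if_neg (by omega), if_neg (by omega), i5]
    · simp [Cmd.run, i2, i3, i4, i6, i7, q1, q2]
      rw [hB _ (by rw [hc.size]; omega), h.weights _ hxn, hc.size, pot, hx₀]
    · simp [Cmd.run]
      omega
  · simp [Cmd.run, hc.size, hmin]
    intro x hx
    rw [if_neg (by omega), if_neg (by omega), if_neg (by omega)]

theorem rebuild_det (hc : Core n L s) (hO : IsEvalOracle F O) (hn : 0 < n) {Q : State → Prop}
    (hQ : ∀ t : State, (∀ x, x = 0 ∨ x = 1 ∨ x = 2 ∨ x = 7 ∨ x = 8 → t.narr x = s.narr x) →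
      (∀ x, x < 3 → t.nreg x = s.nreg x) → t.rreg 0 = s.rreg 0 → t.nreg 3 = 0 →
      Epoch (liftNat F) n (s.narr 1) id t →
      t.tau ≤ s.tau + 200 * (n + 1) → Q t) :
    Det O rebuild s Q := by
  unfold rebuild
  repeat refine Det.cons (Det.atom ?_)
  refine Det.cons (Det.loop (fun m t => t.nreg 10 + m = n ∧
      (∀ x, x = 0 ∨ x = 1 ∨ x = 2 ∨ x = 7 ∨ x = 8 → t.narr x = s.narr x) ∧
      (∀ x, x < 3 → t.nreg x = s.nreg x) ∧ t.rreg 0 = s.rreg 0 ∧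
      (t.nreg 3 = 0 ∧ t.nreg 4 = s.narr 1 0 ∧ t.nreg 5 = s.narr 1 0) ∧
      (∀ k, k ≤ t.nreg 10 → t.rarr 0 k =
        ∑ j ∈ Finset.range k, |gr (liftNat F) (s.narr 1) j|) ∧
      (∀ k, k < t.nreg 10 → t.narr 6 k = 0) ∧
      (∀ k, k + 1 < t.nreg 10 → t.narr 3 (s.narr 1 k) = s.narr 1 (k + 1) ∧
        t.narr 4 (s.narr 1 (k + 1)) = s.narr 1 k) ∧
      t.tau ≤ s.tau + 40 + 100 * t.nreg 10) ?_ ?_ n _ ?_)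
  · rintro m t ⟨i1, i2, i3, i4, i5, i6, i7, i8, i9⟩ hb
    simp only [BExp.holds, NExp.eval] at hb
    rw [i3 0 (by omega), hc.size] at hb
    refine ⟨by omega, ?_⟩
    refine Det.cons (gradAt_det (p := t.nreg 10) (L := L) ?_ hO (by simp) (by simp) (by simp)
      hb ?_)
    · exact hc.congr (by simp [i3]) (by simp [i3]) (by simp [i2]) (by simp [i2]) (by simp [i2])
        (by simp [i2]) (by simp [i2])
    intro u u1 u2 u3 u4 u5 u6 u7 u8
    simp at u1 u2 u3 u4 u7 u8
    repeat refine Det.cons (Det.atom ?_)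
    apply Det.nil
    have a1 : t.narr 1 = s.narr 1 := i2 1 (by omega)
    refine ⟨?_, ?_, ?_, ?_, ?_, ?_, ?_, ?_, ?_⟩
    · simp [Cmd.run, u3]
      omega
    · rintro x (rfl | rfl | rfl | rfl | rfl) <;> simp [Cmd.run, u1, i2]
    · intro x hx
      simp [Cmd.run, u3, show x ≠ 10 by omega, i3 x hx]
    · simp [Cmd.run, u4, i4]
    · simp [Cmd.run, u3, i5]
    · intro k hk
      have hk : k ≤ t.nreg 10 + 1 := by simpa [Cmd.run, u3] using hk
      simp [Cmd.run, u2, u3, u7, a1, Function.update_apply]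
      split_ifs with hk2
      · rw [hk2, Finset.sum_range_succ, i6 _ le_rfl]
      · exact i6 k (by omega)
    · intro k hk
      have hk : k < t.nreg 10 + 1 := by simpa [Cmd.run, u3] using hk
      simp [Cmd.run, u1, u3, Function.update_apply]
      intro hk2
      exact i7 k (by omega)
    · intro k hk
      have hk : k + 1 < t.nreg 10 + 1 := by simpa [Cmd.run, u3] using hk
      simp [Cmd.run, u1, u3, a1, Function.update_apply]
      rcases Nat.lt_or_ge (k + 1) (t.nreg 10) with h1 | h1
      · have e1 : s.narr 1 k ≠ s.narr 1 (t.nreg 10 - 1) := fun he => by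
          have := hc.list.inj _ (by omega) _ (by omega) he
          omega
        have e2 : s.narr 1 (k + 1) ≠ s.narr 1 (t.nreg 10) := fun he => by
          have := hc.list.inj _ (by omega) _ (by omega) he
          omega
        rw [if_neg e1, if_neg e2]
        exact i8 k h1
      · have e : t.nreg 10 = k + 1 := by omega
        simp [e]
    · simp [Cmd.run, u3]
      omega
  · rintro m t ⟨i1, i2, i3, i4, i5, i6, i7, i8, i9⟩ hb
    simp only [BExp.holds, NExp.eval] at hb
    rw [i3 0 (by omega), hc.size] at hb
    have hm : t.nreg 10 = n := by omega
    rw [hm] at i6 i7 i8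
    have a1 : t.narr 1 = s.narr 1 := i2 1 (by omega)
    have r0 : t.nreg 0 = n := by rw [i3 0 (by omega), hc.size]
    repeat refine Det.cons (Det.atom ?_)
    apply Det.nil
    apply hQ
    · rintro x (rfl | rfl | rfl | rfl | rfl) <;> simp [Cmd.run, i2]
    · intro x hx
      simp [Cmd.run, i3 x hx]
    · simp [Cmd.run, i4]
    · simp [Cmd.run, i5]
    · have key : ∀ k, k < n → (k + 1 < n ∧ (k + 1) % n = k + 1) ∨
          (k = n - 1 ∧ (k + 1) % n = 0) := by
        intro k hk
        rcases Nat.lt_or_ge (k + 1) n with h1 | h1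
        · exact Or.inl ⟨h1, Nat.mod_eq_of_lt h1⟩
        · have : k + 1 = n := by omega
          exact Or.inr ⟨by omega, by rw [this, Nat.mod_self]⟩
      constructor
      · exact hc.list
      · intro i _ _
        simp [Cmd.run, a1]
      · simp only [Cmd.run, State.tick_nreg, State.putN_nreg, i5, touchedSet]
        rw [Finset.range_zero, Finset.image_empty]
        refine Finset.eq_empty_of_forall_notMem fun p hp => ?_
        have hp := Finset.mem_filter.mp hp
        exact hp.2 (by simpa using i7 p (Finset.mem_range.mp hp.1))
      · simp [Cmd.run, i5]
      · intro i hi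
        simpa [Cmd.run] using i6 i hi
      · exact ⟨fun i hi => hi, fun i _ j _ hij => hij⟩
      · intro i j hij _
        exact hij
      · intro k hk
        have : k < n := by omega
        simpa [Cmd.run] using i7 k this
      · intro k hk hk'
        simp [Cmd.run, i5] at hk'
        omega
      · intro k hk
        simp [Cmd.run, a1, r0, Function.update_apply]
        rcases key k hk with ⟨h1, h2⟩ | ⟨h1, h2⟩
        · rw [h2, if_neg, (i8 k h1).1]
          intro he
          have := hc.list.inj _ (by omega) _ (by omega) he
          omega
        · rw [h2, h1, if_pos rfl]
      · intro k hk
        simp [Cmd.run, a1, r0, Function.update_apply]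
        rcases key k hk with ⟨h1, h2⟩ | ⟨h1, h2⟩
        · rw [h2, if_neg, (i8 k h1).2]
          intro he
          have := hc.list.inj _ (by omega) _ (by omega) he
          omega
        · rw [h2, h1, if_pos rfl]
      · simp [Cmd.run, i5]
      · simp [Cmd.run, i5]
    · simp [Cmd.run]
      omega
  · simp [Cmd.run]
    intro x hx
    rw [if_neg (by omega), if_neg (by omega), if_neg (by omega), if_neg (by omega)]

end Parts


/-! ### Moving an element to the end of the cyclic list -/

section Touch

/-- The successor in a cycle of length `n`. -/
def cycSucc (n k : ℕ) : ℕ := if k + 1 < n then k + 1 else 0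

theorem mod_eq_cycSucc {n k : ℕ} (hk : k < n) : (k + 1) % n = cycSucc n k := by
  unfold cycSucc
  split_ifs with h
  · exact Nat.mod_eq_of_lt h
  · rw [show k + 1 = n by omega, Nat.mod_self]

/-- Move the index `r` to the end of `0, …, n - 1`. -/
def toEnd (n r k : ℕ) : ℕ := if k < r then k else if k + 1 < n then k + 1 else r

theorem isList_toEnd {n r : ℕ} (hr : r < n) : IsList n (toEnd n r) := by
  constructor
  · intro i hi
    unfold toEnd
    split_ifs <;> omega
  · intro i hi j hj
    unfold toEnd
    split_ifs <;> omega

theorem IsList.update_apply {n : ℕ} {b : ℕ → ℕ} (hb : IsList n b) (f : ℕ → ℕ) {i j : ℕ} (v : ℕ)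
    (hi : i < n) (hj : j < n) :
    Function.update f (b i) v (b j) = if j = i then v else f (b j) := by
  rw [Function.update_apply]
  by_cases h : j = i
  · rw [if_pos h, if_pos (congrArg b h)]
  · rw [if_neg h, if_neg fun he => h (hb.inj _ hj _ hi he)]

variable {n : ℕ} {b cy cp : ℕ → ℕ} {r : ℕ}

/-- The three updates unlink `b r` and reinsert it before the head `b 0`. The index `l` is that of
the last element once `b r` is unlinked: `n - 1`, or `r - 1` if `b r` was itself last. -/
theorem cycle_toEnd_succ (hb : IsList n b) (h : ∀ k, k < n → cy (b k) = b ((k + 1) % n))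
    (h0 : 0 < r) (hr : r < n) {l : ℕ} (hl : l = if r + 1 < n then n - 1 else r - 1) :
    ∀ k, k < n →
      Function.update (Function.update (Function.update cy (b (r - 1)) (b ((r + 1) % n))) (b l)
        (b r)) (b r) (b 0) (b (toEnd n r k)) = b (toEnd n r ((k + 1) % n)) := by
  intro k hk
  have hln : l < n := by split_ifs at hl <;> omega
  have ht := (isList_toEnd hr).lt k hk
  rw [hb.update_apply _ _ hr ht, hb.update_apply _ _ hln ht, hb.update_apply _ _ (by omega) ht,
    h _ ht, mod_eq_cycSucc hr, mod_eq_cycSucc ht, mod_eq_cycSucc hk]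
  simp only [← apply_ite b]
  congr 1
  subst hl
  simp only [cycSucc, toEnd]
  split_ifs <;> omega

theorem cycle_toEnd_pred (hb : IsList n b) (h : ∀ k, k < n → cp (b ((k + 1) % n)) = b k)
    (h0 : 0 < r) (hr : r < n) {l : ℕ} (hl : l = if r + 1 < n then n - 1 else r - 1) :
    ∀ k, k < n →
      Function.update (Function.update (Function.update cp (b ((r + 1) % n)) (b (r - 1))) (b r)
        (b l)) (b 0) (b r) (b (toEnd n r ((k + 1) % n))) = b (toEnd n r k) := by
  intro k hk
  have hn : 0 < n := by omega
  have hln : l < n := by split_ifs at hl <;> omega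
  have ht := (isList_toEnd hr).lt _ (Nat.mod_lt (k + 1) hn)
  have h' : ∀ j, j < n → cp (b j) = b (if 0 < j then j - 1 else n - 1) := by
    intro j hj
    split_ifs with hj0
    · have := h (j - 1) (by omega)
      rwa [Nat.sub_add_cancel hj0, Nat.mod_eq_of_lt hj] at this
    · have := h (n - 1) (by omega)
      rwa [Nat.sub_add_cancel hn, Nat.mod_self, show 0 = j by omega] at this
  rw [hb.update_apply _ _ hn ht, hb.update_apply _ _ hr ht,
    hb.update_apply _ _ (Nat.mod_lt _ hn) ht,
    h' _ ht, mod_eq_cycSucc hr, mod_eq_cycSucc hk]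
  simp only [← apply_ite b]
  congr 1
  subst hl
  obtain ⟨i, hi⟩ : ∃ i, cycSucc n k = i := ⟨_, rfl⟩
  obtain ⟨j, hj⟩ : ∃ j, toEnd n r i = j := ⟨_, rfl⟩
  rw [hi, hj]
  simp only [cycSucc, toEnd] at hi hj ⊢
  split_ifs at hi <;> split_ifs at hj <;> split_ifs <;> omega

/-- Shows that the predecessor of the head, read after unlinking `b r`, is the `b l` of the two
preceding lemmas in both cases. -/
theorem cycle_last (hb : IsList n b) (h : ∀ k, k < n → cp (b ((k + 1) % n)) = b k)
    (h0 : 0 < r) (hr : r < n) :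
    Function.update cp (b ((r + 1) % n)) (b (r - 1)) (b 0) =
      b (if r + 1 < n then n - 1 else r - 1) := by
  have hn : 0 < n := by omega
  have := h (n - 1) (by omega)
  rw [Nat.sub_add_cancel hn, Nat.mod_self] at this
  rw [hb.update_apply _ _ (Nat.mod_lt _ hn) hn, this, mod_eq_cycSucc hr]
  unfold cycSucc
  by_cases h1 : r + 1 < n
  · simp [h1]
  · simp [h1]

end Touch

section Parts

variable {n L : ℕ} {F : Finset (Fin n) → ℝ} {O : Oracle} {s : State} {f₀ a : ℕ → ℕ}
  {G : Finset ℕ → ℝ}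

/-- The combinatorial effect of touching the position `a r`. -/
theorem Epoch.touch (h : Epoch G n f₀ a s) {r : ℕ} (hr : r < n - s.nreg 3) {t : State}
    (h3 : t.nreg 3 = s.nreg 3 + 1) (a1 : t.narr 1 = s.narr 1) (r0 : t.rarr 0 = s.rarr 0)
    (a6 : t.narr 6 = Function.update (s.narr 6) (a r) 1)
    (a5 : t.narr 5 = Function.update (s.narr 5) (s.nreg 3) (a r))
    (h5 : t.nreg 5 = if 0 < s.nreg 3 then s.nreg 5 else f₀ (a r))
    (h4 : t.nreg 4 = f₀ (a (toEnd n r 0)))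
    (a3 : ∀ k, k < n → t.narr 3 (f₀ (a (toEnd n r k))) = f₀ (a (toEnd n r ((k + 1) % n))))
    (a4 : ∀ k, k < n → t.narr 4 (f₀ (a (toEnd n r ((k + 1) % n)))) = f₀ (a (toEnd n r k))) :
    Epoch G n f₀ (fun k => a (toEnd n r k)) t := by
  have hrn : r < n := by omega
  have hte := isList_toEnd hrn
  constructor
  · exact h.base
  · intro i hi hi6
    rw [a6, Function.update_apply] at hi6
    rw [a1]
    split_ifs at hi6
    exact h.agree i hi hi6
  · have e1 : touchedSet n t = insert (a r) (touchedSet n s) := by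
      ext p
      rw [Finset.mem_insert, mem_touchedSet, mem_touchedSet, a6, Function.update_apply]
      by_cases hp : p = a r
      · simp [hp, h.cyc.lt r hrn]
      · simp [hp]
    rw [e1, h.tp, h3, a5, Finset.range_add_one, Finset.image_insert, Function.update_self]
    congr 1
    refine Finset.image_congr fun k hk => ?_
    have : k < s.nreg 3 := by simpa using hk
    rw [Function.update_of_ne (by omega)]
  · intro i hi j hj hij
    rw [h3] at hi hj
    simp only [Finset.coe_range, Set.mem_Iio] at hi hj
    have key : ∀ k, k < s.nreg 3 → s.narr 5 k ≠ a r := by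
      intro k hk he
      have : a r ∈ touchedSet n s := by
        rw [h.tp, ← he]
        exact Finset.mem_image_of_mem _ (Finset.mem_range.mpr hk)
      have := (h.mem_iff hrn).mp this
      omega
    rw [a5, Function.update_apply, Function.update_apply] at hij
    split_ifs at hij with hi' hj' hj'
    · omega
    · exact absurd hij.symm (key j (by omega))
    · exact absurd hij (key i (by omega))
    · exact h.tp_inj (by simp; omega) (by simp; omega) hij
  · rw [r0]; exact h.weights
  · exact h.cyc.comp hte
  · intro i j hij hj
    rw [h3] at hj
    apply h.mono <;> unfold toEnd <;> split_ifs <;> omega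
  · intro k hk
    rw [h3] at hk
    rw [a6, Function.update_of_ne]
    · apply h.un
      unfold toEnd
      split_ifs <;> omega
    · intro he
      have := h.cyc.inj _ (hte.lt k (by omega)) _ hrn he
      unfold toEnd at this
      split_ifs at this <;> omega
  · intro k hk hk'
    rw [h3] at hk'
    rw [a6, Function.update_apply]
    split_ifs with he
    · exact one_ne_zero
    · have : toEnd n r k ≠ r := fun e => he (by rw [e])
      apply h.tou _ (hte.lt k hk)
      unfold toEnd at this ⊢
      split_ifs at this ⊢ <;> omega
  · exact a3
  · exact a4
  · exact h4
  · rw [h5, h3, Nat.mod_eq_of_lt (by omega)]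
    split_ifs with hs
    · rw [h.head', Nat.mod_eq_of_lt (by omega)]
      congr 2
      unfold toEnd
      split_ifs <;> omega
    · congr 2
      unfold toEnd
      split_ifs <;> omega

theorem touch_det (h : Epoch G n f₀ a s) {p : ℕ} (hp : s.nreg 17 = p) (hpn : p < n)
    {Q : State → Prop}
    (hQ : ∀ t : State, (∀ x, x = 0 ∨ x = 1 ∨ x = 2 ∨ x = 7 ∨ x = 8 → t.narr x = s.narr x) →
      t.rreg = s.rreg → (∀ x, x < 3 ∨ (5 < x ∧ x < 18) → t.nreg x = s.nreg x) →
      (∃ a', Epoch G n f₀ a' t) → t.narr 6 p ≠ 0 → (∀ i, s.narr 6 i ≠ 0 → t.narr 6 i ≠ 0) →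
      t.nreg 3 ≤ s.nreg 3 + 1 → t.tau ≤ s.tau + 100 → Q t) :
    Det O touch s Q := by
  unfold touch
  refine Det.ite (fun hb => ?_) (fun hb => ?_)
  · refine Det.atom ?_
    simp [hp] at hb
    apply hQ
    · simp [Cmd.run]
    · simp [Cmd.run]
    · simp [Cmd.run]
    · exact ⟨a, h.congr (by simp [Cmd.run]) (by simp [Cmd.run]) (by simp [Cmd.run])
        (by simp [Cmd.run]) (by simp [Cmd.run]) (by simp [Cmd.run]) (by simp [Cmd.run])
        (by simp [Cmd.run]) (by simp [Cmd.run])⟩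
    · simp [Cmd.run]
      omega
    · simp [Cmd.run]
    · simp [Cmd.run]
    · simp [Cmd.run]
  · have h6 : s.narr 6 p = 0 := by simpa [hp] using hb
    obtain ⟨r, hrn, rfl⟩ := h.cyc.surj hpn
    have hr : r < n - s.nreg 3 := by
      by_contra hr
      exact h.tou r hrn (by omega) h6
    -- An untouched position still holds its base entry, so the cell to be moved can be read from
    -- the current order.
    have hu : s.narr 1 (a r) = f₀ (a r) := h.agree _ hpn h6
    have hb := h.base.comp h.cyc
    have hsu := h.succ r hrn
    have hinj : f₀ (a r) = f₀ (a 0) ↔ r = 0 :=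
      ⟨fun he => hb.inj _ hrn _ (by omega) he, fun he => by rw [he]⟩
    repeat refine Det.cons (Det.atom ?_)
    refine Det.cons (Det.ite (fun hc => Det.atom ?_) (fun hc => ?_))
    -- The head of a cycle goes to its end by advancing the head pointer alone; no link changes.
    · have hc : r = 0 := by
        rw [← hinj]
        simp [Cmd.run, hp, hu, h.head] at hc
        omega
      refine Det.cons (Det.ite (fun hd => Det.atom ?_) (fun hd => Det.atom ?_))
      all_goals
        refine Det.cons (Det.atom (Det.nil ?_))
        simp [Cmd.run] at hd
        apply hQ
        · rintro x (rfl | rfl | rfl | rfl | rfl) <;> simp [Cmd.run]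
        · simp [Cmd.run]
        · intro x hx
          simp only [Cmd.run, State.tick_nreg, State.setN_nreg, State.putN_nreg]
          repeat rw [if_neg (by omega)]
        · refine ⟨_, h.touch hr ?_ ?_ ?_ ?_ ?_ ?_ ?_ ?_ ?_⟩
          · simp [Cmd.run]
          · simp [Cmd.run]
          · simp [Cmd.run]
          · simp [Cmd.run, hp]
          · simp [Cmd.run, hp]
          · simp [Cmd.run, hp, hu, hd]
          · simp [Cmd.run, hp, hu, hsu]
            congr 2
            rw [mod_eq_cycSucc hrn, cycSucc, toEnd, hc]
            split_ifs <;> omega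
          · intro k hk
            simp [Cmd.run]
            rw [h.succ _ ((isList_toEnd hrn).lt k hk)]
            congr 2
            rw [mod_eq_cycSucc ((isList_toEnd hrn).lt k hk), mod_eq_cycSucc hk]
            unfold cycSucc toEnd
            split_ifs <;> omega
          · intro k hk
            simp [Cmd.run]
            rw [← h.pred _ ((isList_toEnd hrn).lt k hk)]
            congr 3
            rw [mod_eq_cycSucc ((isList_toEnd hrn).lt k hk), mod_eq_cycSucc hk]
            unfold cycSucc toEnd
            split_ifs <;> omega
        · simp [Cmd.run, hp]
        · intro i hi
          simp [Cmd.run, Function.update_apply]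
          split_ifs <;> first | exact hi | simp
        · simp [Cmd.run]
        · simp [Cmd.run]
    · have hc : 0 < r := by
        rw [Nat.pos_iff_ne_zero, Ne, ← hinj]
        intro he
        apply hc
        simp [Cmd.run, hp, hu, h.head, he]
      have hpr : s.narr 4 (f₀ (a r)) = f₀ (a (r - 1)) := by
        have := h.pred (r - 1) (by omega)
        rwa [Nat.sub_add_cancel hc, Nat.mod_eq_of_lt hrn] at this
      have hla := cycle_last hb h.pred hc hrn
      repeat refine Det.cons (Det.atom ?_)
      apply Det.nil
      refine Det.cons (Det.ite (fun hd => Det.atom ?_) (fun hd => Det.atom ?_))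
      all_goals
        refine Det.cons (Det.atom (Det.nil ?_))
        simp [Cmd.run] at hd
        apply hQ
        · rintro x (rfl | rfl | rfl | rfl | rfl) <;> simp [Cmd.run]
        · simp [Cmd.run]
        · intro x hx
          simp only [Cmd.run, State.tick_nreg, State.setN_nreg, State.putN_nreg]
          repeat rw [if_neg (by omega)]
        · refine ⟨_, h.touch hr ?_ ?_ ?_ ?_ ?_ ?_ ?_ ?_ ?_⟩
          · simp [Cmd.run]
          · simp [Cmd.run]
          · simp [Cmd.run]
          · simp [Cmd.run, hp]
          · simp [Cmd.run, hp]
          · simp [Cmd.run, hp, hu, hd]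
          · simp [Cmd.run, h.head, toEnd, hc]
          · simp [Cmd.run, hp, hu, hsu, hpr, h.head, hla]
            exact cycle_toEnd_succ hb h.succ hc hrn rfl
          · simp [Cmd.run, hp, hu, hsu, hpr, h.head, hla]
            exact cycle_toEnd_pred hb h.pred hc hrn rfl
        · simp [Cmd.run, hp]
        · intro i hi
          simp [Cmd.run, Function.update_apply]
          split_ifs <;> first | exact hi | simp
        · simp [Cmd.run]
        · simp [Cmd.run]

end Parts


/-! ### Exchanging two entries of the current order -/

section Parts

variable {n L : ℕ} {F : Finset (Fin n) → ℝ} {O : Oracle} {s : State} {f₀ a : ℕ → ℕ}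
  {G : Finset ℕ → ℝ}

/-- The list `f` with the entries `p` and `q` exchanged. -/
def exchange (f : ℕ → ℕ) (p q : ℕ) : ℕ → ℕ := Function.update (Function.update f p (f q)) q (f p)

theorem exchange_apply (f : ℕ → ℕ) (p q i : ℕ) :
    exchange f p q i = f (if i = q then p else if i = p then q else i) := by
  simp only [exchange, Function.update_apply]
  split_ifs <;> rfl

theorem IsList.exchange {f : ℕ → ℕ} (hf : IsList n f) {p q : ℕ} (hp : p < n) (hq : q < n) :
    IsList n (exchange f p q) := by
  have : IsList n fun i => if i = q then p else if i = p then q else i := by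
    constructor
    · intro i hi
      split_ifs <;> omega
    · intro i hi j hj
      split_ifs <;> omega
  have h := hf.comp this
  constructor
  · intro i hi
    rw [exchange_apply]
    exact h.lt i hi
  · intro i hi j hj hij
    rw [exchange_apply, exchange_apply] at hij
    exact h.inj i hi j hj hij

/-- Only links leaving `p - 1`, `p`, `q - 1` and `q` can change. Each update writes the correct
successor, so overlaps among these positions and the truncated `0 - 1` do no harm. -/
theorem exchange_next {f nx : ℕ → ℕ} (hf : IsList n f)
    (h : ∀ i, i + 1 < n → nx (f i) = f (i + 1)) {p q : ℕ} (hp : p < n) (hq : q < n) {g : ℕ → ℕ}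
    (hg : g = exchange f p q) :
    ∀ i, i + 1 < n →
      Function.update (Function.update (Function.update (Function.update nx
        (g (p - 1)) (g (p - 1 + 1))) (g p) (g (p + 1))) (g (q - 1)) (g (q - 1 + 1)))
        (g q) (g (q + 1)) (g i) = g (i + 1) := by
  subst hg
  intro i hi
  have hl := hf.exchange hp hq
  have hi' : i < n := by omega
  rw [hl.update_apply _ _ hq hi', hl.update_apply _ _ (by omega) hi',
    hl.update_apply _ _ hp hi', hl.update_apply _ _ (by omega) hi']
  split_ifs with h1 h2 h3 h4
  · rw [h1]
  · rw [h2]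
  · rw [h3]
  · rw [h4]
  · rw [exchange_apply, exchange_apply, if_neg h1, if_neg h3, if_neg (by omega),
      if_neg (by omega), h i hi]

theorem moveTo_det (hc : Core n L s) (h : Epoch G n f₀ a s) {p q e y l' : ℕ}
    (hp : s.nreg 12 = p) (hq : s.nreg 13 = q) (he : s.nreg 14 = e) (hy : s.nreg 15 = y)
    (hl : s.nreg 16 = l') (hpn : p < n) (hqn : q < n) (hyn : y ≤ n) (hl' : l' ≤ L)
    (hb : ∀ l, 1 ≤ l → ∀ i, i < n → (i < Function.update (s.narr 8) e y l ↔
      l ≤ Function.update (s.narr 7) q l' i))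
    {Q : State → Prop}
    (hQ : ∀ t : State, Core n L t → (∃ a', Epoch G n f₀ a' t) →
      t.narr 1 = exchange (s.narr 1) p q → t.narr 7 = Function.update (s.narr 7) q l' →
      t.nreg 2 = s.nreg 2 → t.rreg 0 = s.rreg 0 → t.nreg 3 ≤ s.nreg 3 + 2 →
      t.tau ≤ s.tau + 300 → Q t) :
    Det O moveTo s Q := by
  unfold moveTo relink
  refine Det.cons (Det.atom (Det.cons (touch_det (G := G) (f₀ := f₀) (a := a) (p := p) (n := n)
    (h.congr ?_ ?_ ?_ ?_ ?_ ?_ ?_ ?_ ?_) ?_ hpn ?_)))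
  any_goals (simp [Cmd.run, hp]; done)
  rintro u u1 u2 u3 ⟨a₁, hu⟩ u4 u5 u6 u7
  simp only [Cmd.run, State.tick_narr, State.setN_narr, State.tick_rreg, State.setN_rreg,
    State.tick_nreg, State.setN_nreg, NExp.eval, hp] at u1 u2 u3 u5 u6
  refine Det.cons (Det.atom (Det.cons (touch_det (G := G) (f₀ := f₀) (a := a₁) (p := q) (n := n)
    (hu.congr ?_ ?_ ?_ ?_ ?_ ?_ ?_ ?_ ?_) ?_ hqn ?_)))
  any_goals (simp [Cmd.run, hq, u3]; done)
  rintro v v1 v2 v3 ⟨a₂, hv⟩ v4 v5 v6 v7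
  simp only [Cmd.run, State.tick_narr, State.setN_narr, State.tick_rreg, State.setN_rreg,
    State.tick_nreg, State.setN_nreg, NExp.eval] at v1 v2 v3 v5 v6
  simp [Cmd.run] at u7 v7 u6 v6
  have w0 : v.narr 0 = s.narr 0 := by rw [v1 0 (by omega), u1 0 (by omega)]
  have w1 : v.narr 1 = s.narr 1 := by rw [v1 1 (by omega), u1 1 (by omega)]
  have w2 : v.narr 2 = s.narr 2 := by rw [v1 2 (by omega), u1 2 (by omega)]
  have w7 : v.narr 7 = s.narr 7 := by rw [v1 7 (by omega), u1 7 (by omega)]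
  have w8 : v.narr 8 = s.narr 8 := by rw [v1 8 (by omega), u1 8 (by omega)]
  have wr : ∀ x, x < 3 ∨ (5 < x ∧ x < 17) → v.nreg x = s.nreg x := by
    intro x hx
    rw [v3 x (by omega), if_neg (by omega), u3 x (by omega), if_neg (by omega)]
  have r12 : v.nreg 12 = p := by rw [wr 12 (by omega), hp]
  have r13 : v.nreg 13 = q := by rw [wr 13 (by omega), hq]
  have r14 : v.nreg 14 = e := by rw [wr 14 (by omega), he]
  have r15 : v.nreg 15 = y := by rw [wr 15 (by omega), hy]
  have r16 : v.nreg 16 = l' := by rw [wr 16 (by omega), hl]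
  have rr : v.rreg = s.rreg := by rw [v2, u2]
  have ex : Function.update (Function.update (s.narr 1) p (s.narr 1 q)) q (s.narr 1 p) =
    exchange (s.narr 1) p q := rfl
  have hmark : v.narr 6 p ≠ 0 := v5 p u4
  repeat refine Det.cons (Det.atom ?_)
  apply Det.nil
  apply hQ
  · constructor
    · simp [Cmd.run, wr, hc.size]
    · simp [Cmd.run, wr, hc.levels]
    · simp [Cmd.run, w1, r12, r13, ex]
      exact hc.list.exchange hpn hqn
    · simp [Cmd.run, w1, w2, r12, r13, ex]
      have hx := exchange_next hc.list hc.next hpn hqn rfl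
      rwa [show exchange (s.narr 1) p q q = s.narr 1 p by simp [exchange],
        show exchange (s.narr 1) p q (q + 1) =
          Function.update (s.narr 1) p (s.narr 1 q) (q + 1) by simp [exchange]] at hx
    · intro i hi
      simp [Cmd.run, w7, r13, r16, Function.update_apply]
      split_ifs
      · exact hl'
      · exact hc.le i hi
    · intro l hl1 i hi
      simpa [Cmd.run, w7, w8, r13, r14, r15, r16] using hb l hl1 i hi
    · intro l hl1
      simp [Cmd.run, w8, r14, r15, Function.update_apply]
      split_ifs
      · exact hyn
      · exact hc.bdry_le l hl1
    · intro i
      simpa [Cmd.run, w0] using hc.out i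
  · refine ⟨a₂, hv.congr ?_ ?_ ?_ ?_ ?_ ?_ ?_ ?_ ?_⟩
    · simp [Cmd.run]
    · simp [Cmd.run]
    · simp [Cmd.run]
    -- The exchange affects only `p` and `q`, which are both marked, so agreement with the base
    -- order at unmarked positions survives.
    · intro i hi h6
      have h6 : v.narr 6 i = 0 := by simpa [Cmd.run] using h6
      simp [Cmd.run, r12, r13]
      rw [Function.update_of_ne (show i ≠ q from fun hh => v4 (hh ▸ h6)),
        Function.update_of_ne (show i ≠ p from fun hh => hmark (hh ▸ h6))]
    · simp [Cmd.run]
    · simp [Cmd.run]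
    · simp [Cmd.run]
    · simp [Cmd.run]
    · simp [Cmd.run]
  · simp [Cmd.run, w1, r12, r13, ex]
  · simp [Cmd.run, w7, r13, r16]
  · simp [Cmd.run, wr]
  · simp [Cmd.run, rr]
  · simp [Cmd.run]
    omega
  · simp [Cmd.run]
    omega

end Parts


/-! ### Progress of a single move -/

/-- The squared distance of the levels to the point `L` on `S`, `0` elsewhere. -/
noncomputable def dist2 (n L : ℕ) (S : Finset ℕ) (s : State) : ℝ :=
  ∑ i ∈ Finset.range n, ((s.narr 7 i : ℝ) - if s.narr 1 i ∈ S then (L : ℝ) else 0) ^ 2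

theorem dist2_nonneg (n L : ℕ) (S : Finset ℕ) (s : State) : 0 ≤ dist2 n L S s :=
  Finset.sum_nonneg fun _ _ => sq_nonneg _

theorem dist2_congr {n L : ℕ} {S : Finset ℕ} {s t : State} (h1 : t.narr 1 = s.narr 1)
    (h7 : t.narr 7 = s.narr 7) : dist2 n L S t = dist2 n L S s := by
  unfold dist2
  rw [h1, h7]

/-- The sign of the marginal value at the position `p`. -/
noncomputable def gsgn (G : Finset ℕ → ℝ) (f : ℕ → ℕ) (p : ℕ) : ℝ := if gr G f p < 0 then -1 else 1

theorem abs_mul_gsgn (G : Finset ℕ → ℝ) (f : ℕ → ℕ) (p : ℕ) :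
    |gr G f p| * gsgn G f p = gr G f p := by
  unfold gsgn
  split_ifs with h
  · rw [abs_of_neg h]; ring
  · rw [abs_of_nonneg (not_lt.mp h)]; ring

/-- The bound for the change of the squared distance by a move at the position `p`. -/
noncomputable def stepChange (G : Finset ℕ → ℝ) (L : ℕ) (S : Finset ℕ) (s : State) (p : ℕ) : ℝ :=
  1 - 2 * gsgn G (s.narr 1) p * ((s.narr 7 p : ℝ) - if s.narr 1 p ∈ S then (L : ℝ) else 0)

/-- Adding `stepChange` to the term of `p` in the distance gives the perfect square `(z - y - σ)²`.
Nonnegativity is needed since labels in `Ens` are nonnegative. -/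
theorem stepChange_add_nonneg (G : Finset ℕ → ℝ) {n : ℕ} (L : ℕ) (S : Finset ℕ) (s : State)
    {p : ℕ} (hp : p < n) : 0 ≤ dist2 n L S s + stepChange G L S s p := by
  have h1 : ((s.narr 7 p : ℝ) - if s.narr 1 p ∈ S then (L : ℝ) else 0) ^ 2 ≤ dist2 n L S s :=
    Finset.single_le_sum
      (f := fun i => ((s.narr 7 i : ℝ) - if s.narr 1 i ∈ S then (L : ℝ) else 0) ^ 2)
      (fun _ _ => sq_nonneg _) (Finset.mem_range.mpr hp)
  unfold stepChange
  have h2 : gsgn G (s.narr 1) p ^ 2 = 1 := by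
    unfold gsgn
    split_ifs <;> norm_num
  nlinarith [sq_nonneg (((s.narr 7 p : ℝ) - if s.narr 1 p ∈ S then (L : ℝ) else 0) -
    gsgn G (s.narr 1) p)]

/-- Reindexing by the transposition of `p` and `q`, which preserves `z` because `z p = z q`, leaves
only the contribution of the moved element `f p`. -/
theorem sum_exchange {n : ℕ} (φ : ℕ → ℕ → ℝ) (f z : ℕ → ℕ) {p q l' : ℕ} (hp : p < n) (hq : q < n)
    (hz : z p = z q) :
    ∑ i ∈ Finset.range n, φ (Function.update z q l' i) (exchange f p q i) =
      ∑ i ∈ Finset.range n, φ (z i) (f i) + (φ l' (f p) - φ (z p) (f p)) := by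
  have hid : IsList n fun i => i := ⟨fun _ h => h, fun _ _ _ _ h => h⟩
  have hτ := hid.exchange hp hq
  set τ := exchange (fun i => i) p q with hτd
  have hτa : ∀ i, τ i = if i = q then p else if i = p then q else i := fun i =>
    exchange_apply _ _ _ _
  have e1 : ∀ i, φ (Function.update z q l' i) (exchange f p q i) =
      (fun j => φ (z j) (f j) + if j = p then φ l' (f p) - φ (z p) (f p) else 0) (τ i) := by
    intro i
    simp only [exchange_apply, hτa, Function.update_apply]
    by_cases h1 : i = q
    · simp [h1]
    · by_cases h2 : i = p
      · have h3 : q ≠ p := fun e => h1 (h2.trans e.symm)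
        have h4 : p ≠ q := Ne.symm h3
        simp [h2, h3, h4, hz]
      · simp [h1, h2]
  rw [Finset.sum_congr rfl fun i _ => e1 i, ← Finset.sum_image (f := fun j => φ (z j) (f j) +
    if j = p then φ l' (f p) - φ (z p) (f p) else 0) hτ.injOn, hτ.image_range,
    Finset.sum_add_distrib, Finset.sum_ite_eq' (Finset.range n) p, if_pos (Finset.mem_range.mpr hp)]

section Parts

variable {n L : ℕ} {F : Finset (Fin n) → ℝ} {O : Oracle} {s : State} {f₀ a : ℕ → ℕ}
  {G : Finset ℕ → ℝ}

/-- An element moving up is first exchanged with the first entry of its level block, one moving down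
with the last entry. The levels then remain decreasing after the change, and a single block boundary
shifts by one. -/
theorem moveStep_det (hc : Core n L s) (h : Epoch G n f₀ a s) {p : ℕ} (hp : s.nreg 12 = p)
    (hpn : p < n) (h5 : s.rreg 5 = pv G (s.narr 1) p) (h6 : s.rreg 6 = pv G (s.narr 1) (p + 1))
    (S : Finset ℕ) {Q : State → Prop}
    (hQ : ∀ t : State, Core n L t → (∃ a', Epoch G n f₀ a' t) →
      dist2 n L S t ≤ dist2 n L S s + stepChange G L S s p →
      t.nreg 2 = s.nreg 2 → t.rreg 0 = s.rreg 0 → t.nreg 3 ≤ s.nreg 3 + 2 →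
      t.tau ≤ s.tau + 400 → Q t) :
    Det O moveStep s Q := by
  have hy0 : (0 : ℝ) ≤ (if s.narr 1 p ∈ S then (L : ℝ) else 0) := by split_ifs <;> positivity
  have hyL : (if s.narr 1 p ∈ S then (L : ℝ) else 0) ≤ L := by
    split_ifs
    · exact le_rfl
    · positivity
  have hzL := hc.le p hpn
  have hsgn : gr G (s.narr 1) p < 0 ↔ s.rreg 6 < s.rreg 5 := by
    rw [h5, h6]
    unfold gr
    exact sub_neg
  -- A move that would leave the range `0, …, L` is suppressed. This is the projection onto the
  -- cube; there `stepChange` is nonnegative, so the bound still holds.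
  have hskip : ∀ k k', k < 50 → k' < 50 → 0 ≤ stepChange G L S s p →
      Q (((s.tick k).tick k').tick 1) := by
    intro k k' hk hk' hs
    apply hQ
    · exact hc.congr rfl rfl rfl rfl rfl rfl rfl
    · exact ⟨a, h.congr rfl rfl rfl (fun _ _ _ => rfl) rfl rfl rfl rfl rfl⟩
    · have := dist2_congr (n := n) (L := L) (S := S) (s := s)
        (t := ((s.tick k).tick k').tick 1) rfl rfl
      linarith
    · rfl
    · rfl
    · exact Nat.le_add_right _ _
    · simp
      omega
  have hmove : ∀ t : State, ∀ q l' : ℕ, q < n → s.narr 7 p = s.narr 7 q →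
      ((l' : ℝ) - if s.narr 1 p ∈ S then (L : ℝ) else 0) ^ 2 -
        ((s.narr 7 p : ℝ) - if s.narr 1 p ∈ S then (L : ℝ) else 0) ^ 2 = stepChange G L S s p →
      t.narr 1 = exchange (s.narr 1) p q → t.narr 7 = Function.update (s.narr 7) q l' →
      dist2 n L S t ≤ dist2 n L S s + stepChange G L S s p := by
    intro t q l' hq hz hl t1 t7
    unfold dist2
    rw [t1, t7, sum_exchange (fun z v => ((z : ℝ) - if v ∈ S then (L : ℝ) else 0) ^ 2) _ _ hpn hq
      hz, hl]
  obtain ⟨l, hl⟩ : ∃ l, s.narr 7 p = l := ⟨_, rfl⟩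
  unfold moveStep
  refine Det.ite (fun hb => ?_) (fun hb => ?_)
  · have hs : gsgn G (s.narr 1) p = -1 := if_pos (hsgn.mpr (by simpa using hb))
    refine Det.ite (fun hb' => ?_) (fun hb' => Det.atom ?_)
    · have hlt : l < L := by simpa [hp, hl, hc.levels] using hb'
      have hq : s.narr 8 (l + 1) ≤ p := by
        by_contra hlt'
        have := (hc.bdry (l + 1) (by omega) p hpn).mp (by omega)
        omega
      have hzq : s.narr 7 (s.narr 8 (l + 1)) = l := by
        have h1 := hc.bdry (l + 1) (by omega) (s.narr 8 (l + 1)) (by omega)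
        have h2 : l ≤ s.narr 7 (s.narr 8 (l + 1)) := by
          rcases Nat.eq_zero_or_pos l with h0 | h0
          · omega
          · have h3 := hc.bdry l h0 p hpn
            have h4 := hc.bdry l h0 (s.narr 8 (l + 1)) (by omega)
            omega
        omega
      repeat refine Det.cons (Det.atom ?_)
      refine Det.cons (moveTo_det (G := G) (f₀ := f₀) (a := a) (n := n) (L := L) (p := p)
        (q := s.narr 8 (l + 1)) (e := l + 1) (y := s.narr 8 (l + 1) + 1) (l' := l + 1)
        (hc.congr ?_ ?_ ?_ ?_ ?_ ?_ ?_) (h.congr ?_ ?_ ?_ ?_ ?_ ?_ ?_ ?_ ?_)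
        ?_ ?_ ?_ ?_ ?_ hpn (by omega) (by omega) (by omega) ?_ ?_)
      any_goals (simp [Cmd.run, hp, hl]; done)
      · intro l₁ hl₁ i hi
        simp only [Cmd.run, State.tick_narr, State.setN_narr, Function.update_apply]
        have h1 := hc.bdry l₁ hl₁ i hi
        split_ifs with h2 h3 h3
        · omega
        · subst h2; omega
        · subst h3; omega
        · exact h1
      · intro t t1 t2 t3 t4 t5 t6 t7 t8
        simp [Cmd.run] at t3 t4 t5 t6 t7 t8
        refine Det.nil (hQ _ ?_ ?_ ?_ ?_ ?_ ?_ ?_)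
        · exact t1.congr rfl rfl rfl rfl rfl rfl rfl
        · obtain ⟨a', ha'⟩ := t2
          exact ⟨a', ha'.congr rfl rfl rfl (fun _ _ _ => rfl) rfl rfl rfl rfl rfl⟩
        · refine hmove _ (s.narr 8 (l + 1)) (l + 1) (by omega) (by omega) ?_ t3 t4
          unfold stepChange
          rw [hs, hl]
          push_cast
          ring
        · simpa using t5
        · simpa using t6
        · simpa using t7
        · simp
          omega
    · have hlt : l = L := by
        simp [hp, hl, hc.levels] at hb'
        omega
      refine hskip _ _ ?_ ?_ ?_
      · simp
      · simp
      unfold stepChange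
      rw [hs, hl, hlt]
      nlinarith
  · have hs : gsgn G (s.narr 1) p = 1 := if_neg fun h => hb (by simpa using hsgn.mp h)
    refine Det.ite (fun hb' => ?_) (fun hb' => Det.atom ?_)
    · have hlt : 0 < l := by simpa [hp, hl] using hb'
      have hq : p < s.narr 8 l := (hc.bdry l hlt p hpn).mpr (by omega)
      have hqn := hc.bdry_le l hlt
      have hzq : s.narr 7 (s.narr 8 l - 1) = l := by
        have h1 := hc.bdry l hlt (s.narr 8 l - 1) (by omega)
        have h2 := hc.bdry (l + 1) (by omega) (s.narr 8 l - 1) (by omega)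
        have h3 := hc.bdry (l + 1) (by omega) p hpn
        omega
      repeat refine Det.cons (Det.atom ?_)
      refine Det.cons (moveTo_det (G := G) (f₀ := f₀) (a := a) (n := n) (L := L) (p := p)
        (q := s.narr 8 l - 1) (e := l) (y := s.narr 8 l - 1) (l' := l - 1)
        (hc.congr ?_ ?_ ?_ ?_ ?_ ?_ ?_) (h.congr ?_ ?_ ?_ ?_ ?_ ?_ ?_ ?_ ?_)
        ?_ ?_ ?_ ?_ ?_ hpn (by omega) (by omega) (by omega) ?_ ?_)
      any_goals (simp [Cmd.run, hp, hl]; done)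
      · intro l₁ hl₁ i hi
        simp only [Cmd.run, State.tick_narr, State.setN_narr, Function.update_apply]
        have h1 := hc.bdry l₁ hl₁ i hi
        split_ifs with h2 h3 h3
        · omega
        · subst h2; omega
        · subst h3; omega
        · exact h1
      · intro t t1 t2 t3 t4 t5 t6 t7 t8
        simp [Cmd.run] at t3 t4 t5 t6 t7 t8
        refine Det.nil (hQ _ ?_ ?_ ?_ ?_ ?_ ?_ ?_)
        · exact t1.congr rfl rfl rfl rfl rfl rfl rfl
        · obtain ⟨a', ha'⟩ := t2
          exact ⟨a', ha'.congr rfl rfl rfl (fun _ _ _ => rfl) rfl rfl rfl rfl rfl⟩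
        · refine hmove _ (s.narr 8 l - 1) (l - 1) (by omega) (by omega) ?_ t3 t4
          unfold stepChange
          rw [hs, hl]
          push_cast [Nat.cast_sub (show 1 ≤ l from hlt)]
          ring
        · simpa using t5
        · simpa using t6
        · simpa using t7
        · simp
          omega
    · have hlt : l = 0 := by
        simp [hp, hl] at hb'
        omega
      refine hskip _ _ ?_ ?_ ?_
      · simp
      · simp
      unfold stepChange
      rw [hs, hl, hlt]
      push_cast
      nlinarith

theorem Agree.abs_gr_le_weight {f : ℕ → ℕ} {J : Finset ℕ} {tp : ℕ → ℕ} (h : Agree n f₀ f J)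
    (hG : SubNat G) {i : ℕ} (hi : ¬ (i < n ∧ i ∈ J)) :
    |gr G f (leafPos n tp i)| ≤ pot G n f₀ f J tp (i + 1) - pot G n f₀ f J tp i := by
  have hn' : (0 : ℝ) ≤ 1 / n := by positivity
  unfold leafPos
  split_ifs with hin
  · rw [pot_succ_of_lt hin]
    have := h.abs_gr_le hG hin (fun hJ => hi ⟨hin, hJ⟩)
    linarith
  · obtain ⟨k, rfl⟩ := Nat.exists_eq_add_of_le (not_lt.mp hin)
    rw [pot_succ_of_le, Nat.add_sub_cancel_left]
    linarith

/-- The acceptance probability lies in `[0, 1]`, because the weight dominates `|gr|` and `tot ≤ 16`.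
So the value is a convex combination of `V` and `V + δ`. -/
theorem Agree.leafVal_nonneg {f : ℕ → ℕ} {J : Finset ℕ} {tp : ℕ → ℕ} (h : Agree n f₀ f J)
    (hG : SubNat G) (hn : 0 < n) {i : ℕ} {tot V : ℝ} {δ : ℕ → ℝ} (htot : 0 ≤ tot)
    (htot' : tot ≤ 16) (hV : 0 ≤ V) (hδ : 0 ≤ V + δ (leafPos n tp i)) :
    0 ≤ leafVal G n f₀ f J tp tot V δ i := by
  have hw := sub_pos.mpr (h.pot_lt (tp := tp) hG hn i)
  unfold leafVal
  split_ifs with hif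
  · exact hV
  · have habs := h.abs_gr_le_weight (tp := tp) hG hif
    have h0 := abs_nonneg (gr G f (leafPos n tp i))
    set θ := |gr G f (leafPos n tp i)| * tot /
      ((pot G n f₀ f J tp (i + 1) - pot G n f₀ f J tp i) * 16) with hθ
    have hθ0 : 0 ≤ θ := by positivity
    have hθ1 : θ ≤ 1 := by
      rw [hθ, div_le_one (by positivity)]
      nlinarith
    nlinarith

theorem act_ens (hF : SubNat (liftNat F)) (hO : IsEvalOracle F O) (hc : Core n L s)
    (h : Epoch (liftNat F) n f₀ a s) (hn : 0 < n) {i : ℕ} (hi : s.nreg 6 = i)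
    (hin : i < n + s.nreg 3) {tot : ℝ} (h4 : s.rreg 4 = tot) (htot : 0 < tot) (htot' : tot ≤ 16)
    (hw : s.rreg 2 - s.rreg 1 = pot (liftNat F) n f₀ (s.narr 1) (touchedSet n s) (s.narr 5) (i + 1)
      - pot (liftNat F) n f₀ (s.narr 1) (touchedSet n s) (s.narr 5) i)
    (S : Finset ℕ) {A B : ℝ} (hA : 0 ≤ A) (hB : 0 ≤ B) {Ψ : State → ℝ → Prop}
    (hΨ : ∀ t x, Core n L t → (∃ a', Epoch (liftNat F) n f₀ a' t) → t.nreg 2 = s.nreg 2 →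
      t.rreg 0 = s.rreg 0 → t.nreg 3 ≤ s.nreg 3 + 2 → t.tau ≤ s.tau + 500 →
      A + B * dist2 n L S t ≤ x → Ψ t x) :
    Ens O act s Ψ (leafVal (liftNat F) n f₀ (s.narr 1) (touchedSet n s) (s.narr 5) tot
      (A + B * dist2 n L S s) (fun p => B * stepChange (liftNat F) L S s p) i) := by
  classical
  have hag := h.toAgree hc
  have hd := dist2_nonneg n L S s
  have hwpos := hag.pot_lt (tp := s.narr 5) hF hn i
  have hpn : leafPos n (s.narr 5) i < n := by
    unfold leafPos
    split_ifs with hlt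
    · exact hlt
    · exact h.tp_lt (by omega)
  have hV : 0 ≤ A + B * dist2 n L S s := by positivity
  have hV' : 0 ≤ A + B * (dist2 n L S s + stepChange (liftNat F) L S s (leafPos n (s.narr 5) i)) :=
    add_nonneg hA (mul_nonneg hB (stepChange_add_nonneg _ _ _ _ hpn))
  have hres := hag.leafVal_nonneg (tp := s.narr 5) (δ := fun p => B * stepChange (liftNat F) L S s p)
    hF hn (i := i) htot.le htot' hV (by linarith)
  have habs := hag.abs_gr_le_weight (tp := s.narr 5) hF (i := i)
  rw [leafVal] at hres ⊢
  set w := pot (liftNat F) n f₀ (s.narr 1) (touchedSet n s) (s.narr 5) (i + 1) -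
    pot (liftNat F) n f₀ (s.narr 1) (touchedSet n s) (s.narr 5) i with hwdef
  have hw0 : 0 < w := sub_pos.mpr hwpos
  obtain ⟨p, hp⟩ : ∃ p, leafPos n (s.narr 5) i = p := ⟨_, rfl⟩
  rw [hp] at hpn hV' habs hres ⊢
  set θ := |gr (liftNat F) (s.narr 1) p| * tot / (w * 16) with hθ
  have hθ0 : 0 ≤ θ := by positivity
  unfold act
  refine Ens.cons_det hres ?_
  -- The two ways of looking up the position differ only in their cost `k`, so the rest is treated
  -- once for both.
  have hcont : ∀ k, k < 30 → Ens O (Cmd.block [.ite (.and (.nlt (.var 6) (.var 0))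
      (.nlt (.const 0) (.get 6 (.var 6)))) .skip
      (.block [gradAt (.var 12),
        .flip 11 (.div (.mul (.var 7) (.var 4))
          (.mul (.sub (.var 2) (.var 1)) (.ofNat (.const 16)))),
        .ite (.nlt (.const 0) (.var 11)) moveStep .skip])]) (((s.tick 4).setN 12 p).tick k) Ψ
      (if i < n ∧ i ∈ touchedSet n s then A + B * dist2 n L S s else
      A + B * dist2 n L S s + θ * (B * stepChange (liftNat F) L S s p)) := by
    intro k hk
    refine Ens.cons (Ens.ite (fun hb => ?_) (fun hb => ?_))
    · have hif : i < n ∧ i ∈ touchedSet n s := by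
        simp [hi, hc.size] at hb
        exact ⟨hb.1, mem_touchedSet.mpr ⟨hb.1, by omega⟩⟩
      rw [if_pos hif]
      refine Ens.det (Det.atom (Ens.nil hV (hΨ _ _ ?_ ?_ ?_ ?_ ?_ ?_ ?_))) hV
      · exact hc.congr rfl rfl rfl rfl rfl rfl rfl
      · exact ⟨a, h.congr rfl rfl rfl (fun _ _ _ => rfl) rfl rfl rfl rfl rfl⟩
      · rfl
      · rfl
      · exact Nat.le_add_right _ _
      · simp [Cmd.run]
        omega
      · exact le_of_eq rfl
    · have hif : ¬ (i < n ∧ i ∈ touchedSet n s) := by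
        rintro ⟨h1, h2⟩
        apply hb
        have := (mem_touchedSet.mp h2).2
        simp [hi, hc.size, h1]
        omega
      rw [if_neg hif] at hres ⊢
      have hθ1 : θ ≤ 1 := by
        rw [hθ, div_le_one (by positivity)]
        have := habs hif
        nlinarith [abs_nonneg (gr (liftNat F) (s.narr 1) p)]
      refine Ens.cons_det hres (gradAt_det (p := p) (L := L)
        (hc.congr ?_ ?_ ?_ ?_ ?_ ?_ ?_) hO ?_ ?_ ?_ hpn ?_)
      any_goals (simp; done)
      intro u u1 u2 u3 u4 u5 u6 u7 u8
      simp at u1 u2 u5 u6 u7 u8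
      have u3' : ∀ x, u.nreg x = if x = 12 then p else s.nreg x := by
        intro x
        rw [u3]
        simp
      have u4' : ∀ x, x < 5 → u.rreg x = s.rreg x := u4
      refine Ens.cons (Ens.flip (p := θ)
        (r₁ := A + B * (dist2 n L S s + stepChange (liftNat F) L S s p))
        (r₀ := A + B * dist2 n L S s) ?_ hθ0 hθ1 hV hV' (fun _ => ?_) (fun _ => ?_) ?_)
      · simp [u4', u7, h4, hw, hθ]
      · refine Ens.cons (Ens.ite (fun hb => Ens.det (moveStep_det (n := n) (L := L)
          (G := liftNat F) (f₀ := f₀) (a := a) (p := p)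
          (hc.congr ?_ ?_ ?_ ?_ ?_ ?_ ?_) (h.congr ?_ ?_ ?_ ?_ ?_ ?_ ?_ ?_ ?_) ?_ hpn ?_ ?_ S ?_)
          hV') (fun hb => absurd ?_ hb))
        any_goals (simp [u1, u2, u3', u5, u6]; done)
        · rintro t t1 ⟨a', t2⟩ t3 t4 t5 t6 t7
          simp [u3', u4'] at t4 t5 t6 t7
          refine Ens.nil hV' (Ens.nil hV' (hΨ _ _ ?_ ?_ ?_ ?_ ?_ ?_ ?_))
          · exact t1.congr rfl rfl rfl rfl rfl rfl rfl
          · exact ⟨a', t2.congr rfl rfl rfl (fun _ _ _ => rfl) rfl rfl rfl rfl rfl⟩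
          · simpa using t4
          · simpa using t5
          · simpa using t6
          · simp
            omega
          · have e1 : stepChange (liftNat F) L S s p = stepChange (liftNat F) L S
                (((u.setN 11 1).tick (RExp.cost (.div (.mul (.var 7) (.var 4))
                  (.mul (.sub (.var 2) (.var 1)) (.ofNat (.const 16)))) + 1)).tick
                    (BExp.cost (.nlt (.const 0) (.var 11)) + 1)) p := by
              simp [stepChange, u1]
            have e2 : dist2 n L S ((t.tick 1).tick 1) = dist2 n L S t := rfl
            rw [← e1] at t3
            have e3 : dist2 n L S (((u.setN 11 1).tick (RExp.cost (.div (.mul (.var 7) (.var 4))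
                  (.mul (.sub (.var 2) (.var 1)) (.ofNat (.const 16)))) + 1)).tick
                    (BExp.cost (.nlt (.const 0) (.var 11)) + 1)) = dist2 n L S s :=
              dist2_congr (by simp [u1]) (by simp [u1])
            rw [e3] at t3
            rw [e2]
            gcongr
      · refine Ens.cons (Ens.ite (fun hb => absurd hb ?_) (fun hb => Ens.det (Det.atom
          (Ens.nil hV (Ens.nil hV (hΨ _ _ ?_ ?_ ?_ ?_ ?_ ?_ ?_)))) hV))
        · simp
        · exact hc.congr (by simp [Cmd.run, u3']) (by simp [Cmd.run, u3'])
            (by simp [Cmd.run, u1]) (by simp [Cmd.run, u1]) (by simp [Cmd.run, u1])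
            (by simp [Cmd.run, u1]) (by simp [Cmd.run, u1])
        · refine ⟨a, h.congr ?_ ?_ ?_ ?_ ?_ ?_ ?_ ?_ ?_⟩ <;> simp [Cmd.run, u1, u2, u3']
        · simp [Cmd.run, u3']
        · simp [Cmd.run, u4']
        · simp [Cmd.run, u3']
        · simp [Cmd.run]
          omega
        · rw [dist2_congr (s := s) (by simp [Cmd.run, u1]) (by simp [Cmd.run, u1])]
      · apply le_of_eq
        ring
  refine Det.ite (fun hb => Det.atom ?_) (fun hb => Det.atom ?_)
  · have hlt : i < n := by simpa [hi, hc.size] using hb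
    have := hcont 2 (by omega)
    rw [leafPos, if_pos hlt] at hp
    simpa [Cmd.run, hi, hp] using this
  · have hlt : ¬ i < n := by simpa [hi, hc.size] using hb
    have := hcont 5 (by omega)
    rw [leafPos, if_neg hlt] at hp
    simpa [Cmd.run, hi, hp, hc.size] using this

end Parts


/-- The two states differ in temporary registers and time only. -/
structure Frame (s t : State) : Prop where
  narr : t.narr = s.narr
  rarr : t.rarr = s.rarr
  nreg : ∀ x, x < 6 → t.nreg x = s.nreg x
  rreg : ∀ x, x = 0 ∨ x = 4 → t.rreg x = s.rreg x

/-! ### Random bisection and one stochastic step -/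

section Parts

variable {n L : ℕ} {F : Finset (Fin n) → ℝ} {O : Oracle} {s : State} {f₀ a : ℕ → ℕ}
  {G : Finset ℕ → ℝ}

theorem Core.frame {t : State} (h : Core n L s) (hf : Frame s t) : Core n L t := by
  apply h.congr <;> simp [hf.narr, hf.nreg]

theorem Epoch.frame {t : State} (h : Epoch G n f₀ a s) (hf : Frame s t) : Epoch G n f₀ a t := by
  apply h.congr <;> simp [hf.narr, hf.nreg, hf.rarr]

/-- The label of an interval is the weighted mean of the leaf values in it. A coin biased by the
weights of the two halves makes these means a martingale, so no path probabilities are computed. The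
exponent `d` bounds the depth and thereby the time. -/
theorem bisect_ens (hF : SubNat (liftNat F)) (hO : IsEvalOracle F O) (hc : Core n L s)
    (h : Epoch (liftNat F) n f₀ a s) (hn : 0 < n)
    (hB : ∀ k, k ≤ s.nreg 3 → s.rarr 1 k =
        ∑ j ∈ Finset.range k, |gr (liftNat F) (s.narr 1) (s.narr 5 j)|)
    {Θ : ℕ → ℝ} (hΘ : Θ = pot (liftNat F) n f₀ (s.narr 1) (touchedSet n s) (s.narr 5))
    {ψ : ℕ → ℝ} (hψ : ∀ i, i < n + s.nreg 3 → 0 ≤ ψ i) {Ψ : State → ℝ → Prop} {T : ℕ}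
    (hleaf : ∀ i u, i < n + s.nreg 3 → Frame s u → u.nreg 6 = i → u.rreg 1 = Θ i →
      u.rreg 2 = Θ (i + 1) → u.tau ≤ T → Ψ u (ψ i)) :
    ∀ (d lo hi : ℕ) (t : State), Frame s t → t.nreg 6 = lo → t.nreg 7 = hi → t.rreg 1 = Θ lo →
      t.rreg 2 = Θ hi → lo < hi → hi ≤ n + s.nreg 3 → hi - lo ≤ 2 ^ d →
      t.tau + 200 * (s.nreg 3 + 1) * d + 20 ≤ T →
      Ens O bisect t Ψ
        ((∑ i ∈ Finset.Ico lo hi, (Θ (i + 1) - Θ i) * ψ i) / (Θ hi - Θ lo)) := by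
  have hmono : StrictMono Θ := by
    rw [hΘ]
    exact strictMono_nat_of_lt_succ fun i => (h.toAgree hc).pot_lt hF hn i
  have hsum : ∀ lo hi, hi ≤ n + s.nreg 3 →
      0 ≤ ∑ i ∈ Finset.Ico lo hi, (Θ (i + 1) - Θ i) * ψ i := by
    intro lo hi hhi
    refine Finset.sum_nonneg fun i hi' => ?_
    rw [Finset.mem_Ico] at hi'
    exact mul_nonneg (sub_pos.mpr (hmono (Nat.lt_succ_self i))).le (hψ i (by omega))
  intro d
  induction d with
  | zero =>
    intro lo hi t hf h6 h7 h1 h2 hlt hhi hd hT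
    obtain rfl : hi = lo + 1 := by simp at hd; omega
    have hpos := sub_pos.mpr (hmono (Nat.lt_succ_self lo))
    have e : (∑ i ∈ Finset.Ico lo (lo + 1), (Θ (i + 1) - Θ i) * ψ i) / (Θ (lo + 1) - Θ lo) =
        ψ lo := by
      rw [Nat.Ico_succ_singleton, Finset.sum_singleton]
      exact mul_div_cancel_left₀ _ hpos.ne'
    rw [e]
    refine Ens.loop_false (by simp [h6, h7]) (hψ lo (by omega)) ?_
    refine hleaf lo _ (by omega) ?_ (by simp [h6]) (by simp [h1]) (by simp [h2]) (by simp; omega)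
    exact ⟨hf.narr, hf.rarr, hf.nreg, hf.rreg⟩
  | succ d ih =>
    intro lo hi t hf h6 h7 h1 h2 hlt hhi hd hT
    by_cases hlt' : lo + 1 < hi
    · have hmid1 : lo < (lo + hi) / 2 := by omega
      have hmid2 : (lo + hi) / 2 < hi := by omega
      have hp1 := sub_pos.mpr (hmono hmid1)
      have hp2 := sub_pos.mpr (hmono hmid2)
      have hp3 := sub_pos.mpr (hmono hlt)
      have hpow : 2 ^ (d + 1) = 2 * 2 ^ d := by ring
      have hTd : 200 * (s.nreg 3 + 1) * (d + 1) =
        200 * (s.nreg 3 + 1) * d + 200 * (s.nreg 3 + 1) := by ring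
      obtain ⟨mid, hmid⟩ : ∃ mid, (lo + hi) / 2 = mid := ⟨_, rfl⟩
      rw [hmid] at hmid1 hmid2 hp1 hp2
      have hR : 0 ≤ (∑ i ∈ Finset.Ico lo hi, (Θ (i + 1) - Θ i) * ψ i) / (Θ hi - Θ lo) :=
        div_nonneg (hsum lo hi hhi) hp3.le
      unfold bisect
      refine Ens.loop_true (by simp [h6, h7, hlt']) ?_
      refine Ens.cons_det hR (Det.atom ?_)
      refine Ens.cons_det hR (evalPot_det (n := n) (L := L) (F := F) (f₀ := f₀) (a := a)
        (hc.congr ?_ ?_ ?_ ?_ ?_ ?_ ?_) (h.congr ?_ ?_ ?_ ?_ ?_ ?_ ?_ ?_ ?_) hO hn ?_ ?_ ?_)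
      any_goals (simp [Cmd.run, hf.narr, hf.nreg, hf.rarr]; done)
      · simp [Cmd.run, h6, h7, hf.nreg, hmid]
        omega
      · simpa [Cmd.run, hf.narr, hf.nreg, hf.rarr] using hB
      intro u u1 u2 u3 u4 u5 u6
      have u5' : u.rreg 3 = Θ mid := by
        rw [u5, hΘ]
        rw [touchedSet_congr (s := s) (by simp [Cmd.run, hf.narr])]
        simp [Cmd.run, hf.narr, h6, h7, hmid]
      have u8 : u.nreg 8 = mid := by rw [u3 8 (by omega)]; simp [Cmd.run, h6, h7, hmid]
      have v6 : u.nreg 6 = lo := by rw [u3 6 (by omega)]; simp [Cmd.run, h6]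
      have v7 : u.nreg 7 = hi := by rw [u3 7 (by omega)]; simp [Cmd.run, h7]
      have w1 : u.rreg 1 = Θ lo := by rw [u4 1 (by omega)]; simp [Cmd.run, h1]
      have w2 : u.rreg 2 = Θ hi := by rw [u4 2 (by omega)]; simp [Cmd.run, h2]
      have hfu : ∀ v : State, v.narr = u.narr → v.rarr = u.rarr →
          (∀ x, x < 6 → v.nreg x = u.nreg x) → (∀ x, x = 0 ∨ x = 4 → v.rreg x = u.rreg x) →
          Frame s v := by
        intro v b1 b2 b3 b4
        refine ⟨?_, ?_, ?_, ?_⟩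
        · rw [b1, u1]; simp [Cmd.run, hf.narr]
        · rw [b2, u2]; simp [Cmd.run, hf.rarr]
        · intro x hx
          have : x ≠ 8 := by omega
          rw [b3 x hx, u3 x (by omega)]
          simp [Cmd.run, hf.nreg x hx, this]
        · intro x hx
          rw [b4 x hx, u4 x (by omega)]
          simp [Cmd.run, hf.rreg x hx]
      have u6' : u.tau ≤ t.tau + 20 + 100 * (s.nreg 3 + 1) := by
        refine u6.trans ?_
        simp [Cmd.run, hf.nreg]
      refine Ens.cons (Ens.flip (p := (Θ hi - Θ mid) / (Θ hi - Θ lo))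
        (r₁ := (∑ i ∈ Finset.Ico mid hi, (Θ (i + 1) - Θ i) * ψ i) / (Θ hi - Θ mid))
        (r₀ := (∑ i ∈ Finset.Ico lo mid, (Θ (i + 1) - Θ i) * ψ i) / (Θ mid - Θ lo))
        ?_ ?_ ?_ ?_ ?_ (fun _ => ?_) (fun _ => ?_) ?_)
      · simp [u5', w1, w2]
      · positivity
      · rw [div_le_one hp3]
        linarith
      · exact div_nonneg (hsum _ _ (by omega)) hp1.le
      · exact div_nonneg (hsum _ _ (by omega)) hp2.le
      · have hr := div_nonneg (hsum mid hi (by omega)) hp2.le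
        refine Ens.cons (Ens.ite (fun _ => ?_) (fun hb => absurd ?_ hb))
        · refine Ens.cons_det hr (Det.atom (Ens.cons_det hr (Det.atom (Ens.nil hr
            (Ens.nil hr (ih mid hi _ (hfu _ ?_ ?_ ?_ ?_) ?_ ?_ ?_ ?_ hmid2 hhi ?_ ?_))))))
          any_goals (simp [Cmd.run, u8, v7, u5', w2]; done)
          · intro x hx
            have h11 : x ≠ 11 := by omega
            have h6 : x ≠ 6 := by omega
            simp [Cmd.run, h11, h6]
          · omega
          · rw [hTd] at hT
            simp [Cmd.run]
            omega
        · simp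
      · have hr := div_nonneg (hsum lo mid (by omega)) hp1.le
        refine Ens.cons (Ens.ite (fun hb => absurd hb ?_) (fun _ => ?_))
        · simp
        · refine Ens.cons_det hr (Det.atom (Ens.cons_det hr (Det.atom (Ens.nil hr
            (Ens.nil hr (ih lo mid _ (hfu _ ?_ ?_ ?_ ?_) ?_ ?_ ?_ ?_ hmid1 (by omega) ?_ ?_))))))
          any_goals (simp [Cmd.run, u8, v6, u5', w1]; done)
          · intro x hx
            have h11 : x ≠ 11 := by omega
            have h7 : x ≠ 7 := by omega
            simp [Cmd.run, h11, h7]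
          · omega
          · rw [hTd] at hT
            simp [Cmd.run]
            omega
      · apply le_of_eq
        rw [← Finset.sum_Ico_consecutive _ hmid1.le hmid2.le]
        have e : 1 - (Θ hi - Θ mid) / (Θ hi - Θ lo) = (Θ mid - Θ lo) / (Θ hi - Θ lo) := by
          rw [eq_div_iff hp3.ne', sub_mul, div_mul_cancel₀ _ hp3.ne']
          ring
        rw [e]
        field_simp
        ring
    · have : hi = lo + 1 := by omega
      refine ih lo hi t hf h6 h7 h1 h2 hlt hhi ?_ ?_
      · have : 1 ≤ 2 ^ d := Nat.one_le_two_pow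
        omega
      · refine le_trans ?_ hT
        gcongr
        omega

/-- Each `stepChange` is at least `-dist2`, and the moving probabilities add up to at most `1 / 4`.
-/
theorem add_sum_stepChange_nonneg (hF : SubNat (liftNat F)) (hb : ∀ A, |liftNat F A| ≤ 1)
    (hc : Core n L s) (S : Finset ℕ) :
    0 ≤ dist2 n L S s + (∑ p ∈ Finset.range n,
      |gr (liftNat F) (s.narr 1) p| * stepChange (liftNat F) L S s p) / 16 := by
  have h1 : ∑ p ∈ Finset.range n, |gr (liftNat F) (s.narr 1) p| * (-dist2 n L S s) ≤
      ∑ p ∈ Finset.range n, |gr (liftNat F) (s.narr 1) p| * stepChange (liftNat F) L S s p := by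
    refine Finset.sum_le_sum fun p hp => mul_le_mul_of_nonneg_left ?_ (abs_nonneg _)
    linarith [stepChange_add_nonneg (liftNat F) L S s (Finset.mem_range.mp hp)]
  rw [← Finset.sum_mul] at h1
  nlinarith [sum_abs_gr_le hF hb hc.list, dist2_nonneg n L S s]

theorem bisect_act_ens (hF : SubNat (liftNat F)) (hb : ∀ A, |liftNat F A| ≤ 1)
    (hO : IsEvalOracle F O) (hc : Core n L s)
    (h : Epoch (liftNat F) n f₀ a s) (hn : 0 < n) {d : ℕ} (hd : n + s.nreg 3 ≤ 2 ^ d)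
    (hB : ∀ k, k ≤ s.nreg 3 → s.rarr 1 k =
        ∑ j ∈ Finset.range k, |gr (liftNat F) (s.narr 1) (s.narr 5 j)|)
    {Θ : ℕ → ℝ} (hΘ : Θ = pot (liftNat F) n f₀ (s.narr 1) (touchedSet n s) (s.narr 5))
    (h6 : s.nreg 6 = 0) (h7 : s.nreg 7 = n + s.nreg 3) (h1 : s.rreg 1 = Θ 0)
    (h2 : s.rreg 2 = Θ (n + s.nreg 3)) (h4 : s.rreg 4 = Θ (n + s.nreg 3) - Θ 0)
    (S : Finset ℕ) {A B : ℝ} (hA : 0 ≤ A) (hB' : 0 ≤ B) {Ψ : State → ℝ → Prop}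
    (hΨ : ∀ t x, Core n L t → (∃ a', Epoch (liftNat F) n f₀ a' t) → t.nreg 2 = s.nreg 2 →
      t.rreg 0 = s.rreg 0 → t.nreg 3 ≤ s.nreg 3 + 2 →
      t.tau ≤ s.tau + 200 * (s.nreg 3 + 1) * d + 600 → A + B * dist2 n L S t ≤ x → Ψ t x) :
    Ens O (Cmd.block [bisect, act]) s Ψ (A + B * (dist2 n L S s + (∑ p ∈ Finset.range n,
      |gr (liftNat F) (s.narr 1) p| * stepChange (liftNat F) L S s p) / 16)) := by
  have hag := h.toAgree hc
  have hs := h.count_le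
  have hmono : StrictMono Θ := by
    rw [hΘ]
    exact strictMono_nat_of_lt_succ fun i => hag.pot_lt hF hn i
  obtain ⟨tot, htot⟩ : ∃ tot, Θ (n + s.nreg 3) - Θ 0 = tot := ⟨_, rfl⟩
  have htot0 : 0 < tot := htot ▸ sub_pos.mpr (hmono (by omega))
  have htot16 : tot ≤ 16 := by
    rw [← htot, hΘ]
    exact hag.pot_total_le hF hb hn h.tp h.tp_inj
  have hV : 0 ≤ A + B * dist2 n L S s := add_nonneg hA (mul_nonneg hB' (dist2_nonneg _ _ _ _))
  obtain ⟨ψ, hψ⟩ : ∃ ψ, ψ = leafVal (liftNat F) n f₀ (s.narr 1) (touchedSet n s) (s.narr 5) tot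
      (A + B * dist2 n L S s) (fun p => B * stepChange (liftNat F) L S s p) := ⟨_, rfl⟩
  have hψ0 : ∀ i, i < n + s.nreg 3 → 0 ≤ ψ i := by
    intro i hi
    rw [hψ]
    refine hag.leafVal_nonneg hF hn htot0.le htot16 hV ?_
    have hpn : leafPos n (s.narr 5) i < n := by
      unfold leafPos
      split_ifs with hlt
      · exact hlt
      · exact h.tp_lt (by omega)
    have := add_nonneg hA (mul_nonneg hB' (stepChange_add_nonneg (liftNat F) L S s hpn))
    linarith
  have hval : (∑ i ∈ Finset.Ico 0 (n + s.nreg 3), (Θ (i + 1) - Θ i) * ψ i) /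
      (Θ (n + s.nreg 3) - Θ 0) = A + B * (dist2 n L S s + (∑ p ∈ Finset.range n,
        |gr (liftNat F) (s.narr 1) p| * stepChange (liftNat F) L S s p) / 16) := by
    rw [htot, Nat.Ico_zero_eq_range, hψ, hΘ, hag.sum_leafVal hF hn h.tp h.tp_inj tot _
      (by rw [← hΘ, htot]), mul_div_cancel_left₀ _ htot0.ne']
    simp only [mul_left_comm _ B, ← Finset.mul_sum]
    ring
  rw [← hval]
  refine Ens.cons (bisect_ens (T := s.tau + 200 * (s.nreg 3 + 1) * d + 20) hF hO hc h hn hB hΘ hψ0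
    (fun i u hi hf u6 u1 u2 ut => ?_) d 0 (n + s.nreg 3) s ⟨rfl, rfl, fun _ _ => rfl, fun _ _ => rfl⟩
    h6 h7 h1 h2 (by omega) le_rfl (by omega) le_rfl)
  have hts : touchedSet n u = touchedSet n s := touchedSet_congr (by rw [hf.narr])
  have hact := act_ens (Ψ := fun t x => Ens O (Cmd.block []) t Ψ x) hF hO (hc.frame hf)
    (h.frame hf) hn u6 (by rw [hf.nreg 3 (by omega)]; exact hi)
    (((hf.rreg 4 (by omega)).trans h4).trans htot) htot0 htot16
    (by rw [u1, u2, hts, hf.narr, hΘ]) S hA hB' ?_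
  · have e : leafVal (liftNat F) n f₀ (u.narr 1) (touchedSet n u) (u.narr 5) tot
        (A + B * dist2 n L S u) (fun p => B * stepChange (liftNat F) L S u p) i = ψ i := by
      unfold stepChange
      rw [hts, dist2_congr (s := s) (by rw [hf.narr]) (by rw [hf.narr]), hf.narr, hψ]
      rfl
    rw [e] at hact
    exact Ens.cons hact
  · intro t x c1 c2 c3 c4 c5 c6 c7
    rw [hf.nreg 2 (by omega)] at c3
    rw [hf.rreg 0 (by omega)] at c4
    rw [hf.nreg 3 (by omega)] at c5
    have hx : 0 ≤ x := (add_nonneg hA (mul_nonneg hB' (dist2_nonneg n L S t))).trans c7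
    refine Ens.nil hx (hΨ _ _ ?_ ?_ c3 c4 c5 ?_ c7)
    · exact c1.congr rfl rfl rfl rfl rfl rfl rfl
    · obtain ⟨a', c2⟩ := c2
      exact ⟨a', c2.congr rfl rfl rfl (fun _ _ _ => rfl) rfl rfl rfl rfl rfl⟩
    · simp
      omega

theorem stochStep_ens (hF : SubNat (liftNat F)) (hb : ∀ A, |liftNat F A| ≤ 1)
    (hO : IsEvalOracle F O) (hc : Core n L s)
    (h : Epoch (liftNat F) n f₀ a s) (hn : 0 < n) {d : ℕ} (hd : n + s.nreg 3 ≤ 2 ^ d)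
    (S : Finset ℕ) {A B : ℝ} (hA : 0 ≤ A) (hB : 0 ≤ B) {Ψ : State → ℝ → Prop}
    (hΨ : ∀ t x, Core n L t → (∃ a', Epoch (liftNat F) n f₀ a' t) → t.nreg 2 = s.nreg 2 →
      t.rreg 0 = s.rreg 0 → t.nreg 3 ≤ s.nreg 3 + 2 →
      t.tau ≤ s.tau + 1500 * (s.nreg 3 + 1) * (d + 1) → A + B * dist2 n L S t ≤ x → Ψ t x) :
    Ens O stochStep s Ψ (A + B * (dist2 n L S s + (∑ p ∈ Finset.range n,
      |gr (liftNat F) (s.narr 1) p| * stepChange (liftNat F) L S s p) / 16)) := by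
  have hr := add_nonneg hA (mul_nonneg hB (add_sum_stepChange_nonneg hF hb hc S))
  obtain ⟨Θ, hΘ⟩ : ∃ Θ, Θ = pot (liftNat F) n f₀ (s.narr 1) (touchedSet n s) (s.narr 5) := ⟨_, rfl⟩
  unfold stochStep
  refine Ens.cons_det hr (sumTouched_det hc hO (fun k hk => h.tp_lt hk) ?_)
  intro t t1 t2 t3 t4 t5 t6
  refine Ens.cons_det hr (Det.atom ?_)
  refine Ens.cons_det hr (evalPot_det (n := n) (L := L) (F := F) (f₀ := f₀) (a := a)
    (hc.congr ?_ ?_ ?_ ?_ ?_ ?_ ?_) (h.congr ?_ ?_ ?_ ?_ ?_ ?_ ?_ ?_ ?_) hO hn ?_ ?_ ?_)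
  any_goals (simp [Cmd.run, t1, t2, t3]; done)
  · simpa [Cmd.run, t1, t3] using t5
  intro u u1 u2 u3 u4 u5 u6
  simp [Cmd.run, t1, t3] at u1 u2 u5 u6
  have e5 : u.rreg 3 = Θ 0 := by
    rw [u5, hΘ, touchedSet_congr (s := s) (by simp [t1])]
  refine Ens.cons_det hr (Det.atom ?_)
  refine Ens.cons_det hr (Det.atom ?_)
  refine Ens.cons_det hr (evalPot_det (n := n) (L := L) (F := F) (f₀ := f₀) (a := a)
    (hc.congr ?_ ?_ ?_ ?_ ?_ ?_ ?_) (h.congr ?_ ?_ ?_ ?_ ?_ ?_ ?_ ?_ ?_) hO hn ?_ ?_ ?_)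
  any_goals (simp [Cmd.run, u1, u2, u3, t2, t3, hc.size]; done)
  · simpa [Cmd.run, u1, u2, u3, t1, t3] using t5
  intro v v1 v2 v3 v4 v5 v6
  simp [Cmd.run, u1, u2, u3, t3, hc.size] at v1 v2 v5 v6
  have f5 : v.rreg 3 = Θ (n + s.nreg 3) := by
    rw [v5, hΘ, touchedSet_congr (s := s) (by simp [u1])]
  have w1 : v.rreg 1 = Θ 0 := by rw [v4 1 (by omega)]; simp [Cmd.run, e5]
  have w0 : v.rreg 0 = s.rreg 0 := by
    rw [v4 0 (by omega)]; simp [Cmd.run, u4, t4]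
  have wn : ∀ x, x < 6 → v.nreg x = s.nreg x := by
    intro x hx
    have h8 : x ≠ 8 := by omega
    have h10 : x ≠ 10 := by omega
    rw [v3 x (by omega)]
    simp [Cmd.run, h8]
    rw [u3 x (by omega)]
    simp [Cmd.run, h8, t3 x h10]
  refine Ens.cons_det hr (Det.atom ?_)
  refine Ens.cons_det hr (Det.atom ?_)
  refine Ens.cons_det hr (Det.atom ?_)
  refine Ens.cons_det hr (Det.atom ?_)
  have key : ∀ b : State, b.narr = s.narr → b.rarr = v.rarr → (∀ x, x < 6 → b.nreg x = s.nreg x) →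
      b.nreg 6 = 0 → b.nreg 7 = n + s.nreg 3 → b.rreg 0 = s.rreg 0 → b.rreg 1 = Θ 0 →
      b.rreg 2 = Θ (n + s.nreg 3) → b.rreg 4 = Θ (n + s.nreg 3) - Θ 0 → b.tau ≤ v.tau + 20 →
      Ens O (Cmd.block [bisect, act]) b Ψ (A + B * (dist2 n L S s + (∑ p ∈ Finset.range n,
        |gr (liftNat F) (s.narr 1) p| * stepChange (liftNat F) L S s p) / 16)) := by
    intro b b1 b2 b3 b6 b7 c0 c1 c2 c4 bt
    have hs3 := b3 3 (by omega)
    have hx := bisect_act_ens (s := b) (d := d) (Θ := Θ) (Ψ := Ψ) hF hb hO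
      (hc.congr (b3 0 (by omega)) (b3 1 (by omega)) ?_ ?_ ?_ ?_ ?_)
      (h.congr hs3 (b3 4 (by omega)) (b3 5 (by omega)) ?_ ?_ ?_ ?_ ?_ ?_) hn (by rwa [hs3]) ?_ ?_
      b6 (by rwa [hs3]) c1 (by rwa [hs3]) (by rwa [hs3]) S hA hB ?_
    · rw [dist2_congr (s := s) (by rw [b1]) (by rw [b1])] at hx
      unfold stepChange at hx ⊢
      rwa [b1] at hx
    any_goals (simp [b1]; done)
    · rw [b2, v2, t2]
    · rw [hs3, b1, b2, v2]
      exact t5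
    · rw [hΘ, b1, touchedSet_congr (s := s) (t := b) (by rw [b1])]
    · intro t x d1 d2 d3 d4 d5 d6 d7
      refine hΨ t x d1 d2 (d3.trans (b3 2 (by omega))) (d4.trans c0) (hs3 ▸ d5) ?_ d7
      rw [hs3, mul_assoc] at d6
      have : 1500 * (s.nreg 3 + 1) * (d + 1) = 1500 * ((s.nreg 3 + 1) * d) + 1500 * (s.nreg 3 + 1) := by
        ring
      rw [this]
      have hy := Nat.zero_le ((s.nreg 3 + 1) * d)
      have hz := Nat.zero_le (s.nreg 3)
      clear * - t6 u6 v6 bt d6 hy hz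
      linarith
  apply key
  any_goals (simp [Cmd.run, v1, v2, wn, hc.size, w0, w1, f5]; done)
  · intro x hx
    have h6 : x ≠ 6 := by omega
    have h7 : x ≠ 7 := by omega
    simp [Cmd.run, wn x hx, h6, h7]

end Parts


/-! ### Amortised cost of a round and the main loop -/

section Parts

variable {n L : ℕ} {F : Finset (Fin n) → ℝ} {O : Oracle} {s : State}

theorem Core.level_antitone (hc : Core n L s) {i j : ℕ} (hij : i ≤ j) (hj : j < n) :
    s.narr 7 j ≤ s.narr 7 i := by
  rcases Nat.eq_zero_or_pos (s.narr 7 j) with h | h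
  · omega
  · have := (hc.bdry _ h j hj).mpr le_rfl
    exact (hc.bdry _ h i (by omega)).mp (by omega)

theorem exists_pv_min (G : Finset ℕ → ℝ) (f : ℕ → ℕ) (n : ℕ) :
    ∃ i ≤ n, ∀ j ≤ n, pv G f i ≤ pv G f j := by
  obtain ⟨i, hi, h⟩ := Finset.exists_min_image (Finset.range (n + 1)) (pv G f) ⟨0, by simp⟩
  exact ⟨i, by simpa [Nat.lt_succ_iff] using hi,
    fun j hj => h j (by simpa [Nat.lt_succ_iff] using hj)⟩

theorem sum_stepChange_le (hF : SubNat (liftNat F)) (hb : ∀ A, |liftNat F A| ≤ 1)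
    (hc : Core n L s) {S : Finset ℕ} (hS : S ⊆ Finset.range n) {m : ℝ}
    (hm : ∀ i ≤ n, m ≤ pv (liftNat F) (s.narr 1) i) :
    ∑ p ∈ Finset.range n, |gr (liftNat F) (s.narr 1) p| * stepChange (liftNat F) L S s p ≤
      4 - 2 * L * (m - liftNat F S) :=
  descent_le (z := fun i => (s.narr 7 i : ℝ)) hF hb hc.list (Nat.cast_nonneg L) hm
    (fun i j hij hj => by exact_mod_cast hc.level_antitone hij hj)
    (fun i hi => ⟨Nat.cast_nonneg _, by exact_mod_cast hc.le i hi⟩) hS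
    (fun i => abs_mul_gsgn _ _ _)

/-- Amortisation with the credit `400 (q + 1)` per touched position, where `q + 1` exceeds `√n`. A
step adds at most two touched positions; a rebuild resets their number to zero and is paid by the
released credit. -/
theorem round_ens (hF : SubNat (liftNat F)) (hb : ∀ A, |liftNat F A| ≤ 1)
    (hO : IsEvalOracle F O) (hn : 0 < n) {d q : ℕ} (hd : 2 * n ≤ 2 ^ d)
    (hq : n < (q + 1) * (q + 1)) (S : Finset ℕ) (hc : Core n L s)
    (he : s.nreg 3 * s.nreg 3 < n → ∃ f₀ a, Epoch (liftNat F) n f₀ a s)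
    {A B : ℝ} (hA : 0 ≤ A) (hB : 0 ≤ B) {Ψ : State → ℝ → Prop}
    (hΨ : ∀ t x, Core n L t → (∃ f₀ a, Epoch (liftNat F) n f₀ a t) → t.nreg 2 = s.nreg 2 →
      t.tau + 400 * ((q + 1) * t.nreg 3) + 100 ≤
        s.tau + 400 * ((q + 1) * s.nreg 3) + 3000 * ((q + 1) * (d + 1)) →
      A + B * dist2 n L S t ≤ x → Ψ t x) :
    Ens O (.block [.ite (.rlt (.mul (.ofNat (.var 3)) (.ofNat (.var 3))) (.ofNat (.var 0)))
      .skip rebuild, stochStep]) s Ψ (A + B * (dist2 n L S s + (∑ p ∈ Finset.range n,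
        |gr (liftNat F) (s.narr 1) p| * stepChange (liftNat F) L S s p) / 16)) := by
  have hr := add_nonneg hA (mul_nonneg hB (add_sum_stepChange_nonneg hF hb hc S))
  have key : ∀ t : State, Core n L t → (∃ f₀ a, Epoch (liftNat F) n f₀ a t) →
      t.nreg 2 = s.nreg 2 → t.narr 1 = s.narr 1 → t.narr 7 = s.narr 7 →
      t.tau + 400 * ((q + 1) * t.nreg 3) + 1500 * (t.nreg 3 + 1) * (d + 1) + 1000 * (q + 1) ≤
        s.tau + 400 * ((q + 1) * s.nreg 3) + 3000 * ((q + 1) * (d + 1)) →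
      Ens O (.block [stochStep]) t Ψ (A + B * (dist2 n L S s + (∑ p ∈ Finset.range n,
        |gr (liftNat F) (s.narr 1) p| * stepChange (liftNat F) L S s p) / 16)) := by
    rintro t hct ⟨f₀, a, h⟩ t2 t1 t7 ht
    have hx := stochStep_ens (Ψ := fun t x => Ens O (Cmd.block []) t Ψ x) hF hb hO hct h hn
      (d := d) (by have := h.count_le; omega) S hA hB ?_
    · rw [dist2_congr t1 t7] at hx
      unfold stepChange at hx ⊢
      rw [t1, t7] at hx
      exact Ens.cons hx
    · rintro u x u1 ⟨a', u2⟩ u3 - u5 u6 u7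
      have hx : 0 ≤ x := (add_nonneg hA (mul_nonneg hB (dist2_nonneg n L S u))).trans u7
      refine Ens.nil hx (hΨ _ _ ?_ ⟨f₀, a', ?_⟩ (u3.trans t2) ?_ u7)
      · exact u1.congr rfl rfl rfl rfl rfl rfl rfl
      · exact u2.congr rfl rfl rfl (fun _ _ _ => rfl) rfl rfl rfl rfl rfl
      · have : (q + 1) * u.nreg 3 ≤ (q + 1) * (t.nreg 3 + 2) := Nat.mul_le_mul_left _ u5
        simp only [State.tick_tau, State.tick_nreg]
        linarith
  have hqd : q + 1 ≤ (q + 1) * (d + 1) := Nat.le_mul_of_pos_right _ (by omega)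
  refine Ens.cons_det hr (Det.ite (fun hlt => Det.atom ?_) (fun hlt => ?_))
  · have hlt' : s.nreg 3 * s.nreg 3 < n := by
      simp [hc.size] at hlt
      exact_mod_cast hlt
    have hsq : s.nreg 3 + 1 ≤ q + 1 := by
      by_contra hcon
      have : (q + 1) * (q + 1) ≤ s.nreg 3 * s.nreg 3 := Nat.mul_le_mul (by omega) (by omega)
      omega
    obtain ⟨f₀, a, h⟩ := he hlt'
    refine key _ ?_ ⟨f₀, a, ?_⟩ rfl rfl rfl ?_
    · exact hc.congr rfl rfl rfl rfl rfl rfl rfl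
    · exact h.congr rfl rfl rfl (fun _ _ _ => rfl) rfl rfl rfl rfl rfl
    · have : (s.nreg 3 + 1) * (d + 1) ≤ (q + 1) * (d + 1) := Nat.mul_le_mul_right _ hsq
      simp [Cmd.run]
      linarith
  · have hlt' : n ≤ s.nreg 3 * s.nreg 3 := by
      simp [hc.size] at hlt
      exact_mod_cast hlt
    -- The credit accumulated when an epoch ends covers the linear cost of the rebuild.
    have hsq : n ≤ (q + 1) * s.nreg 3 := by
      rcases Nat.lt_or_ge (q + 1) (s.nreg 3) with h | h
      · have : (q + 1) * (q + 1) ≤ (q + 1) * s.nreg 3 := Nat.mul_le_mul_left _ h.le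
        omega
      · exact hlt'.trans (Nat.mul_le_mul_right _ h)
    have hdq : d + 1 ≤ (q + 1) * (d + 1) := Nat.le_mul_of_pos_left _ (by omega)
    refine rebuild_det (n := n) (L := L) (F := F) (s := s.tick _) (hc.congr rfl rfl rfl rfl rfl rfl rfl) hO hn ?_
    intro t t1 t2 t3 t4 t5 t6
    refine key t (hc.congr ?_ ?_ ?_ ?_ ?_ ?_ ?_) ⟨_, _, t5⟩ ?_ ?_ ?_ ?_
    any_goals simp [t1, t2]
    rw [t4]
    simp at t6
    linarith

/-- With `k + 1` rounds left, the label says that the mean excess of the best prefix value over the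
remaining rounds is at most `8 / (L (k + 1))` times the present distance plus `1 / 4` per round.
Stopping realises the present prefix value; continuing replaces the distance by its expectation
after one step. The summand `1` keeps labels nonnegative. -/
theorem mainLoop_ens (hF : SubNat (liftNat F)) (hb : ∀ A, |liftNat F A| ≤ 1)
    (hO : IsEvalOracle F O) (hn : 0 < n) (hL : 0 < L) {d q B : ℕ} (hd : 2 * n ≤ 2 ^ d)
    (hq : n < (q + 1) * (q + 1)) {S : Finset ℕ} (hS : S ⊆ Finset.range n)
    {Ψ : State → ℝ → Prop}
    (hΨ : ∀ t x i, Core n L t → i ≤ n → t.tau ≤ B → pv (liftNat F) (t.narr 1) i + 1 ≤ x → Ψ t x) :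
    ∀ (k : ℕ) (s : State), Core n L s → s.nreg 2 = k + 1 →
      (s.nreg 3 * s.nreg 3 < n → ∃ f₀ a, Epoch (liftNat F) n f₀ a s) →
      s.tau + 400 * ((q + 1) * s.nreg 3) + 3000 * ((q + 1) * (d + 1)) * (k + 1) + 40 ≤ B →
      Ens O mainLoop s Ψ (liftNat F S + 1 + 8 / (L * (k + 1)) * (dist2 n L S s + (k + 1) / 4)) := by
  have hL' : (0 : ℝ) < L := by exact_mod_cast hL
  have hv : 0 ≤ liftNat F S + 1 := by linarith [(abs_le.mp (hb S)).1]
  intro k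
  induction k using Nat.strong_induction_on with
  | _ k ih =>
  intro s hc h2 he hB
  have hD := dist2_nonneg n L S s
  obtain ⟨i, hi, hmin⟩ := exists_pv_min (liftNat F) (s.narr 1) n
  have hdes := sum_stepChange_le hF hb hc hS hmin
  have hnn := add_sum_stepChange_nonneg hF hb hc S
  set m := pv (liftNat F) (s.narr 1) i with hm
  set Δ := ∑ p ∈ Finset.range n, |gr (liftNat F) (s.narr 1) p| * stepChange (liftNat F) L S s p
  have hm0 : 0 ≤ m + 1 := by
    have : -1 ≤ m := (abs_le.mp (hb ((Finset.range i).image (s.narr 1)))).1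
    linarith
  have hA : 0 ≤ liftNat F S + 1 + 2 / L := by positivity
  have hBk : (0 : ℝ) ≤ 8 / (L * k) := by positivity
  have hr₀ : 0 ≤ liftNat F S + 1 + 2 / L + 8 / (L * k) * (dist2 n L S s + Δ / 16) :=
    add_nonneg hA (mul_nonneg hBk hnn)
  unfold mainLoop
  refine Ens.loop_true (by simp [h2]) ?_
  refine Ens.cons (Ens.flip (p := 1 / ((k : ℝ) + 1)) (r₁ := m + 1)
    (r₀ := liftNat F S + 1 + 2 / L + 8 / (L * k) * (dist2 n L S s + Δ / 16)) ?_ ?_ ?_ ?_ ?_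
    (fun _ => ?_) (fun hp => ?_) ?_)
  · simp [h2]
  · positivity
  · rw [div_le_one (by positivity)]
    linarith [(Nat.cast_nonneg k : (0 : ℝ) ≤ k)]
  · exact hr₀
  · exact hm0
  · refine Ens.cons_det hm0 (Det.ite (fun _ => Det.atom (Ens.nil hm0
      (Ens.loop_false ?_ hm0 (hΨ _ _ i ?_ hi ?_ ?_)))) (fun hb' => absurd ?_ hb'))
    · simp [Cmd.run]
    · apply hc.congr <;> simp [Cmd.run]
    · simp [Cmd.run]
      omega
    · exact le_of_eq rfl
    · simp
  · have hk : k ≠ 0 := by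
      rintro rfl
      simp at hp
    obtain ⟨j, rfl⟩ := Nat.exists_eq_succ_of_ne_zero hk
    refine Ens.cons (Ens.ite (fun hb' => absurd hb' ?_) (fun _ => ?_))
    · simp
    refine Ens.cons_det hr₀ (Det.atom ?_)
    have hx := round_ens (s := (Cmd.run O (.nset 2 (.sub (.var 2) (.const 1)))
      ((((s.tick ((BExp.nlt (NExp.const 0) (NExp.var 2)).cost + 1)).setN 11 0).tick ((RExp.div (.ofNat (.const 1)) (.ofNat (.var 2))).cost + 1)).tick
        ((BExp.nlt (.const 0) (.var 11)).cost + 1))))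
      (Ψ := fun t x => Ens O (Cmd.block []) t (fun t x => Ens O mainLoop t Ψ x) x)
      hF hb hO hn hd hq S (hc.congr ?_ ?_ ?_ ?_ ?_ ?_ ?_) ?_ hA hBk ?_
    · exact hx
    any_goals (simp [Cmd.run]; done)
    · intro hlt
      obtain ⟨f₀, a, h⟩ := he (by simpa [Cmd.run] using hlt)
      exact ⟨f₀, a, by apply h.congr <;> simp [Cmd.run]⟩
    · rintro t x t1 ⟨f₀, a, t2⟩ t3 t4 t5
      have hx : 0 ≤ x := (add_nonneg hA (mul_nonneg hBk (dist2_nonneg n L S t))).trans t5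
      refine Ens.nil hx ?_
      refine (ih j (Nat.lt_succ_self j) _ ?_ ?_ (fun _ => ⟨f₀, a, ?_⟩) ?_).mono_bound ?_
      · exact t1.congr rfl rfl rfl rfl rfl rfl rfl
      · simp [t3, Cmd.run, h2]
      · exact t2.congr rfl rfl rfl (fun _ _ _ => rfl) rfl rfl rfl rfl rfl
      · simp [Cmd.run] at t4
        simp
        linarith
      · refine le_trans (le_of_eq ?_) t5
        have e : dist2 n L S (t.tick 1) = dist2 n L S t := rfl
        rw [e]
        push_cast
        field_simp
        ring
  -- In the last round the coin stops surely, and nonnegativity of the expected distance after one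
  -- step bounds the excess directly; the division by `k = 0` has coefficient zero.
  · rcases Nat.eq_zero_or_pos k with rfl | hk
    · have h1 : m - liftNat F S ≤ 8 / L * (dist2 n L S s + 1 / 4) := by
        rw [div_mul_eq_mul_div, le_div_iff₀ hL']
        linarith
      simp only [Nat.cast_zero, zero_add, mul_one, div_one, sub_self, zero_mul, add_zero, one_mul]
      linarith
    · have hk' : (0 : ℝ) < k := by exact_mod_cast hk
      -- The gain `L / 8 * (m - F S)` from stopping is exactly what the descent inequality subtracts
      -- from `Δ / 16`, which leaves `1 / 4` for this round.
      have h1 : 1 / ((k : ℝ) + 1) * (m + 1) + (1 - 1 / ((k : ℝ) + 1)) *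
          (liftNat F S + 1 + 2 / L + 8 / (L * k) * (dist2 n L S s + Δ / 16)) =
          liftNat F S + 1 + 8 / (L * (k + 1)) * (L / 8 * (m - liftNat F S) + k / 4 +
            (dist2 n L S s + Δ / 16)) := by
        field_simp
        ring
      rw [h1]
      refine add_le_add_right (mul_le_mul_of_nonneg_left ?_ (by positivity)) _
      linarith

end Parts


/-! ### Setup, and output of the best prefix -/

section Parts

variable {n L : ℕ} {F : Finset (Fin n) → ℝ} {O : Oracle} {s : State}

/-- Counting up to the first multiple of the real register `0` that is at least `c`. -/
theorem count_det {x : ℕ} {e : RExp} {c ε : ℝ} (hε : 0 < ε) (hc0 : 0 ≤ c) (hs : s.rreg 0 = ε)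
    (hx : s.nreg x = 0)
    (he : ∀ t : State, (∀ y, y ≠ x → t.nreg y = s.nreg y) → t.rreg = s.rreg → e.eval t = c)
    (hcost : e.cost ≤ 20) {Q : State → Prop}
    (hQ : ∀ t : State, (∀ y, y ≠ x → t.nreg y = s.nreg y) → t.narr = s.narr → t.rreg = s.rreg →
      c ≤ t.nreg x * ε → t.nreg x * ε ≤ c + ε → t.tau ≤ s.tau + 40 * (t.nreg x + 1) → Q t) :
    Det O (.loop (.rlt (.mul (.ofNat (.var x)) (.var 0)) e)
      (.nset x (.add (.var x) (.const 1)))) s Q := by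
  obtain ⟨N, hN⟩ : ∃ N : ℕ, c < N * ε := by
    obtain ⟨N, hN⟩ := exists_nat_gt (c / ε)
    exact ⟨N, by rwa [div_lt_iff₀ hε] at hN⟩
  refine Det.loop (fun m t => t.nreg x + m = N ∧ (∀ y, y ≠ x → t.nreg y = s.nreg y) ∧
    t.narr = s.narr ∧ t.rreg = s.rreg ∧ t.nreg x * ε ≤ c + ε ∧
    t.tau ≤ s.tau + 40 * t.nreg x) ?_ ?_ N s ?_
  · rintro m t ⟨i1, i2, i3, i4, i5, i6⟩ hb
    simp [he t i2 i4, i4, hs] at hb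
    have hlt : (t.nreg x : ℝ) < N := by
      by_contra hcon
      nlinarith
    have hlt' : t.nreg x < N := by exact_mod_cast hlt
    refine ⟨by omega, Det.atom ?_⟩
    simp [Cmd.run, i3, i4]
    refine ⟨by omega, ?_, by linarith, by omega⟩
    intro y hy
    simp [hy, i2]
  · rintro m t ⟨i1, i2, i3, i4, i5, i6⟩ hb
    simp [he t i2 i4, i4, hs] at hb
    exact hQ _ i2 i3 i4 hb i5 (by simp; omega)
  · simp [hx]
    linarith

theorem setup_det {ε : ℝ} (hn : 0 < n) (hε : 0 < ε) (h0 : s.nreg 0 = n)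
    (hz : ∀ x, x ≠ 0 → s.nreg x = 0) (hr : s.rreg 0 = ε) (ha : ∀ x i, s.narr x i = 0)
    {Q : State → Prop}
    (hQ : ∀ (L : ℕ) (t : State), Core n L t → (16 : ℝ) ≤ L * ε → L * ε ≤ 16 + ε →
      16 * (n * L) ≤ t.nreg 2 * ε → t.nreg 2 * ε ≤ 16 * (n * L) + ε → t.nreg 3 = n →
      (∀ i, t.narr 7 i = 0) → t.tau ≤ s.tau + 40 * (L + t.nreg 2 + n + 3) → Q t) :
    Det O setup s Q := by
  unfold setup
  refine Det.cons (count_det (c := 16) hε (by norm_num) hr (hz 1 (by omega)) ?_ ?_ ?_)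
  · intro t _ _
    simp
  · simp
  intro t t1 t2 t3 t4 t5 t6
  refine Det.cons (count_det (c := 16 * (n * t.nreg 1)) hε (by positivity) (by rw [t3, hr])
    (by rw [t1 2 (by omega), hz 2 (by omega)]) ?_ ?_ ?_)
  · intro u u1 u2
    simp [u1, t1, h0]
  · simp
  intro u u1 u2 u3 u4 u5 u6
  refine Det.cons (Det.atom ?_)
  refine Det.cons (Det.loop (fun m v => v.nreg 10 + m = n ∧ (∀ y, y < 3 → v.nreg y = u.nreg y) ∧
    v.nreg 3 = n ∧ (∀ x, x ≠ 1 → x ≠ 2 → v.narr x = s.narr x) ∧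
    (∀ i, i < v.nreg 10 → v.narr 1 i = i ∧ v.narr 2 i = i + 1) ∧
    v.tau ≤ u.tau + 4 + 36 * v.nreg 10) ?_ ?_ n _ ?_)
  · rintro m v ⟨i1, i2, i3, i4, i5, i6⟩ hb
    simp [i2 0 (by omega), u1 0 (by omega), t1 0 (by omega), h0] at hb
    refine ⟨by omega, ?_⟩
    repeat refine Det.cons (Det.atom ?_)
    apply Det.nil
    simp [Cmd.run, i3]
    refine ⟨by omega, ?_, ?_, ?_, by omega⟩
    · intro y hy
      have : y ≠ 10 := by omega
      simp [this, i2 y hy]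
    · intro x h1 h2
      simp [h1, h2, i4]
    · intro i hi
      by_cases h : i = v.nreg 10
      · simp [h]
      · simp [h, i5 i (by omega)]
  · rintro m v ⟨i1, i2, i3, i4, i5, i6⟩ hb
    simp [i2 0 (by omega), u1 0 (by omega), t1 0 (by omega), h0] at hb
    have h10 : v.nreg 10 = n := by omega
    rw [h10] at i5 i6
    have hv2 := i2 2 (by omega)
    have hv1 : v.nreg 1 = t.nreg 1 := by rw [i2 1 (by omega), u1 1 (by omega)]
    apply Det.nil
    refine hQ (t.nreg 1) _ ?_ t4 t5 ?_ ?_ i3 ?_ ?_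
    · constructor
      · simp [i2 0 (by omega), u1 0 (by omega), t1 0 (by omega), h0]
      · exact hv1
      · exact ⟨fun i hi => by simp [i5 i hi, hi], fun i hi j hj => by simp [i5 i hi, i5 j hj]⟩
      · intro i hi
        have := i5 i (by omega)
        simp [i5 (i + 1) hi, this]
      · intro i hi
        simp [i4, ha]
      · intro l hl i hi
        simp [i4, ha]
        omega
      · intro l hl
        simp [i4, ha]
      · intro i
        simp [i4, ha]
    · simpa [hv2] using u4
    · simpa [hv2] using u5
    · simp [i4, ha]
    · simp [hv2]
      omega
  · have h10 : u.nreg 10 = 0 := by rw [u1 10 (by omega), t1 10 (by omega), hz 10 (by omega)]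
    simp [Cmd.run, h10, u2, t2, u1, t1, h0]
    intro y hy h3
    omega

theorem finish_det (hc : Core n L s) (hO : IsEvalOracle F O) {Q : State → Prop}
    (hQ : ∀ t : State, (∀ i ≤ n, F (t.output n) ≤ pv (liftNat F) (s.narr 1) i) →
      t.tau ≤ s.tau + 100 * (n + 1) → Q t) :
    Det O finish s Q := by
  unfold finish
  repeat refine Det.cons (Det.atom ?_)
  refine Det.cons (Det.loop (fun m t => t.nreg 10 + m = n ∧ t.narr = s.narr ∧ t.nreg 0 = n ∧
    t.nreg 6 ≤ t.nreg 10 ∧ t.rreg 1 = pv (liftNat F) (s.narr 1) (t.nreg 6) ∧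
    (∀ i, i ≤ t.nreg 10 → pv (liftNat F) (s.narr 1) (t.nreg 6) ≤ pv (liftNat F) (s.narr 1) i) ∧
    t.tau ≤ s.tau + 20 + 40 * t.nreg 10) ?_ ?_ n _ ?_)
  · rintro m t ⟨i1, i2, i3, i4, i5, i6, i7⟩ hb
    simp [i3] at hb
    refine ⟨by omega, ?_⟩
    have hq := hc.query hO (show t.nreg 10 + 1 ≤ n by omega)
    repeat refine Det.cons (Det.atom ?_)
    have hcase : ∀ i, i ≤ t.nreg 10 + 1 → i ≤ t.nreg 10 ∨ i = t.nreg 10 + 1 := by omega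
    refine Det.cons (Det.ite (fun hlt => ?_) (fun hlt => Det.atom (Det.nil ?_)))
    · repeat refine Det.cons (Det.atom ?_)
      apply Det.nil
      apply Det.nil
      simp [Cmd.run, i2, hq, i5] at hlt
      simp [Cmd.run, i2, i3, hq]
      refine ⟨by omega, ?_, by omega⟩
      intro i hi
      rcases hcase i hi with h | rfl
      · exact hlt.le.trans (i6 i h)
      · exact le_rfl
    · simp [Cmd.run, i2, hq, i5] at hlt
      simp [Cmd.run, i2, i3, i5]
      refine ⟨by omega, by omega, ?_, by omega⟩
      intro i hi
      rcases hcase i hi with h | rfl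
      · exact i6 i h
      · exact hlt
  · rintro m t ⟨i1, i2, i3, i4, i5, i6, i7⟩ hb
    simp [i3] at hb
    obtain ⟨j, hj⟩ : ∃ j, t.nreg 6 = j := ⟨_, rfl⟩
    have hjn : j ≤ n := by omega
    repeat refine Det.cons (Det.atom ?_)
    refine Det.cons (Det.loop (fun m u => u.nreg 10 + m = j ∧ u.narr 1 = s.narr 1 ∧ u.nreg 6 = j ∧
      (∀ v, u.narr 0 v ≠ 0 ↔ ∃ i, i < u.nreg 10 ∧ s.narr 1 i = v) ∧
      u.tau ≤ t.tau + 20 + 40 * u.nreg 10) ?_ ?_ j _ ?_)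
    · rintro m u ⟨k1, k2, k3, k4, k5⟩ hb
      simp [k3] at hb
      refine ⟨by omega, ?_⟩
      repeat refine Det.cons (Det.atom ?_)
      apply Det.nil
      simp [Cmd.run, k2, k3]
      refine ⟨by omega, ?_, by omega⟩
      intro v
      rw [Function.update_apply]
      split_ifs with h
      · simpa using ⟨_, le_rfl, h.symm⟩
      · refine (k4 v).trans ⟨fun ⟨i, hi, hv⟩ => ⟨i, hi.le, hv⟩, fun ⟨i, hi, hv⟩ => ⟨i, ?_, hv⟩⟩
        exact lt_of_le_of_ne hi fun h' => h (by rw [← hv, h'])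
    · rintro m u ⟨k1, k2, k3, k4, k5⟩ hb
      simp [k3] at hb
      apply Det.nil
      have h10 : u.nreg 10 = j := by omega
      rw [h10] at k4 k5
      refine hQ _ ?_ (by simp; omega)
      intro i hi
      refine le_trans (le_of_eq ?_) (i6 i (by omega))
      rw [hj]
      unfold pv liftNat State.output
      congr 1
      ext v
      simp [k4]
    · simp [Cmd.run, i2, hj, hc.out]
  · simp [Cmd.run, hc.size, hc.query hO (Nat.zero_le n)]

end Parts


/-! ### From labels to expectations, the constants, and the conclusion -/

theorem Ens.exists_exec {O : Oracle} {c : Cmd} {s : State} {Ψ : State → ℝ → Prop} {r : ℝ}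
    (h : Ens O c s Ψ r) (hr : 0 ≤ r) {α : Type*} [Fintype α] (f : State → α) {g : α → ℝ}
    (hg : ∀ a, 0 ≤ g a + 1) (hΨ : ∀ t x, Ψ t x → g (f t) + 1 ≤ x) :
    ∃ μ : PMF State, Exec O c s μ ∧ ∑ a, ((μ.map f) a).toReal * g a ≤ r - 1 ∧
      ∀ t ∈ μ.support, ∃ x, Ψ t x := by
  obtain ⟨ν, h₁, h₂, h₃⟩ := h
  refine ⟨ν.map Prod.fst, h₁, ?_, ?_⟩
  · set κ := (ν.map Prod.fst).map f with hκ
    have e1 : ∑ a, κ a * ENNReal.ofReal (g a + 1) ≤ ENNReal.ofReal r := by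
      rw [← tsum_fintype (L := SummationFilter.unconditional α), hκ, PMF.map_comp,
        ← PMF.bind_pure_comp, Ens.tsum_bind]
      refine le_trans (ENNReal.tsum_le_tsum fun y => ?_) h₃
      simp only [Function.comp, Ens.tsum_pure]
      by_cases hy : ν y = 0
      · simp [hy]
      · gcongr
        exact hΨ _ _ (h₂ y ((PMF.mem_support_iff ν y).mpr hy)).2
    have e2 : ∑ a, (κ a).toReal * (g a + 1) ≤ r := by
      have := ENNReal.toReal_mono ENNReal.ofReal_ne_top e1
      rw [ENNReal.toReal_ofReal hr, ENNReal.toReal_sum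
        fun a _ => ENNReal.mul_ne_top (PMF.apply_ne_top κ a) ENNReal.ofReal_ne_top] at this
      simpa only [ENNReal.toReal_mul, ENNReal.toReal_ofReal (hg _)] using this
    have e3 : ∑ a, (κ a).toReal = 1 := by
      rw [← ENNReal.toReal_sum fun a _ => PMF.apply_ne_top κ a,
        ← tsum_fintype (L := SummationFilter.unconditional α), PMF.tsum_coe, ENNReal.toReal_one]
    simp only [mul_add, mul_one, Finset.sum_add_distrib, e3] at e2
    linarith
  · intro t ht
    obtain ⟨y, hy, rfl⟩ := (PMF.mem_support_map_iff _ _ _).mp ht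
    exact ⟨y.2, (h₂ y hy).2⟩

theorem nat_log_add_three_le (n : ℕ) (hn : 0 < n) :
    ((Nat.log 2 n + 3 : ℕ) : ℝ) ≤ 6 * Real.log (n + 2) := by
  have hn' : (0 : ℝ) < n := by exact_mod_cast hn
  have h1 : (Nat.log 2 n : ℝ) * Real.log 2 ≤ Real.log (n + 2) := by
    rw [← Real.log_pow]
    refine Real.log_le_log (by positivity) ?_
    have : ((2 ^ Nat.log 2 n : ℕ) : ℝ) ≤ n := by exact_mod_cast Nat.pow_log_le_self 2 hn.ne'
    push_cast at this
    linarith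
  have h2 : Real.log 2 ≤ Real.log (n + 2) := Real.log_le_log (by norm_num) (by linarith)
  have h3 := Real.log_two_gt_d9
  push_cast
  nlinarith [(Nat.cast_nonneg (Nat.log 2 n) : (0 : ℝ) ≤ Nat.log 2 n)]

/-- From `L ε ≤ 18` one gets `K ε² ≤ 16 · 18 n + 4 ≤ 292 n`. -/
theorem rounds_le {n L K : ℕ} {ε : ℝ} (hn : 0 < n) (hε : 0 < ε) (hε2 : ε < 2)
    (hL : L * ε ≤ 16 + ε) (hK : K * ε ≤ 16 * (n * L) + ε) : (K : ℝ) ≤ 292 * n / ε ^ 2 := by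
  have hn' : (1 : ℝ) ≤ n := by exact_mod_cast hn
  rw [le_div_iff₀ (by positivity)]
  have h1 : (K : ℝ) * ε * ε ≤ (16 * (n * L) + ε) * ε := mul_le_mul_of_nonneg_right hK hε.le
  have h2 : (n : ℝ) * (L * ε) ≤ n * 18 := mul_le_mul_of_nonneg_left (by linarith) (by linarith)
  nlinarith

theorem time_bound_le {n L K : ℕ} {ε : ℝ} (hn : 0 < n) (hε : 0 < ε) (hε2 : ε < 2)
    (hL : L * ε ≤ 16 + ε) (hK : K * ε ≤ 16 * (n * L) + ε) :
    (((Nat.sqrt n + 1) * (Nat.log 2 n + 3) * K : ℕ) : ℝ) ≤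
      3504 * (Real.log (n + 2) * ((n : ℝ) ^ (3 / 2 : ℝ) / ε ^ 2)) := by
  have hn' : (1 : ℝ) ≤ n := by exact_mod_cast hn
  have h1 : ((Nat.sqrt n + 1 : ℕ) : ℝ) ≤ 2 * √n := by
    have a1 : (Nat.sqrt n : ℝ) ≤ √n := Real.nat_sqrt_le_real_sqrt
    have a2 : 1 ≤ √(n : ℝ) := Real.one_le_sqrt.mpr hn'
    push_cast
    linarith
  have h2 := nat_log_add_three_le n hn
  have h3 := rounds_le hn hε hε2 hL hK
  have e : (n : ℝ) ^ (3 / 2 : ℝ) = n * √n := by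
    rw [show (3 / 2 : ℝ) = 1 + 1 / 2 by norm_num, Real.rpow_add (by linarith), Real.rpow_one,
      Real.sqrt_eq_rpow]
  rw [e, Nat.cast_mul, Nat.cast_mul]
  calc ((Nat.sqrt n + 1 : ℕ) : ℝ) * ((Nat.log 2 n + 3 : ℕ) : ℝ) * K
      ≤ (2 * √n) * (6 * Real.log (n + 2)) * (292 * n / ε ^ 2) := by
        gcongr
        exact mul_nonneg (by positivity) ((Nat.cast_nonneg _).trans h2)
    _ = 3504 * (Real.log (n + 2) * (n * √n / ε ^ 2)) := by ring

section Parts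

variable {n : ℕ} {F : Finset (Fin n) → ℝ} {O : Oracle}

theorem dist2_le {L : ℕ} {S : Finset ℕ} {s : State} (h : ∀ i, s.narr 7 i = 0) :
    dist2 n L S s ≤ n * (L : ℝ) ^ 2 := by
  unfold dist2
  refine (Finset.sum_le_sum (g := fun _ => (L : ℝ) ^ 2) fun i _ => ?_).trans (by simp)
  rw [h]
  split_ifs
  · simp
  · simp

theorem sfm_ens (hF : SubNat (liftNat F)) (hb : ∀ A, |liftNat F A| ≤ 1) (hO : IsEvalOracle F O)
    {ε : ℝ} (hn : 0 < n) (hε : 0 < ε) (hε2 : ε < 2) {S : Finset ℕ} (hS : S ⊆ Finset.range n) :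
    Ens O sfm (State.init n ε) (fun t x => F (t.output n) + 1 ≤ x ∧
      (t.tau : ℝ) ≤ 4000 * (3504 * (Real.log (n + 2) * ((n : ℝ) ^ (3 / 2 : ℝ) / ε ^ 2))))
      (liftNat F S + 1 + ε) := by
  have hv : 0 ≤ liftNat F S + 1 := by linarith [(abs_le.mp (hb S)).1]
  have hr : 0 ≤ liftNat F S + 1 + ε := by linarith
  unfold sfm
  refine Ens.ite (fun _ => ?_) (fun h => absurd ?_ h)
  · refine Ens.cons_det hr (setup_det hn hε ?_ ?_ ?_ ?_ ?_)
    · simp [State.init]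
    · intro x hx
      simp [State.init, hx]
    · simp [State.init]
    · intro x i
      simp [State.init]
    intro L t hc hL1 hL2 hK1 hK2 h3 h7 ht
    have hn' : (1 : ℝ) ≤ n := by exact_mod_cast hn
    have hL' : (0 : ℝ) < L := by
      by_contra hcon
      nlinarith
    have hL : 0 < L := by exact_mod_cast hL'
    have hnLK : n * L ≤ t.nreg 2 := by
      have : (n : ℝ) * L ≤ t.nreg 2 := by
        have : (0 : ℝ) ≤ t.nreg 2 := Nat.cast_nonneg _
        nlinarith
      exact_mod_cast this
    have hnK : n ≤ t.nreg 2 := (Nat.le_mul_of_pos_right n hL).trans hnLK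
    have hLK : L ≤ t.nreg 2 := (Nat.le_mul_of_pos_left L hn).trans hnLK
    obtain ⟨k, hk⟩ : ∃ k, t.nreg 2 = k + 1 := ⟨t.nreg 2 - 1, by omega⟩
    have hB := time_bound_le hn hε hε2 hL2 hK2
    set q := Nat.sqrt n with hqd
    have hpow : 2 * n ≤ 2 ^ (Nat.log 2 n + 2) := by
      have := Nat.lt_pow_succ_log_self (b := 2) (by norm_num) n
      rw [pow_succ] at this ⊢
      omega
    have hq : n < (q + 1) * (q + 1) := Nat.lt_succ_sqrt n
    refine Ens.cons ((mainLoop_ens (L := L) (d := Nat.log 2 n + 2) (q := q)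
      (B := t.tau + 400 * ((q + 1) * t.nreg 3) +
        3000 * ((q + 1) * (Nat.log 2 n + 2 + 1)) * (k + 1) + 40)
      hF hb hO hn hL hpow hq hS ?_ k t hc hk ?_ le_rfl).mono_bound ?_)
    · intro u x i hu hi hut hx
      have hx0 : 0 ≤ x := by
        have : -1 ≤ pv (liftNat F) (u.narr 1) i := (abs_le.mp (hb _)).1
        linarith
      refine Ens.cons_det hx0 (finish_det hu hO fun v hv1 hv2 => Ens.nil hx0 ⟨?_, ?_⟩)
      · have : F ((v.tick 1).output n) ≤ pv (liftNat F) (u.narr 1) i := hv1 i hi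
        linarith
      · refine le_trans ?_ (mul_le_mul_of_nonneg_left hB (by norm_num))
        rw [← hk, h3] at hut
        have b1 : 1 ≤ (q + 1) * (Nat.log 2 n + 3) := Nat.one_le_iff_ne_zero.mpr (by positivity)
        have b2 : t.nreg 2 ≤ (q + 1) * (Nat.log 2 n + 3) * t.nreg 2 := Nat.le_mul_of_pos_left _ b1
        have b3 : (q + 1) * n ≤ (q + 1) * (Nat.log 2 n + 3) * t.nreg 2 := by
          rw [mul_assoc]
          exact Nat.mul_le_mul_left _ (hnK.trans (Nat.le_mul_of_pos_left _ (by omega)))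
        have b4 : (State.tick (State.init n ε) ((BExp.and (.nlt (.const 0) (.var 0))
          (.rlt (.var 0) (.ofNat (.const 2)))).cost + 1)).tau = 9 := by
          simp [State.init, State.tau, State.tick]
        rw [b4] at ht
        have : (v.tick 1).tau ≤ 4000 * ((q + 1) * (Nat.log 2 n + 3) * t.nreg 2) := by
          have b5 : 3000 * ((q + 1) * (Nat.log 2 n + 2 + 1)) * t.nreg 2 =
            3000 * ((q + 1) * (Nat.log 2 n + 3) * t.nreg 2) := by ring
          rw [b5] at hut
          rw [State.tick_tau]
          omega
        exact_mod_cast this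
    -- Vacuous: the touched count is set to `n`, so no epoch is claimed before the first rebuild.
    · intro hlt
      rw [h3] at hlt
      exact absurd hlt (not_lt.mpr (Nat.le_mul_self n))
    · have hD := dist2_le (n := n) (L := L) (S := S) h7
      have hkr : (t.nreg 2 : ℝ) = k + 1 := by rw [hk]; push_cast; ring
      rw [hkr] at hK1
      have hk0 : (0 : ℝ) < k + 1 := by positivity
      -- All levels start at zero, so the distance is at most `n L²`. The choice of the number of
      -- rounds makes the first part at most `ε / 2`, and `L ε ≥ 16` makes the second, `2 / L`, at
      -- most `ε / 8`.
      have e1 : 8 / (L * ((k : ℝ) + 1)) * (dist2 n L S t + (k + 1) / 4) ≤ ε := by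
        rw [div_mul_eq_mul_div, div_le_iff₀ (by positivity)]
        nlinarith
      linarith
  · simp [State.init, hn, hε2]

theorem abs_liftNat_le (h : ∀ S, F S ∈ Set.Icc (-1 : ℝ) 1) (A : Finset ℕ) : |liftNat F A| ≤ 1 :=
  abs_le.mpr (h _)

theorem liftNat_image (S : Finset (Fin n)) : liftNat F (S.image Fin.val) = F S := by
  unfold liftNat
  congr 1
  ext v
  simp [Fin.val_inj]

end Parts

theorem sum_pure_toReal {α : Type*} [Fintype α] (a : α) (g : α → ℝ) :
    ∑ b, (PMF.pure a b).toReal * g b = g a := by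
  rw [Finset.sum_eq_single_of_mem a (Finset.mem_univ _) fun b _ hb => by
    rw [PMF.pure_apply_of_ne _ _ hb, ENNReal.toReal_zero, zero_mul]]
  rw [PMF.pure_apply_self, ENNReal.toReal_one, one_mul]

theorem mainTheorem1 :
    ∃ (prog : Cmd) (C : ℝ) (k : ℕ), 0 < C ∧
      ∀ (n : ℕ) (F : Finset (Fin n) → ℝ) (O : Oracle) (ε EO : ℝ),
        IsSubmodular F → (∀ S, F S ∈ Set.Icc (-1 : ℝ) 1) → IsEvalOracle F O →
        0 < ε → 1 ≤ EO →
        ∃ μ : PMF State, Exec O prog (State.init n ε) μ ∧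
          (∑ S : Finset (Fin n), ((μ.map (State.output n)) S).toReal * F S
            ≤ Finset.univ.inf' Finset.univ_nonempty F + ε) ∧
          (∀ s ∈ μ.support,
            s.time EO ≤
              C * Real.log ((n : ℝ) + 2) ^ k * max 1 ((n : ℝ) ^ (3 / 2 : ℝ) / ε ^ 2) * EO) := by
  refine ⟨sfm, 4000 * 3504, 1, by norm_num, ?_⟩
  intro n F O ε EO hF hF1 hO hε hEO
  obtain ⟨S₀, -, hS₀⟩ := Finset.exists_mem_eq_inf' Finset.univ_nonempty F
  have hlog : Real.log 2 ≤ Real.log (n + 2) :=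
    Real.log_le_log (by norm_num) (by linarith [(Nat.cast_nonneg n : (0 : ℝ) ≤ n)])
  have hlog2 := Real.log_two_gt_d9
  have htime : ∀ s : State, (s.tau : ℝ) ≤ 4000 * (3504 * (Real.log (n + 2) *
      max 1 ((n : ℝ) ^ (3 / 2 : ℝ) / ε ^ 2))) → s.time EO ≤
        4000 * 3504 * Real.log ((n : ℝ) + 2) ^ 1 * max 1 ((n : ℝ) ^ (3 / 2 : ℝ) / ε ^ 2) * EO := by
    intro s hs
    refine (s.time_le_tau hEO).trans (mul_le_mul_of_nonneg_right (hs.trans (le_of_eq ?_)) (by linarith))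
    ring
  by_cases hcase : 0 < n ∧ ε < 2
  · have hens := sfm_ens hF.liftNat (abs_liftNat_le hF1) hO hcase.1 hε hcase.2
      (S := S₀.image Fin.val) (fun x hx => by
        obtain ⟨v, -, rfl⟩ := Finset.mem_image.mp hx
        exact Finset.mem_range.mpr v.2)
    rw [liftNat_image] at hens
    obtain ⟨μ, h1, h2, h3⟩ := hens.exists_exec (by linarith [(hF1 S₀).1]) (State.output n) (g := F)
      (fun S => by linarith [(hF1 S).1]) (fun t x h => h.1)
    refine ⟨μ, h1, by rw [hS₀]; linarith, fun s hs => htime s ?_⟩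
    obtain ⟨x, -, hx⟩ := h3 s hs
    refine hx.trans ?_
    gcongr
    · exact (Real.log_nonneg (by linarith [(Nat.cast_nonneg n : (0 : ℝ) ≤ n)]))
    · exact le_max_right _ _
  -- The trivial case takes constant time, covered by the `1` in the maximum.
  · refine ⟨_, Exec.ite_false _ _ _ _ _ ?_ (Exec.skip _), ?_, ?_⟩
    · simpa [State.init] using hcase
    · rw [PMF.pure_map, hS₀]
      have hle : ∀ S, F S ≤ F S₀ + ε := by
        intro S
        rcases Nat.eq_zero_or_pos n with rfl | hn
        · rw [Subsingleton.elim S S₀]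
          linarith
        · have : 2 ≤ ε := not_lt.mp fun h => hcase ⟨hn, h⟩
          linarith [(hF1 S₀).1, (hF1 S).2]
      rw [sum_pure_toReal]
      exact hle _
    · intro s hs
      rw [PMF.support_pure, Set.mem_singleton_iff] at hs
      refine htime s ?_
      have h10 : s.tau = 10 := by
        rw [hs]
        simp [State.init, State.tau, State.tick]
      rw [h10]
      have hm := le_max_left (1 : ℝ) ((n : ℝ) ^ (3 / 2 : ℝ) / ε ^ 2)
      push_cast
      nlinarith
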